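/- **Rectangles and toggles.** Let $R=[r]\times[s]$ with the componentwise order (any rectangle $[i_0,i_1]\times[j_0,j_1]\subset\mathbb Z^2$ is treated in the same way after translation). The up-diagonals are the sets $i=\mathrm{const}$, the down-diagonals the sets $j=\mathrm{const}$, and the $k$-th file $F_k$ is the set of $(i,j)\in R$ with $i-j=k$. The piecewise-linear toggle $t_p:\mathbb R^R\to\mathbb R^R$ replaces the label $x_p$ by $\min_{q\gtrdot p}x_q+\max_{q\lessdot p}x_q-x_p$ and fixes all other labels, with empty maximum $0$ and empty minimum $1$. For $I\subseteq R$ put $\rho_I=t_{p_1}\circ\cdots\circ t_{p_n}$, where $p_1,\dots,p_n$ are the elements of $I$ in the order of a linear extension. Write $\rho=\rho_R$, and write $\rho_{i,j}$ for $\rho_I$ with $I$ the order ideal generated by $(i,j)$. The transfer map $\phi:\mathbb R^R\to\mathbb R^R$ is the bijection $x_p\mapsto x_p-\max_{q\lessdot p}x_q$ (empty maximum $0$). With $m=\min\{r,s\}$ let $$\mathrm{RSK}=\rho^{-1}_{r-m+1,s-m+1}\circ\cdots\circ\rho^{-1}_{r-1,s-1}\circ\phi^{-1},$$ $$\mathrm{Pro}^P=\rho_{F_{r-s+1}}\circ\cdots\circ\rho_{F_{r-1}},\qquad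 \mathrm{Pro}^Q=\rho_{F_{r-s-1}}\circ\cdots\circ\rho_{F_{1-s}}.$$ **Shifts.** A moon polyomino is a finite subset of $\mathbb Z^2$ whose up- and down-diagonals are intervals and whose up-diagonals, viewed as sets of values of $j$, are pairwise comparable under inclusion. Let $R$ be a maximal (nonempty) rectangle of a moon polyomino $\mathcal M$. To each of the maps $$\mathrm{RSK}^{-1}\circ\mathrm{Pro}^P\circ\mathrm{RSK},\qquad \mathrm{RSK}^{-1}\circ\mathrm{Pro}^Q\circ\mathrm{RSK},\qquad \phi\circ\rho^{-1}\circ\phi^{-1}$$ on $\mathbb R^R$ we associate a shift of the boxes of $\mathcal M$ that fixes the boxes of $R$. The first map moves the boxes outside $R$ lying in down-diagonals that meet $R$ by $(0,-1)$. The second moves the boxes outside $R$ lying in up-diagonals that meet $R$ by $(-1,0)$. The third does both. If the resulting polyomino $\mathcal N$ is again a moon polyomino, the map extends to $\psi:\mathbb R^{\mathcal M}\to\mathbb R^{\mathcal N}$ by applying it to the labels in $R$ and carrying the labels outside $R$ along with their boxes. Every other maximal rectangle $S$ of $\mathcal M$ corresponds to the rectangle of $\mathcal N$ that is the translate of $S$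 by the vector by which the boxes of $S\setminus R$ move (possibly $0$). **Theorem.** (1) Let $R_1\neq R_2$ be maximal rectangles of a moon polyomino $\mathcal M$. For $a=1,2$ let $\psi_a$ be one of the three maps above acting on $R_a$, such that the resulting polyomino $\mathcal N_a$ is a moon polyomino. Then the rectangle $R_2'$ of $\mathcal N_1$ corresponding to $R_2$ and the rectangle $R_1'$ of $\mathcal N_2$ corresponding to $R_1$ are maximal, the shifts of the types of $\psi_2$ on $R_2'\subseteq\mathcal N_1$ and of $\psi_1$ on $R_1'\subseteq\mathcal N_2$ lead to one and the same moon polyomino $\mathcal K$, and $$\psi_1\circ\psi_2=\psi_2\circ\psi_1:\ \mathbb R^{\mathcal M}\to\mathbb R^{\mathcal K}.$$ (2) Suppose that $\mathcal N$ is obtained from $\mathcal M$ by a finite sequence of shifts of the first two types and inverses of such shifts, each of which moves at least one box. Then the composite of the corresponding maps and inverse maps is a bijection $\Omega_{\mathcal M\to\mathcal N}:\mathbb R^{\mathcal M}\to\mathbb R^{\mathcal N}$ that depends only on $\mathcal M$ and $\mathcal N$: any two such sequences from $\mathcal M$ to $\mathcal N$ give the same bijection. -/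

import Mathlib

noncomputable section

open scoped Classical in
/-- The elements of a finite poset covered by `p`. -/
def lowerCovers {P : Type*} [PartialOrder P] [Fintype P] (p : P) : Finset P :=
  Finset.univ.filter (fun q => q ⋖ p)

open scoped Classical in
/-- The elements of a finite poset covering `p`. -/
def upperCovers {P : Type*} [PartialOrder P] [Fintype P] (p : P) : Finset P :=
  Finset.univ.filter (fun q => p ⋖ q)

open scoped Classical in
/-- `max_{q ⋖ p} x_q`, where the empty maximum is `0`. -/
def maxBelow {P : Type*} [PartialOrder P] [Fintype P] (x : P → ℝ) (p : P) : ℝ :=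
  if h : (lowerCovers p).Nonempty then (lowerCovers p).sup' h x else 0

open scoped Classical in
/-- `min_{q ⋗ p} x_q`, where the empty minimum is `1`. -/
def minAbove {P : Type*} [PartialOrder P] [Fintype P] (x : P → ℝ) (p : P) : ℝ :=
  if h : (upperCovers p).Nonempty then (upperCovers p).inf' h x else 1

theorem maxBelow_congr {P : Type*} [PartialOrder P] [Fintype P] {x y : P → ℝ} {p : P}
    (h : ∀ q, q < p → x q = y q) : maxBelow x p = maxBelow y p := by
  unfold maxBelow
  split_ifs with hne
  · refine Finset.sup'_congr hne rfl (fun q hq => h q ?_)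
    simp only [lowerCovers, Finset.mem_filter] at hq
    exact hq.2.lt
  · rfl

theorem minAbove_congr {P : Type*} [PartialOrder P] [Fintype P] {x y : P → ℝ} {p : P}
    (h : ∀ q, p < q → x q = y q) : minAbove x p = minAbove y p := by
  unfold minAbove
  split_ifs with hne
  · refine Finset.inf'_congr hne rfl (fun q hq => h q ?_)
    simp only [upperCovers, Finset.mem_filter] at hq
    exact hq.2.lt
  · rfl

open scoped Classical in
/-- The function underlying the piecewise-linear toggle at `p`. -/
def toggleFun {P : Type*} [PartialOrder P] [Fintype P] (p : P) (x : P → ℝ) : P → ℝ :=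
  Function.update x p (minAbove x p + maxBelow x p - x p)

theorem toggleFun_involutive {P : Type*} [PartialOrder P] [Fintype P] (p : P) :
    Function.Involutive (toggleFun p) := by
  classical
  intro x
  have h1 : minAbove (toggleFun p x) p = minAbove x p :=
    minAbove_congr (fun q hq => by simp [toggleFun, Function.update_of_ne hq.ne'])
  have h2 : maxBelow (toggleFun p x) p = maxBelow x p :=
    maxBelow_congr (fun q hq => by simp [toggleFun, Function.update_of_ne hq.ne])
  have h3 : toggleFun p x p = minAbove x p + maxBelow x p - x p := by simp [toggleFun]
  funext q
  rw [toggleFun, h1, h2, h3]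
  by_cases hq : q = p
  · subst hq
    simp
  · simp [toggleFun, Function.update_of_ne hq]

/-- The piecewise-linear toggle `t_p`, as a permutation of `ℝ^P`. In `Equiv.Perm (P → ℝ)` the
product `f * g` is the composition `f ∘ g` and `f⁻¹` is the inverse map. -/
def toggle {P : Type*} [PartialOrder P] [Fintype P] (p : P) : Equiv.Perm (P → ℝ) :=
  (toggleFun_involutive p).toPerm

/-- The function underlying the transfer map, `x_p ↦ x_p - max_{q ⋖ p} x_q`. -/
def transferFun {P : Type*} [PartialOrder P] [Fintype P] (x : P → ℝ) : P → ℝ :=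
  fun p => x p - maxBelow x p

open scoped Classical in
/-- The inverse `y` of the transfer map, by recursion: `y_p = x_p + max_{q ⋖ p} y_q`, that is, the
maximal weight of a saturated chain from a minimal element up to `p`. -/
def transferInv {P : Type*} [PartialOrder P] [Fintype P] (x : P → ℝ) : P → ℝ :=
  (wellFounded_lt (α := P)).fix
    (fun p ih => x p + maxBelow (fun q => if h : q < p then ih q h else 0) p)

theorem transferInv_eq {P : Type*} [PartialOrder P] [Fintype P] (x : P → ℝ) (p : P) :
    transferInv x p = x p + maxBelow (transferInv x) p := by
  classical
  rw [transferInv, WellFounded.fix_eq]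
  congr 1
  refine maxBelow_congr (fun q hq => ?_)
  simp [hq]

/-- The transfer map `φ`, as a permutation of `ℝ^P`. -/
def transfer {P : Type*} [PartialOrder P] [Fintype P] : Equiv.Perm (P → ℝ) where
  toFun := transferFun
  invFun := transferInv
  left_inv x := by
    funext p
    induction p using (wellFounded_lt (α := P)).induction with
    | _ p ih =>
      rw [transferInv_eq, maxBelow_congr (fun q hq => ih q hq)]
      simp [transferFun]
  right_inv x := by
    funext p
    rw [transferFun, transferInv_eq]
    ring

open scoped Classical in
/-- The elements of `I` in increasing order with respect to a linear extension of `P`. -/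
def linearList {P : Type*} [PartialOrder P] (I : Finset P) : List P :=
  Finset.sort (α := LinearExtension P) I (· ≤ ·)

/-- Piecewise-linear rowmotion `ρ_I = t_{p₁} ∘ ⋯ ∘ t_{pₙ}` for `p₁, …, pₙ` the elements of `I` in the
order of a linear extension (toggle from the top of `I` to the bottom). It does not depend on the
linear extension, because toggles at elements that form no cover relation commute. -/
def rowmotion {P : Type*} [PartialOrder P] [Fintype P] (I : Finset P) : Equiv.Perm (P → ℝ) :=
  ((linearList I).map toggle).prod

/-- A nonempty rectangle `[i₀, i₁] × [j₀, j₁]` in `ℤ × ℤ`. Up-diagonals are the sets `i = const` and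
down-diagonals the sets `j = const`. The standard rectangle `[r] × [s]` is the case `i₀ = j₀ = 1`,
`i₁ = r`, `j₁ = s`. -/
@[ext]
structure Rectangle where
  i₀ : ℤ
  i₁ : ℤ
  j₀ : ℤ
  j₁ : ℤ
  hi : i₀ ≤ i₁
  hj : j₀ ≤ j₁

/-- The boxes of a rectangle; the subtype carries the componentwise order of `ℤ × ℤ`. -/
def Rectangle.boxes (R : Rectangle) : Finset (ℤ × ℤ) :=
  Finset.Icc R.i₀ R.i₁ ×ˢ Finset.Icc R.j₀ R.j₁

/-- The number `r` of up-diagonals of a rectangle. -/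
def Rectangle.numRows (R : Rectangle) : ℕ := (R.i₁ - R.i₀ + 1).toNat

/-- The number `s` of down-diagonals of a rectangle. -/
def Rectangle.numCols (R : Rectangle) : ℕ := (R.j₁ - R.j₀ + 1).toNat

/-- The order ideal of elements of the rectangle that are below `(i, j)`. -/
def Rectangle.ideal (R : Rectangle) (i j : ℤ) : Finset R.boxes :=
  Finset.univ.filter (fun p => p.1.1 ≤ i ∧ p.1.2 ≤ j)

/-- The file of elements `(i, j)` of the rectangle with `i - j = k`. The top element lies in the file
`i₁ - j₁`; elements in files of larger index lie to the left of it. -/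
def Rectangle.file (R : Rectangle) (k : ℤ) : Finset R.boxes :=
  Finset.univ.filter (fun p => p.1.1 - p.1.2 = k)

/-- With `m = min r s`, piecewise-linear RSK is
`ρ⁻¹_{(r-m+1, s-m+1)} ∘ ⋯ ∘ ρ⁻¹_{(r-2, s-2)} ∘ ρ⁻¹_{(r-1, s-1)} ∘ φ⁻¹`, where the subscript `(i, j)`
stands for the order ideal generated by `(i, j)`, and `(r, s)` is the top element `(i₁, j₁)`. -/
def RSK (R : Rectangle) : Equiv.Perm (R.boxes → ℝ) :=
  let m : ℕ := min R.numRows R.numCols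
  ((List.range (m - 1)).map (fun t =>
    (rowmotion (R.ideal (R.i₁ - m + 1 + t) (R.j₁ - m + 1 + t)))⁻¹)).prod * transfer⁻¹

/-- `Pro^P = ρ_{F_{r-s+1}} ∘ ⋯ ∘ ρ_{F_{r-1}}`: toggles in the files strictly left of the top element,
the leftmost file first. -/
def ProP (R : Rectangle) : Equiv.Perm (R.boxes → ℝ) :=
  ((List.range (R.numCols - 1)).map (fun t =>
    rowmotion (R.file (R.i₁ - R.j₁ + 1 + t)))).prod

/-- The transpose `Pro^Q = ρ_{F_{r-s-1}} ∘ ⋯ ∘ ρ_{F_{1-s}}` of `Pro^P`: toggles in the files strictly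
right of the top element, the rightmost file first. -/
def ProQ (R : Rectangle) : Equiv.Perm (R.boxes → ℝ) :=
  ((List.range (R.numRows - 1)).map (fun t =>
    rowmotion (R.file (R.i₁ - R.j₁ - 1 - t)))).prod

/-- Names for the three maps `RSK⁻¹ ∘ Pro^P ∘ RSK`, `RSK⁻¹ ∘ Pro^Q ∘ RSK`, `φ ∘ ρ⁻¹ ∘ φ⁻¹`. -/
inductive ShiftKind where
  | proP
  | proQ
  | row

/-- The map of the given kind on labelings of a rectangle. -/
def rectMap (k : ShiftKind) (R : Rectangle) : Equiv.Perm (R.boxes → ℝ) :=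
  match k with
  | .proP => (RSK R)⁻¹ * ProP R * RSK R
  | .proQ => (RSK R)⁻¹ * ProQ R * RSK R
  | .row => transfer * (rowmotion Finset.univ)⁻¹ * transfer⁻¹

/-- A moon polyomino: a finite subset of `ℤ × ℤ` whose up- and down-diagonals are intervals, and whose
up-diagonals are pairwise comparable under inclusion. -/
structure IsMoon (M : Finset (ℤ × ℤ)) : Prop where
  up_convex : ∀ i : ℤ, {j : ℤ | (i, j) ∈ M}.OrdConnected
  down_convex : ∀ j : ℤ, {i : ℤ | (i, j) ∈ M}.OrdConnected
  nested : ∀ i i' : ℤ, {j : ℤ | (i, j) ∈ M} ⊆ {j : ℤ | (i', j) ∈ M} ∨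
    {j : ℤ | (i', j) ∈ M} ⊆ {j : ℤ | (i, j) ∈ M}

/-- `R` is a maximal rectangle of `M`. -/
def IsMaxRectangle (R : Rectangle) (M : Finset (ℤ × ℤ)) : Prop :=
  R.boxes ⊆ M ∧ ∀ S : Rectangle, R.boxes ⊆ S.boxes → S.boxes ⊆ M → S = R

/-- `p` lies outside `R` but in a down-diagonal meeting `R`. -/
def Rectangle.Beside (R : Rectangle) (p : ℤ × ℤ) : Prop :=
  p ∉ R.boxes ∧ R.j₀ ≤ p.2 ∧ p.2 ≤ R.j₁

/-- `p` lies outside `R` but in an up-diagonal meeting `R`. -/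
def Rectangle.Along (R : Rectangle) (p : ℤ × ℤ) : Prop :=
  p ∉ R.boxes ∧ R.i₀ ≤ p.1 ∧ p.1 ≤ R.i₁

open scoped Classical in
/-- How boxes move: `Pro^P` moves boxes outside `R` in down-diagonals meeting `R` by `(0, -1)`, `Pro^Q`
moves boxes outside `R` in up-diagonals meeting `R` by `(-1, 0)`, and `φ ∘ ρ⁻¹ ∘ φ⁻¹` does both. -/
def boxShift (k : ShiftKind) (R : Rectangle) (p : ℤ × ℤ) : ℤ × ℤ :=
  match k with
  | .proP => if R.Beside p then (p.1, p.2 - 1) else p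
  | .proQ => if R.Along p then (p.1 - 1, p.2) else p
  | .row => if R.Beside p then (p.1, p.2 - 1) else if R.Along p then (p.1 - 1, p.2) else p

open scoped Classical in
/-- The box from which the box `p` of the shifted polyomino comes. -/
def boxUnshift (k : ShiftKind) (R : Rectangle) (p : ℤ × ℤ) : ℤ × ℤ :=
  match k with
  | .proP => if R.Beside p then (p.1, p.2 + 1) else p
  | .proQ => if R.Along p then (p.1 + 1, p.2) else p
  | .row => if R.Beside p then (p.1, p.2 + 1) else if R.Along p then (p.1 + 1, p.2) else p

open scoped Classical in
/-- `N` is a moon polyomino obtained from the moon polyomino `M` by the shift of the given kind with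
respect to the maximal rectangle `R` of `M`. -/
structure IsShift (k : ShiftKind) (R : Rectangle) (M N : Finset (ℤ × ℤ)) : Prop where
  moon_source : IsMoon M
  maximal : IsMaxRectangle R M
  image_eq : N = M.image (boxShift k R)
  moon_target : IsMoon N

open scoped Classical in
/-- The label of the box `p` in a labeling of `M` (only used for `p ∈ M`). -/
def labelAt {M : Finset (ℤ × ℤ)} (x : M → ℝ) (p : ℤ × ℤ) : ℝ :=
  if h : p ∈ M then x ⟨p, h⟩ else 0

open scoped Classical in
/-- The map `ℝ^M → ℝ^N` accompanying the shift `IsShift k R M N`: apply `rectMap k R` to the labels in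
`R`, and move the labels outside `R` along with their boxes. -/
def shiftMap (k : ShiftKind) (R : Rectangle) (M N : Finset (ℤ × ℤ)) (x : M → ℝ) : N → ℝ :=
  fun q =>
    if h : q.1 ∈ R.boxes then rectMap k R (fun p => labelAt x p.1) ⟨q.1, h⟩
    else labelAt x (boxUnshift k R q.1)

/-- The translate of a rectangle by `(-di, -dj)`. -/
def Rectangle.lower (S : Rectangle) (di dj : ℤ) : Rectangle where
  i₀ := S.i₀ - di
  i₁ := S.i₁ - di
  j₀ := S.j₀ - dj
  j₁ := S.j₁ - dj
  hi := sub_le_sub_right S.hi di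
  hj := sub_le_sub_right S.hj dj

open scoped Classical in
/-- The rectangle of the shifted polyomino that corresponds to the rectangle `S` after a shift of kind `k`
with respect to `R`: it is the translate of `S` in the direction in which the boxes of `S` outside `R`
move. If `S` has an up-diagonal that does not meet `R`, this direction is `(0, -1)` for a shift of
down-diagonals; if `S` has a down-diagonal that does not meet `R`, it is `(-1, 0)` for a shift of
up-diagonals. -/
def follow (k : ShiftKind) (R S : Rectangle) : Rectangle :=
  let di : ℤ := if R.j₀ ≤ S.j₀ ∧ S.j₁ ≤ R.j₁ then 0 else 1
  let dj : ℤ := if R.i₀ ≤ S.i₀ ∧ S.i₁ ≤ R.i₁ then 0 else 1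
  match k with
  | .proP => S.lower 0 dj
  | .proQ => S.lower di 0
  | .row => S.lower di dj

/-- A sequence of shifts of down-diagonals or of up-diagonals and inverses of such shifts, leading from
`L` to another polyomino. Every single shift is required to move some box. -/
inductive ShiftSeq (L : Finset (ℤ × ℤ)) : Finset (ℤ × ℤ) → Type where
  | nil : ShiftSeq L L
  | shift {M N : Finset (ℤ × ℤ)} (s : ShiftSeq L M) (k : ShiftKind) (R : Rectangle)
      (hk : k = .proP ∨ k = .proQ) (h : IsShift k R M N) (hne : M ≠ N) : ShiftSeq L N
  | unshift {M N : Finset (ℤ × ℤ)} (s : ShiftSeq L M) (k : ShiftKind) (R : Rectangle)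
      (hk : k = .proP ∨ k = .proQ) (h : IsShift k R N M) (hne : M ≠ N) : ShiftSeq L N

/-- The composite along a sequence of shifts, as a relation: `s.Sends x y` says that the labeling `x` of
`L` is sent to the labeling `y` of `N` when one applies the maps of the shifts, and the inverses of the
maps for the inverse shifts, one after the other. -/
def ShiftSeq.Sends {L : Finset (ℤ × ℤ)} (x : L → ℝ) :
    {N : Finset (ℤ × ℤ)} → ShiftSeq L N → (N → ℝ) → Prop
  | _, .nil, y => x = y
  | N, .shift (M := M) s k R _ _ _, y => ∃ z : M → ℝ, s.Sends x z ∧ shiftMap k R M N z = y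
  | N, .unshift (M := M) s k R _ _ _, y => ∃ z : M → ℝ, s.Sends x z ∧ shiftMap k R N M y = z

end

/-! Deformation. Replace every maximum by the log-sum-exp with parameter `t`, and every minimum by
its dual. In the variables `exp (t * x)` all labels are positive reals, toggles become birational
toggles with weight `exp t` above the top box, and the piecewise-linear maps return as `t → ∞`. The
convergence is continuous, so it is compatible with composition, and an identity between deformed
maps for `t = 1, 2, …` survives in the limit (`ContConv.eq`). Commutation is therefore proved only
for the deformed maps, where sums and products can be cancelled.

Invariants. For a positive array consider the sums over lattice paths that cross a rectangle from
its first to its last column, one for each interval of rows and each pair of end rows in it, and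
likewise with rows and columns exchanged. Iterated rowmotion attaches a shape to each initial
rectangle (`growth`). By `sameCols_iff` and `sameRows_iff`, the crossing path sums carry the same
information as the shapes of the initial column intervals or row intervals; the analytic core is
`pathSum_dropCols_rowTop`. So either family of path sums determines the shape of the whole
rectangle, and both together determine the labels (`eq_of_sameShapes`). By `chainShift_softRectMap`
the three maps translate the column path sums, the row path sums, or both, by one step. The first
two preserve the shape; the third changes it by a rule that computes the new shape from the old one
and the new shapes of two smaller rectangles.

Commutation. Two maximal rectangles cross, one being taller and the other wider. Row path sums are
the matrix entries of a product of column operators (`sameRows_iff_samePush`), so the map of the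
tall rectangle acts on the row path sums of the wide one by a translation. This shows that both
composites have the same row path sums on the translated wide rectangle. The columns outside the
intersection are then stripped off one by one, at the right and at the left; equality of the shape
of the remaining part forces the stripped columns to agree (`SameRows.removeLast`,
`SameRows.removeFirst`). On the intersection the row path sums agree, the transposed argument gives
the column path sums, and so the labels agree (`commute_labels`).

Independence of the sequence. This is Newman's lemma with maps attached. A shift that moves a box
lowers the total height of the boxes above a fixed lower bound, and two different steps from the
same polyomino close up to a square after one more step on each side (`ShiftStep.diamond`). Hence
each polyomino has a unique terminal polyomino together with a unique bijection to it
(`NormalForm.unique`), and every sequence from `M` to `N` induces the bijection of `M` followed by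
the inverse of the bijection of `N`. -/

open Filter Topology

/-! ### Continuous convergence of maps and permutations -/

/-- Continuous convergence of a sequence of maps. -/
def ContConv {A B : Type*} (f : ℕ → (A → ℝ) → (B → ℝ)) (g : (A → ℝ) → (B → ℝ)) : Prop :=
  ∀ (X : ℕ → A → ℝ) (x : A → ℝ), (∀ p, Tendsto (fun n => X n p) atTop (𝓝 (x p))) →
    ∀ p, Tendsto (fun n => f n (X n) p) atTop (𝓝 (g x p))

/-- The arguments are allowed to vary with `n` exactly so that limits compose; pointwise convergence
of the maps would not be enough. -/
theorem ContConv.comp {A B C : Type*} {f : ℕ → (A → ℝ) → (B → ℝ)} {g : (A → ℝ) → (B → ℝ)}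
    {f' : ℕ → (B → ℝ) → (C → ℝ)} {g' : (B → ℝ) → (C → ℝ)}
    (h' : ContConv f' g') (h : ContConv f g) :
    ContConv (fun n => f' n ∘ f n) (g' ∘ g) :=
  fun X x hX => h' _ _ (h X x hX)

/-- Evaluate along constant sequences and use uniqueness of limits. The index `0` is left out
because the deformation divides by its parameter. -/
theorem ContConv.eq {A B : Type*} {f : ℕ → (A → ℝ) → (B → ℝ)} {g g' : (A → ℝ) → (B → ℝ)}
    {f' : ℕ → (A → ℝ) → (B → ℝ)} (h : ContConv f g) (h' : ContConv f' g')
    (e : ∀ n, 0 < n → f n = f' n) : g = g' := by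
  funext x p
  refine tendsto_nhds_unique (h (fun _ => x) x (fun _ => tendsto_const_nhds) p) ?_
  refine (h' (fun _ => x) x (fun _ => tendsto_const_nhds) p).congr' ?_
  filter_upwards [eventually_gt_atTop 0] with n hn
  rw [e n hn]

/-- Continuous convergence of permutations together with their inverses. -/
def PermConv {A : Type*} (f : ℕ → Equiv.Perm (A → ℝ)) (g : Equiv.Perm (A → ℝ)) : Prop :=
  ContConv (fun n => f n) g ∧ ContConv (fun n => ((f n)⁻¹ : Equiv.Perm _)) (g⁻¹ : Equiv.Perm _)

theorem PermConv.mul {A : Type*} {f f' : ℕ → Equiv.Perm (A → ℝ)} {g g' : Equiv.Perm (A → ℝ)}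
    (h : PermConv f g) (h' : PermConv f' g') : PermConv (fun n => f n * f' n) (g * g') := by
  refine ⟨?_, ?_⟩
  · simp only [Equiv.Perm.coe_mul]
    exact h.1.comp h'.1
  · simp only [mul_inv_rev, Equiv.Perm.coe_mul]
    exact h'.2.comp h.2

theorem PermConv.inv {A : Type*} {f : ℕ → Equiv.Perm (A → ℝ)} {g : Equiv.Perm (A → ℝ)}
    (h : PermConv f g) : PermConv (fun n => (f n)⁻¹) g⁻¹ :=
  ⟨h.2, by simpa only [inv_inv] using h.1⟩

theorem PermConv.one {A : Type*} : PermConv (fun _ => (1 : Equiv.Perm (A → ℝ))) 1 :=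
  ⟨fun _ _ h => h, fun _ _ h => by simpa using h⟩

theorem PermConv.list_prod {A ι : Type*} (l : List ι) {f : ℕ → ι → Equiv.Perm (A → ℝ)}
    {g : ι → Equiv.Perm (A → ℝ)} (h : ∀ i, PermConv (fun n => f n i) (g i)) :
    PermConv (fun n => (l.map (f n)).prod) (l.map g).prod := by
  induction l with
  | nil => simpa using PermConv.one
  | cons i l ih => simpa using (h i).mul ih

/-! ### Deformed toggles, transfer maps and rowmotion -/

section Soft

variable {P : Type*} [PartialOrder P] [Fintype P]

open scoped Classical in
/-- The smooth deformation of `maxBelow` with parameter `t`. -/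
noncomputable def softMax (t : ℝ) (x : P → ℝ) (p : P) : ℝ :=
  if (lowerCovers p).Nonempty then Real.log (∑ q ∈ lowerCovers p, Real.exp (t * x q)) / t else 0

open scoped Classical in
/-- The smooth deformation of `minAbove` with parameter `t`. -/
noncomputable def softMin (t : ℝ) (x : P → ℝ) (p : P) : ℝ :=
  if (upperCovers p).Nonempty then -(Real.log (∑ q ∈ upperCovers p, Real.exp (t * -x q)) / t)
  else 1

theorem mem_lowerCovers {p q : P} : q ∈ lowerCovers p ↔ q ⋖ p := by simp [lowerCovers]

theorem mem_upperCovers {p q : P} : q ∈ upperCovers p ↔ p ⋖ q := by simp [upperCovers]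

theorem softMax_congr {t : ℝ} {x y : P → ℝ} {p : P} (h : ∀ q, q ⋖ p → x q = y q) :
    softMax t x p = softMax t y p := by
  unfold softMax
  rw [Finset.sum_congr rfl fun q hq => by rw [h q (mem_lowerCovers.1 hq)]]

theorem softMin_congr {t : ℝ} {x y : P → ℝ} {p : P} (h : ∀ q, p ⋖ q → x q = y q) :
    softMin t x p = softMin t y p := by
  unfold softMin
  rw [Finset.sum_congr rfl fun q hq => by rw [h q (mem_upperCovers.1 hq)]]

open scoped Classical in
/-- The function underlying the deformed toggle. -/
noncomputable def softToggleFun (t : ℝ) (p : P) (x : P → ℝ) : P → ℝ :=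
  Function.update x p (softMin t x p + softMax t x p - x p)

theorem softToggleFun_involutive (t : ℝ) (p : P) : Function.Involutive (softToggleFun t p) := by
  classical
  intro x
  have h1 : softMin t (softToggleFun t p x) p = softMin t x p :=
    softMin_congr (fun q hq => by simp [softToggleFun, Function.update_of_ne hq.lt.ne'])
  have h2 : softMax t (softToggleFun t p x) p = softMax t x p :=
    softMax_congr (fun q hq => by simp [softToggleFun, Function.update_of_ne hq.lt.ne])
  have h3 : softToggleFun t p x p = softMin t x p + softMax t x p - x p := by simp [softToggleFun]
  funext q
  rw [softToggleFun, h1, h2, h3]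
  by_cases hq : q = p
  · subst hq
    simp
  · simp [softToggleFun, Function.update_of_ne hq]

/-- The deformed toggle, as a permutation. -/
noncomputable def softToggle (t : ℝ) (p : P) : Equiv.Perm (P → ℝ) :=
  (softToggleFun_involutive t p).toPerm

theorem softToggle_apply_self (t : ℝ) (p : P) (x : P → ℝ) :
    softToggle t p x p = softMin t x p + softMax t x p - x p := by
  simp [softToggle, softToggleFun]

theorem softToggle_apply_ne (t : ℝ) {p q : P} (h : q ≠ p) (x : P → ℝ) :
    softToggle t p x q = x q := by
  simp [softToggle, softToggleFun, h]

theorem softToggle_inv (t : ℝ) (p : P) : (softToggle t p)⁻¹ = softToggle t p := by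
  ext x : 1
  rw [Equiv.Perm.inv_def]
  exact congrFun (Function.Involutive.toPerm_symm (softToggleFun_involutive t p) ▸ rfl) x

theorem toggle_inv (p : P) : (toggle p)⁻¹ = toggle p := by
  ext x : 1
  rw [Equiv.Perm.inv_def]
  exact congrFun (Function.Involutive.toPerm_symm (toggleFun_involutive p) ▸ rfl) x

open scoped Classical in
/-- The inverse of the deformed transfer map. -/
noncomputable def softTransferInv (t : ℝ) (x : P → ℝ) : P → ℝ :=
  (wellFounded_lt (α := P)).fix
    (fun p ih => x p + softMax t (fun q => if h : q < p then ih q h else 0) p)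

theorem softTransferInv_eq (t : ℝ) (x : P → ℝ) (p : P) :
    softTransferInv t x p = x p + softMax t (softTransferInv t x) p := by
  classical
  rw [softTransferInv, WellFounded.fix_eq]
  congr 1
  refine softMax_congr (fun q hq => ?_)
  simp [hq.lt]

/-- The deformed transfer map. -/
noncomputable def softTransfer (t : ℝ) : Equiv.Perm (P → ℝ) where
  toFun x := fun p => x p - softMax t x p
  invFun := softTransferInv t
  left_inv x := by
    funext p
    induction p using (wellFounded_lt (α := P)).induction with
    | _ p ih =>
      rw [softTransferInv_eq, softMax_congr (fun q hq => ih q hq.lt)]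
      simp
  right_inv x := by
    funext p
    dsimp only
    rw [softTransferInv_eq]
    ring

/-- Deformed rowmotion. -/
noncomputable def softRowmotion (t : ℝ) (I : Finset P) : Equiv.Perm (P → ℝ) :=
  ((linearList I).map (softToggle t)).prod

/-- The inverse product toggles from the bottom up. When an element is toggled, its upper covers
still carry the old labels and its lower covers already carry their final ones. The resulting
recursion no longer depends on the chosen linear extension. -/
theorem softToggle_list_inv_apply (t : ℝ) (l : List P) (hl : l.Pairwise fun a b => ¬ b ≤ a)
    (u : P → ℝ) :
    (∀ p, p ∉ l → ((l.map (softToggle t)).prod)⁻¹ u p = u p) ∧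
    (∀ p, p ∈ l → ((l.map (softToggle t)).prod)⁻¹ u p =
      softMin t u p + softMax t (((l.map (softToggle t)).prod)⁻¹ u) p - u p) := by
  induction l generalizing u with
  | nil => simp
  | cons p l ih =>
    rw [List.pairwise_cons] at hl
    obtain ⟨h1, h2⟩ := ih hl.2 (softToggle t p u)
    have e : (((p :: l).map (softToggle t)).prod)⁻¹ u =
        ((l.map (softToggle t)).prod)⁻¹ (softToggle t p u) := by
      rw [List.map_cons, List.prod_cons, mul_inv_rev, softToggle_inv]
      rfl
    rw [e]
    have hp : p ∉ l := fun h => hl.1 p h le_rfl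
    refine ⟨fun q hq => ?_, fun q hq => ?_⟩
    · rw [List.mem_cons, not_or] at hq
      rw [h1 q hq.2, softToggle_apply_ne t hq.1]
    · rcases List.mem_cons.1 hq with rfl | hq
      · rw [h1 q hp, softToggle_apply_self]
        congr 2
        refine softMax_congr fun a ha => ?_
        rw [h1 a fun h => hl.1 a h ha.le, softToggle_apply_ne t ha.lt.ne]
      · have hne : q ≠ p := fun h => hp (h ▸ hq)
        rw [h2 q hq, softToggle_apply_ne t hne]
        congr 2
        refine softMin_congr fun a ha => ?_
        rw [softToggle_apply_ne t fun h => hl.1 q hq (by rw [← h]; exact ha.le)]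

theorem mem_linearList {P : Type*} [PartialOrder P] {I : Finset P} {p : P} : p ∈ linearList I ↔ p ∈ I := by
  unfold linearList
  exact Finset.mem_sort (α := LinearExtension P) _

theorem linearList_pairwise {P : Type*} [PartialOrder P] (I : Finset P) :
    (linearList I).Pairwise fun a b => ¬ b ≤ a := by
  classical
  have h1 := Finset.sortedLT_sort (α := LinearExtension P) I
  unfold linearList
  refine List.Pairwise.imp (R := fun a b : LinearExtension P => a < b) ?_ h1.pairwise
  intro a b hab hba
  exact absurd ((toLinearExtension (α := P)).monotone' hba) (not_le.2 hab)

theorem softRowmotion_inv_apply_of_notMem (t : ℝ) {I : Finset P} {p : P} (hp : p ∉ I)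
    (u : P → ℝ) : (softRowmotion t I)⁻¹ u p = u p :=
  (softToggle_list_inv_apply t _ (linearList_pairwise I) u).1 p (by rwa [mem_linearList])

theorem softRowmotion_inv_apply_of_mem (t : ℝ) {I : Finset P} {p : P} (hp : p ∈ I)
    (u : P → ℝ) : (softRowmotion t I)⁻¹ u p =
      softMin t u p + softMax t ((softRowmotion t I)⁻¹ u) p - u p :=
  (softToggle_list_inv_apply t _ (linearList_pairwise I) u).2 p (by rwa [mem_linearList])

theorem softRowmotion_apply_of_notMem (t : ℝ) {I : Finset P} {p : P} (hp : p ∉ I)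
    (u : P → ℝ) : softRowmotion t I u p = u p := by
  have := softRowmotion_inv_apply_of_notMem t hp (softRowmotion t I u)
  simp only [Equiv.Perm.inv_def, Equiv.symm_apply_apply] at this
  exact this.symm

theorem softRowmotion_apply_of_mem (t : ℝ) {I : Finset P} {p : P} (hp : p ∈ I)
    (u : P → ℝ) : softRowmotion t I u p =
      softMin t (softRowmotion t I u) p + softMax t u p - u p := by
  have := softRowmotion_inv_apply_of_mem t hp (softRowmotion t I u)
  simp only [Equiv.Perm.inv_def, Equiv.symm_apply_apply] at this
  linarith

theorem sup'_le_logSumExp {ι : Type*} {s : Finset ι} (hs : s.Nonempty) {t : ℝ} (ht : 0 < t)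
    (x : ι → ℝ) : s.sup' hs x ≤ Real.log (∑ q ∈ s, Real.exp (t * x q)) / t := by
  refine Finset.sup'_le _ _ fun q hq => ?_
  rw [le_div_iff₀ ht, mul_comm, Real.le_log_iff_exp_le]
  · exact Finset.single_le_sum (f := fun q => Real.exp (t * x q)) (fun i _ => (Real.exp_pos _).le) hq
  · exact Finset.sum_pos (fun i _ => Real.exp_pos _) hs

theorem logSumExp_le {ι : Type*} {s : Finset ι} (hs : s.Nonempty) {t : ℝ} (ht : 0 < t)
    (x : ι → ℝ) : Real.log (∑ q ∈ s, Real.exp (t * x q)) / t ≤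
      s.sup' hs x + Real.log s.card / t := by
  have hc : (0 : ℝ) < s.card := by exact_mod_cast hs.card_pos
  have key : ∑ q ∈ s, Real.exp (t * x q) ≤ s.card * Real.exp (t * s.sup' hs x) := by
    rw [← nsmul_eq_mul]
    refine Finset.sum_le_card_nsmul _ _ _ fun q hq => ?_
    exact Real.exp_le_exp.2 (mul_le_mul_of_nonneg_left (Finset.le_sup' x hq) ht.le)
  have h2 := Real.log_le_log (Finset.sum_pos (fun i _ => Real.exp_pos _) hs) key
  rw [Real.log_mul hc.ne' (Real.exp_pos _).ne', Real.log_exp] at h2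
  rw [div_le_iff₀ ht, add_mul, div_mul_cancel₀ _ ht.ne']
  linarith

/-- Log-sum-exp lies between the maximum and the maximum plus `log card / t`. The error does not
depend on the labels, so these may vary with `n`. -/
theorem tendsto_logSumExp {ι : Type*} {s : Finset ι} (hs : s.Nonempty) {X : ℕ → ι → ℝ}
    {x : ι → ℝ} (h : ∀ i, Tendsto (fun n => X n i) atTop (𝓝 (x i))) :
    Tendsto (fun n : ℕ => Real.log (∑ q ∈ s, Real.exp (n * X n q)) / n) atTop
      (𝓝 (s.sup' hs x)) := by
  have h1 : Tendsto (fun n => s.sup' hs (X n)) atTop (𝓝 (s.sup' hs x)) := by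
    have := Filter.Tendsto.finset_sup'_nhds_apply hs (l := atTop) (f := fun i n => X n i) (g := x)
      (fun i _ => h i)
    exact this
  have h2 : Tendsto (fun n : ℕ => s.sup' hs (X n) + Real.log s.card / n) atTop
      (𝓝 (s.sup' hs x)) := by
    simpa using h1.add (tendsto_const_div_atTop_nhds_zero_nat (Real.log s.card))
  refine tendsto_of_tendsto_of_tendsto_of_le_of_le' h1 h2 ?_ ?_
  · filter_upwards [eventually_gt_atTop 0] with n hn
    exact sup'_le_logSumExp hs (Nat.cast_pos.2 hn) _
  · filter_upwards [eventually_gt_atTop 0] with n hn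
    exact logSumExp_le hs (Nat.cast_pos.2 hn) _

/-- Convergence is asked for at the lower covers only, since this is all that the induction in
`permConv_softTransfer` supplies. -/
theorem tendsto_softMax {X : ℕ → P → ℝ} {x : P → ℝ} {p : P}
    (h : ∀ i, i ⋖ p → Tendsto (fun n => X n i) atTop (𝓝 (x i))) :
    Tendsto (fun n : ℕ => softMax n (X n) p) atTop (𝓝 (maxBelow x p)) := by
  classical
  unfold softMax maxBelow
  split_ifs with hs
  -- Labels away from the lower covers are replaced by `0`, which gives a family converging at every
  -- index.
  · have := tendsto_logSumExp hs (X := fun n i => if i ⋖ p then X n i else 0)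
      (x := fun i => if i ⋖ p then x i else 0) (fun i => by
        split_ifs with hi
        · exact h i hi
        · exact tendsto_const_nhds)
    have e : (lowerCovers p).sup' hs x = (lowerCovers p).sup' hs (fun i => if i ⋖ p then x i else 0) :=
      Finset.sup'_congr hs rfl fun i hi => by rw [if_pos (mem_lowerCovers.1 hi)]
    rw [e]
    refine this.congr fun n => ?_
    rw [Finset.sum_congr rfl fun i hi => by rw [if_pos (mem_lowerCovers.1 hi)]]
  · exact tendsto_const_nhds

theorem tendsto_softMin {X : ℕ → P → ℝ} {x : P → ℝ} {p : P}
    (h : ∀ i, Tendsto (fun n => X n i) atTop (𝓝 (x i))) :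
    Tendsto (fun n : ℕ => softMin n (X n) p) atTop (𝓝 (minAbove x p)) := by
  classical
  unfold softMin minAbove
  split_ifs with hs
  · have := (tendsto_logSumExp hs (X := fun n i => -X n i) (x := fun i => - x i)
      (fun i => (h i).neg)).neg
    have e : (upperCovers p).inf' hs x = - (upperCovers p).sup' hs (fun i => - x i) := by
      refine le_antisymm ?_ ?_
      · rw [le_neg]
        exact Finset.sup'_le _ _ fun i hi => neg_le_neg (Finset.inf'_le _ hi)
      · refine Finset.le_inf' _ _ fun i hi => ?_
        rw [neg_le]
        exact Finset.le_sup' (fun i => - x i) hi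
    rw [e]
    exact this
  · exact tendsto_const_nhds

theorem permConv_softToggle (p : P) : PermConv (fun n => softToggle n p) (toggle p) := by
  have h : ContConv (fun n : ℕ => softToggle n p) (toggle p) := by
    classical
    intro X x hX q
    by_cases hq : q = p
    · subst hq
      have e : toggle q x q = minAbove x q + maxBelow x q - x q := by simp [toggle, toggleFun]
      simp only [softToggle_apply_self, e]
      exact ((tendsto_softMin hX).add (tendsto_softMax fun i _ => hX i)).sub (hX q)
    · have e : toggle p x q = x q := by simp [toggle, toggleFun, hq]
      simp only [softToggle_apply_ne _ hq, e]
      exact hX q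
  exact ⟨h, by simpa only [softToggle_inv, toggle_inv] using h⟩

theorem permConv_softTransfer :
    PermConv (fun n => softTransfer (P := P) n) transfer := by
  refine ⟨fun X x hX p => (hX p).sub (tendsto_softMax fun i _ => hX i), fun X x hX p => ?_⟩
  induction p using (wellFounded_lt (α := P)).induction with
  | _ p ih =>
    have e1 : ∀ n : ℕ, ((softTransfer n)⁻¹ : Equiv.Perm _) (X n) p =
        X n p + softMax n (((softTransfer n)⁻¹ : Equiv.Perm _) (X n)) p :=
      fun n => softTransferInv_eq n (X n) p
    have e2 : (transfer⁻¹ : Equiv.Perm _) x p =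
        x p + maxBelow ((transfer⁻¹ : Equiv.Perm _) x) p := transferInv_eq x p
    rw [e2]
    simp only [e1]
    exact (hX p).add (tendsto_softMax fun i hi => ih i hi.lt)

theorem permConv_softRowmotion (I : Finset P) :
    PermConv (fun n => softRowmotion n I) (rowmotion I) :=
  PermConv.list_prod _ fun p => permConv_softToggle p

end Soft

/-! ### Deformed RSK and promotion, and their limits -/

/-- Deformed RSK. -/
noncomputable def softRSK (t : ℝ) (R : Rectangle) : Equiv.Perm (R.boxes → ℝ) :=
  let m : ℕ := min R.numRows R.numCols
  ((List.range (m - 1)).map (fun k : ℕ =>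
    (softRowmotion t (R.ideal (R.i₁ - m + 1 + k) (R.j₁ - m + 1 + k)))⁻¹)).prod * (softTransfer t)⁻¹

/-- Deformed promotion in the left files. -/
noncomputable def softProP (t : ℝ) (R : Rectangle) : Equiv.Perm (R.boxes → ℝ) :=
  ((List.range (R.numCols - 1)).map (fun k : ℕ =>
    softRowmotion t (R.file (R.i₁ - R.j₁ + 1 + k)))).prod

/-- Deformed promotion in the right files. -/
noncomputable def softProQ (t : ℝ) (R : Rectangle) : Equiv.Perm (R.boxes → ℝ) :=
  ((List.range (R.numRows - 1)).map (fun k : ℕ =>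
    softRowmotion t (R.file (R.i₁ - R.j₁ - 1 - k)))).prod

/-- The deformation of `rectMap`. -/
noncomputable def softRectMap (t : ℝ) (k : ShiftKind) (R : Rectangle) :
    Equiv.Perm (R.boxes → ℝ) :=
  match k with
  | .proP => (softRSK t R)⁻¹ * softProP t R * softRSK t R
  | .proQ => (softRSK t R)⁻¹ * softProQ t R * softRSK t R
  | .row => softTransfer t * (softRowmotion t Finset.univ)⁻¹ * (softTransfer t)⁻¹

/-- Puts the product into the form indexed by natural numbers to which `PermConv.list_prod` applies.
-/
theorem RSK_eq (R : Rectangle) : RSK R = ((List.range (min R.numRows R.numCols - 1)).map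
    (fun k : ℕ => (rowmotion (R.ideal (R.i₁ - (min R.numRows R.numCols : ℕ) + 1 + k)
      (R.j₁ - (min R.numRows R.numCols : ℕ) + 1 + k)))⁻¹)).prod * transfer⁻¹ := by
  simp only [RSK, List.pure_def, List.bind_eq_flatMap, ← List.map_eq_flatMap, List.map_map,
    Function.comp_def]

theorem ProP_eq (R : Rectangle) : ProP R = ((List.range (R.numCols - 1)).map
    (fun k : ℕ => rowmotion (R.file (R.i₁ - R.j₁ + 1 + k)))).prod := by
  simp only [ProP, List.pure_def, List.bind_eq_flatMap, ← List.map_eq_flatMap, List.map_map,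
    Function.comp_def]

theorem ProQ_eq (R : Rectangle) : ProQ R = ((List.range (R.numRows - 1)).map
    (fun k : ℕ => rowmotion (R.file (R.i₁ - R.j₁ - 1 - k)))).prod := by
  simp only [ProQ, List.pure_def, List.bind_eq_flatMap, ← List.map_eq_flatMap, List.map_map,
    Function.comp_def]

theorem permConv_softRSK (R : Rectangle) : PermConv (fun n => softRSK n R) (RSK R) := by
  rw [RSK_eq]
  unfold softRSK
  refine PermConv.mul (PermConv.list_prod (List.range _)
    (f := fun (n : ℕ) (k : ℕ) => (softRowmotion (n : ℝ) (R.ideal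
      (R.i₁ - (min R.numRows R.numCols : ℕ) + 1 + k)
      (R.j₁ - (min R.numRows R.numCols : ℕ) + 1 + k)))⁻¹) fun k => ?_) permConv_softTransfer.inv
  exact (permConv_softRowmotion _).inv

theorem permConv_softProP (R : Rectangle) : PermConv (fun n => softProP n R) (ProP R) := by
  rw [ProP_eq]
  unfold softProP
  exact PermConv.list_prod (List.range _) (f := fun (n : ℕ) (k : ℕ) =>
    softRowmotion (n : ℝ) (R.file (R.i₁ - R.j₁ + 1 + k))) fun k => permConv_softRowmotion _

theorem permConv_softProQ (R : Rectangle) : PermConv (fun n => softProQ n R) (ProQ R) := by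
  rw [ProQ_eq]
  unfold softProQ
  exact PermConv.list_prod (List.range _) (f := fun (n : ℕ) (k : ℕ) =>
    softRowmotion (n : ℝ) (R.file (R.i₁ - R.j₁ - 1 - k))) fun k => permConv_softRowmotion _

theorem permConv_softRectMap (k : ShiftKind) (R : Rectangle) :
    PermConv (fun n => softRectMap n k R) (rectMap k R) := by
  cases k with
  | proP => exact ((permConv_softRSK R).inv.mul (permConv_softProP R)).mul (permConv_softRSK R)
  | proQ => exact ((permConv_softRSK R).inv.mul (permConv_softProQ R)).mul (permConv_softRSK R)
  | row =>
    exact (permConv_softTransfer.mul (permConv_softRowmotion _).inv).mul permConv_softTransfer.inv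

/-! ### Path sums, growth arrays and rowmotion on a strip -/

section Arrays

/-- The sum of a monomial weight over the lower covers, where the rows and columns below may be
read off from two different arrays; the empty sum is replaced by `1`. -/
def belowMix (p q : ℕ → ℕ → ℝ) : ℕ → ℕ → ℝ
  | 0, 0 => 1
  | 0, b + 1 => q 0 b
  | a + 1, 0 => p a 0
  | a + 1, b + 1 => p a (b + 1) + q (a + 1) b

/-- The total weight of the lattice paths from `(0, 0)` to `(a, b)`. -/
def pathSum (x : ℕ → ℕ → ℝ) : ℕ → ℕ → ℝ
  | 0, 0 => x 0 0
  | 0, b + 1 => x 0 (b + 1) * pathSum x 0 b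
  | a + 1, 0 => x (a + 1) 0 * pathSum x a 0
  | a + 1, b + 1 => x (a + 1) (b + 1) * (pathSum x a (b + 1) + pathSum x (a + 1) b)
termination_by a b => a + b

theorem pathSum_eq (x : ℕ → ℕ → ℝ) (a b : ℕ) :
    pathSum x a b = x a b * belowMix (pathSum x) (pathSum x) a b := by
  rcases a with _ | a <;> rcases b with _ | b <;> rw [pathSum] <;> simp [belowMix]

theorem belowMix_congr {p q p' q' : ℕ → ℕ → ℝ} {a b : ℕ}
    (hp : ∀ i, i + 1 = a → p i b = p' i b) (hq : ∀ j, j + 1 = b → q a j = q' a j) :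
    belowMix p q a b = belowMix p' q' a b := by
  rcases a with _ | a <;> rcases b with _ | b <;> simp [belowMix, hp, hq]

theorem belowMix_pos {p q : ℕ → ℕ → ℝ} {a b : ℕ} (hp : ∀ i, i + 1 = a → 0 < p i b)
    (hq : ∀ j, j + 1 = b → 0 < q a j) : 0 < belowMix p q a b := by
  rcases a with _ | a <;> rcases b with _ | b <;> simp only [belowMix]
  · exact one_pos
  · exact hq _ rfl
  · exact hp _ rfl
  · exact add_pos (hp _ rfl) (hq _ rfl)

theorem belowMix_flip (p q : ℕ → ℕ → ℝ) (a b : ℕ) :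
    belowMix (flip p) (flip q) a b = belowMix q p b a := by
  rcases a with _ | a <;> rcases b with _ | b <;> simp [belowMix, flip, add_comm]

/-- Induction over pairs along the componentwise order. -/
theorem pair_induction {C : ℕ → ℕ → Prop}
    (h : ∀ a b, (∀ i, i + 1 = a → C i b) → (∀ j, j + 1 = b → C a j) → C a b) (a b : ℕ) :
    C a b := by
  induction a generalizing b with
  | zero =>
    induction b with
    | zero => exact h 0 0 (by simp) (by simp)
    | succ b ih => exact h 0 (b + 1) (by simp) (fun j hj => by obtain rfl : j = b := by omega
                                                               exact ih)
  | succ a iha =>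
    induction b with
    | zero => exact h (a + 1) 0 (fun i hi => by obtain rfl : i = a := by omega
                                                exact iha 0) (by simp)
    | succ b ih =>
      exact h (a + 1) (b + 1) (fun i hi => by obtain rfl : i = a := by omega
                                              exact iha _)
        (fun j hj => by obtain rfl : j = b := by omega
                        exact ih)

theorem pathSum_pos {x : ℕ → ℕ → ℝ} (hx : ∀ a b, 0 < x a b) (a b : ℕ) : 0 < pathSum x a b := by
  induction a, b using pair_induction with
  | h a b h1 h2 =>
    rw [pathSum_eq]
    exact mul_pos (hx a b) (belowMix_pos h1 h2)

/-- Later identities for path sums are proved by exhibiting an array and checking the recursion on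
an initial rectangle. -/
theorem pathSum_unique {x c : ℕ → ℕ → ℝ} {r s : ℕ}
    (h : ∀ a b, a < r → b < s → c a b = x a b * belowMix c c a b) {a b : ℕ} (ha : a < r)
    (hb : b < s) : c a b = pathSum x a b := by
  induction a, b using pair_induction with
  | h a b h1 h2 =>
    rw [pathSum_eq, h a b ha hb]
    congr 1
    exact belowMix_congr (fun i hi => h1 i hi (by omega) hb) (fun j hj => h2 j hj ha (by omega))

theorem pathSum_congr {x y : ℕ → ℕ → ℝ} {a b : ℕ} (h : ∀ i j, i ≤ a → j ≤ b → x i j = y i j) :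
    pathSum x a b = pathSum y a b := by
  refine pathSum_unique (r := a + 1) (s := b + 1) (fun i j hi hj => ?_) (by omega) (by omega)
  rw [pathSum_eq, h i j (by omega) (by omega)]

theorem pathSum_flip (x : ℕ → ℕ → ℝ) (a b : ℕ) : pathSum (flip x) a b = pathSum x b a := by
  refine (pathSum_unique (c := flip (pathSum x)) (r := a + 1) (s := b + 1)
    (fun i j hi hj => ?_) (by omega) (by omega)).symm
  rw [belowMix_flip]
  exact pathSum_eq x j i

/-- The labels obtained by rowmotion at the elements that are not on the upper boundary. -/
noncomputable def derived (x : ℕ → ℕ → ℝ) (a b : ℕ) : ℝ :=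
  1 / (pathSum x a b * (1 / pathSum x (a + 1) b + 1 / pathSum x a (b + 1)))

/-- The entries of the array of shapes: `growth k x a b` is part number `k` of the shape of the
rectangle of size `(a + k + 1) × (b + k + 1)`. -/
noncomputable def growth (k : ℕ) (x : ℕ → ℕ → ℝ) : ℕ → ℕ → ℝ :=
  pathSum (derived^[k] x)

theorem derived_pos {x : ℕ → ℕ → ℝ} (hx : ∀ a b, 0 < x a b) (a b : ℕ) : 0 < derived x a b := by
  have := pathSum_pos hx
  have h1 := this a b
  have h2 := this (a + 1) b
  have h3 := this a (b + 1)
  unfold derived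
  positivity

theorem derived_iterate_pos {x : ℕ → ℕ → ℝ} (hx : ∀ a b, 0 < x a b) (k : ℕ) :
    ∀ a b, 0 < derived^[k] x a b := by
  induction k with
  | zero => exact hx
  | succ k ih =>
    rw [Function.iterate_succ_apply']
    exact derived_pos ih

theorem growth_pos {x : ℕ → ℕ → ℝ} (hx : ∀ a b, 0 < x a b) (k a b : ℕ) : 0 < growth k x a b :=
  pathSum_pos (derived_iterate_pos hx k) a b

theorem growth_zero (x : ℕ → ℕ → ℝ) : growth 0 x = pathSum x := rfl

theorem growth_succ (k : ℕ) (x : ℕ → ℕ → ℝ) : growth (k + 1) x = growth k (derived x) := rfl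

theorem derived_congr {x y : ℕ → ℕ → ℝ} {a b : ℕ}
    (h : ∀ i j, i ≤ a + 1 → j ≤ b + 1 → x i j = y i j) : derived x a b = derived y a b := by
  unfold derived
  rw [pathSum_congr fun i j hi hj => h i j (by omega) (by omega),
    pathSum_congr (x := x) (y := y) (a := a + 1) fun i j hi hj => h i j (by omega) (by omega),
    pathSum_congr (x := x) (y := y) (b := b + 1) fun i j hi hj => h i j (by omega) (by omega)]

/-- Each application of `derived` reads one further row and one further column. -/
theorem growth_congr {k : ℕ} {x y : ℕ → ℕ → ℝ} {a b : ℕ}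
    (h : ∀ i j, i ≤ a + k → j ≤ b + k → x i j = y i j) : growth k x a b = growth k y a b := by
  induction k generalizing x y with
  | zero => exact pathSum_congr h
  | succ k ih =>
    rw [growth_succ, growth_succ]
    exact ih fun i j hi hj => derived_congr fun i' j' hi' hj' => h i' j' (by omega) (by omega)

theorem derived_flip (x : ℕ → ℕ → ℝ) : derived (flip x) = flip (derived x) := by
  funext a b
  simp only [derived, pathSum_flip, flip]
  rw [add_comm (1 / _)]

theorem growth_flip (k : ℕ) (x : ℕ → ℕ → ℝ) (a b : ℕ) :
    growth k (flip x) a b = growth k x b a := by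
  induction k generalizing x with
  | zero => exact pathSum_flip x a b
  | succ k ih => rw [growth_succ, derived_flip, ih, growth_succ]

/-- The local rule of growth diagrams. -/
theorem growth_rule {x : ℕ → ℕ → ℝ} (hx : ∀ a b, 0 < x a b) (k a b : ℕ) :
    growth (k + 1) x a b * growth k x a b * (1 / growth k x (a + 1) b + 1 / growth k x a (b + 1)) =
      belowMix (growth (k + 1) x) (growth (k + 1) x) a b := by
  have h1 := growth_pos hx k a b
  have h2 := growth_pos hx k (a + 1) b
  have h3 := growth_pos hx k a (b + 1)
  have e : growth (k + 1) x a b = derived (derived^[k] x) a b *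
      belowMix (growth (k + 1) x) (growth (k + 1) x) a b := by
    unfold growth
    rw [pathSum_eq, Function.iterate_succ_apply']
  have e2 : derived (derived^[k] x) a b * (growth k x a b *
      (1 / growth k x (a + 1) b + 1 / growth k x a (b + 1))) = 1 := by
    unfold derived growth at *
    exact one_div_mul_cancel (by positivity)
  rw [mul_assoc]
  nth_rewrite 1 [e]
  linear_combination belowMix (growth (k + 1) x) (growth (k + 1) x) a b * e2

/-- Rowmotion labels of a strip with `r` rows. -/
noncomputable def rowTop (r : ℕ) (x : ℕ → ℕ → ℝ) (a b : ℕ) : ℝ :=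
  1 / (pathSum x a b * ((if a + 1 < r then 1 / pathSum x (a + 1) b else 0) +
    1 / pathSum x a (b + 1)))

theorem rowTop_pos (r : ℕ) {x : ℕ → ℕ → ℝ} (hx : ∀ a b, 0 < x a b) (a b : ℕ) :
    0 < rowTop r x a b := by
  have := pathSum_pos hx
  have h1 := this a b
  have h2 := this (a + 1) b
  have h3 := this a (b + 1)
  unfold rowTop
  split_ifs <;> positivity

theorem rowTop_eq_derived {r a : ℕ} (h : a + 1 < r) (x : ℕ → ℕ → ℝ) (b : ℕ) :
    rowTop r x a b = derived x a b := by
  simp [rowTop, derived, h]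

/-- The array without its first `j` columns. -/
def dropCols (j : ℕ) (x : ℕ → ℕ → ℝ) : ℕ → ℕ → ℝ := fun a b => x a (b + j)

/-- The array without its first `i` rows. -/
def dropRows (i : ℕ) (x : ℕ → ℕ → ℝ) : ℕ → ℕ → ℝ := fun a b => x (a + i) b

theorem dropCols_flip (j : ℕ) (x : ℕ → ℕ → ℝ) :
    dropCols j (flip x) = flip (dropRows j x) := rfl

theorem dropRows_flip (j : ℕ) (x : ℕ → ℕ → ℝ) :
    dropRows j (flip x) = flip (dropCols j x) := rfl

/-- Rowmotion shifts the path sums between the bottom and the top row by one column. -/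
theorem pathSum_dropCols_rowTop {r : ℕ} (hr : 0 < r) {x : ℕ → ℕ → ℝ} (hx : ∀ a b, 0 < x a b)
    (j n : ℕ) : pathSum (dropCols j (rowTop r x)) (r - 1) n =
      pathSum (dropCols (j + 1) x) (r - 1) n := by
  set u := pathSum x with hu
  set al := pathSum (dropCols (j + 1) x) with hal
  have hup : ∀ a b, 0 < u a b := pathSum_pos hx
  -- `B` is the ratio of the path sum started in column `j + 1` to the full path sum. The zeros in
  -- column `0` and in row `r` are boundary values: no path leads from column `j + 1` back to column
  -- `j`, and there is no row above the strip.
  let B : ℕ → ℕ → ℝ := fun a n =>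
    if a < r then (match n with
      | 0 => 0
      | m + 1 => al a m / u a (m + j + 1)) else 0
  have hB0 : ∀ a, B a 0 = 0 := fun a => by simp [B]
  have hB : ∀ a m, a < r → B a (m + 1) = al a m / u a (m + j + 1) := fun a m h => by simp [B, h]
  have hBr : ∀ m, B r m = 0 := fun m => by simp [B]
  clear_value B
  -- Both `al` and `u` satisfy the path recursion at the same box, with the same weight; dividing
  -- one by the other relates vertical to horizontal differences of `B`.
  have F1 : ∀ a n, a + 1 < r → u a (n + j + 1) * (B a (n + 1) - B (a + 1) (n + 1)) =
      u (a + 1) (n + j) * (B (a + 1) (n + 1) - B (a + 1) n) := by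
    intro a n h
    have e1 : u (a + 1) (n + j + 1) = x (a + 1) (n + j + 1) * (u a (n + j + 1) + u (a + 1) (n + j)) := by
      rw [hu, pathSum]
    have p1 := hup (a + 1) (n + j + 1)
    have p2 := hup a (n + j + 1)
    have p3 := hup (a + 1) (n + j)
    have px := hx (a + 1) (n + j + 1)
    rw [hB _ _ (by omega), hB _ _ h]
    have key : al (a + 1) n / u (a + 1) (n + j + 1) * (u a (n + j + 1) + u (a + 1) (n + j)) =
        al a n + u (a + 1) (n + j) * B (a + 1) n := by
      rcases n with _ | n
      · have e2 : al (a + 1) 0 = x (a + 1) (0 + (j + 1)) * al a 0 := by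
          rw [hal, pathSum]; rfl
        rw [hB0, e2, e1]
        rw [show 0 + (j + 1) = 0 + j + 1 by ring]
        field_simp
        ring
      · have e2 : al (a + 1) (n + 1) = x (a + 1) (n + 1 + (j + 1)) * (al a (n + 1) + al (a + 1) n) := by
          rw [hal, pathSum]; rfl
        rw [hB _ _ h, e2, e1]
        rw [show n + 1 + (j + 1) = n + 1 + j + 1 by ring]
        rw [show n + 1 + j = n + j + 1 by ring] at *
        field_simp
    have e3 : u a (n + j + 1) * (al a n / u a (n + j + 1)) = al a n := by field_simp
    linear_combination e3 - key
  -- In the bottom row there is a single path, so the ratio `B` is constant there.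
  have F0 : ∀ n, u 0 j * B 0 (n + 1) = 1 := by
    intro n
    rw [hB _ _ hr]
    induction n with
    | zero =>
      have e1 : al 0 0 = x 0 (0 + (j + 1)) := by rw [hal, pathSum]; rfl
      have e2 : u 0 (0 + j + 1) = x 0 (0 + j + 1) * u 0 (0 + j) := by rw [hu, pathSum]
      have p := hup 0 j
      have px := hx 0 (j + 1)
      rw [e1, e2, show 0 + (j + 1) = j + 1 by ring, show 0 + j = j by ring]
      field_simp
    | succ n ih =>
      have e1 : al 0 (n + 1) = x 0 (n + 1 + (j + 1)) * al 0 n := by rw [hal, pathSum]; rfl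
      have e2 : u 0 (n + 1 + j + 1) = x 0 (n + 1 + j + 1) * u 0 (n + 1 + j) := by rw [hu, pathSum]
      rw [← ih, e1, e2, show n + 1 + (j + 1) = n + 1 + j + 1 by ring,
        show n + 1 + j = n + j + 1 by ring]
      have p := hup 0 (n + j + 1)
      have px := hx 0 (n + j + 1 + 1)
      field_simp
  -- The candidate for the path sums of the new array. In the top row the second ratio vanishes and
  -- `c` is the path sum of the old array from column `j + 1`.
  let c : ℕ → ℕ → ℝ := fun a n => u a (n + j + 1) * (B a (n + 1) - B (a + 1) (n + 1))
  have F3 : ∀ a n, a < r → belowMix c c a n = u a (n + j) * (B a (n + 1) - B (a + 1) n) := by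
    intro a n ha
    rcases a with _ | a <;> rcases n with _ | n <;> simp only [belowMix, c]
    · rw [hB0, sub_zero, zero_add, F0]
    · rw [show n + 1 + j = n + j + 1 by ring, mul_sub, mul_sub]
      have p := hup 0 (n + j + 1)
      have p2 := hup 0 j
      have : B 0 (n + 1 + 1) = B 0 (n + 1) :=
        mul_left_cancel₀ p2.ne' ((F0 _).trans (F0 _).symm)
      rw [this]
    · rw [F1 a 0 ha, hB0, hB0]
    · rw [F1 a (n + 1) ha]
      rw [show n + 1 + j = n + j + 1 by ring]
      ring
  have F2 : ∀ a n, a < r → rowTop r x a (n + j) * (u a (n + j) * (B a (n + 1) - B (a + 1) n)) =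
      c a n := by
    intro a n ha
    have p1 := hup a (n + j)
    have p2 := hup a (n + j + 1)
    have p3 := hup (a + 1) (n + j)
    simp only [rowTop, c, ← hu]
    split_ifs with h
    · have f1 := F1 a n h
      have e : (u a (n + j + 1) * (B a (n + 1) - B (a + 1) (n + 1))) *
          (1 / u (a + 1) (n + j) + 1 / u a (n + j + 1)) = B a (n + 1) - B (a + 1) n := by
        rw [mul_add]
        nth_rewrite 1 [f1]
        field_simp
        ring
      rw [← e]
      field_simp
    · obtain rfl : a + 1 = r := by omega
      rw [hBr, hBr]
      field_simp
      simp
  have := pathSum_unique (x := dropCols j (rowTop r x)) (c := c) (r := r) (s := n + 1)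
    (fun a b ha hb => by rw [F3 a b ha]; exact (F2 a b ha).symm) (a := r - 1) (b := n)
    (by omega) (by omega)
  rw [← this]
  simp only [c]
  rw [show r - 1 + 1 = r by omega, hBr, hB _ _ (by omega)]
  have p2 := hup (r - 1) (n + j + 1)
  field_simp
  simp

end Arrays

/-! ### Path sums across a rectangle versus shapes of initial intervals -/

section ArrayData

variable {x x' : ℕ → ℕ → ℝ}

/-- Only rows up to `a + k < r - 1` enter, where rowmotion on the strip coincides with `derived`. -/
theorem growth_rowTop_of_lt {r k a : ℕ} (h : a + k + 1 < r) (x : ℕ → ℕ → ℝ) (b : ℕ) :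
    growth k (rowTop r x) a b = growth (k + 1) x a b := by
  rw [growth_succ]
  exact growth_congr fun i j hi hj => rowTop_eq_derived (by omega) x j

/-- The jeu-de-taquin rule for the shapes of a strip of `r` rows under rowmotion. -/
theorem growth_rowTop_rule (hx : ∀ a b, 0 < x a b) {r k a : ℕ} (h : a + k + 1 = r) (b : ℕ) :
    growth k (rowTop r x) a b * growth k x a b *
      ((if k = 0 then 0 else 1 / growth (k - 1) (rowTop r x) (a + 1) b) +
        1 / growth k x a (b + 1)) =
      belowMix (growth (k + 1) x) (growth k (rowTop r x)) a b := by
  rcases k with _ | k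
  · have p1 := pathSum_pos hx a b
    have p2 := pathSum_pos hx a (b + 1)
    have e : belowMix (pathSum (rowTop r x)) (pathSum (rowTop r x)) a b =
        belowMix (growth (0 + 1) x) (growth 0 (rowTop r x)) a b :=
      belowMix_congr (fun i hi => growth_rowTop_of_lt (k := 0) (by omega) x b) fun j hj => rfl
    have e2 : rowTop r x a b = 1 / (pathSum x a b * (1 / pathSum x a (b + 1))) := by
      simp [rowTop, show ¬ (a + 1 < r) by omega]
    rw [← e, growth_zero, growth_zero]
    nth_rewrite 1 [pathSum_eq (rowTop r x)]
    rw [e2, if_pos rfl, zero_add]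
    field_simp
  -- This is the local rule for the new array: its entries below the upper boundary are old entries
  -- with the part number raised by one.
  · have := growth_rule (rowTop_pos r hx) k a b
    rw [growth_rowTop_of_lt (k := k) (a := a) (by omega),
      growth_rowTop_of_lt (k := k) (a := a) (by omega)] at this
    rw [if_neg (by omega), Nat.add_sub_cancel, this]
    exact belowMix_congr (fun i hi => growth_rowTop_of_lt (by omega) x b) fun j hj => rfl

/-- Equality of all path sums from the bottom row to the top row of an `r × s` rectangle. -/
def SameCols (r s : ℕ) (x x' : ℕ → ℕ → ℝ) : Prop :=
  ∀ j n, j + n < s → pathSum (dropCols j x) (r - 1) n = pathSum (dropCols j x') (r - 1) n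

/-- Equality of the shapes of the initial column intervals of an `r × s` rectangle. -/
def SameColShapes (r s : ℕ) (x x' : ℕ → ℕ → ℝ) : Prop :=
  ∀ k a b, a + k + 1 = r → k + b < s → growth k x a b = growth k x' a b

/-- Equality of the shapes of an `r × s` rectangle. -/
def SameShape (r s : ℕ) (x x' : ℕ → ℕ → ℝ) : Prop :=
  ∀ k a b, a + k + 1 = r → b + k + 1 = s → growth k x a b = growth k x' a b

/-- Intervals starting at column `0` are listed separately; every other interval is translated by
rowmotion to one starting a column earlier. -/
theorem sameCols_rowTop_iff {r s : ℕ} (hr : 0 < r) (hx : ∀ a b, 0 < x a b)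
    (hx' : ∀ a b, 0 < x' a b) : SameCols r (s + 1) x x' ↔
      (∀ n ≤ s, pathSum x (r - 1) n = pathSum x' (r - 1) n) ∧
        SameCols r s (rowTop r x) (rowTop r x') := by
  constructor
  · intro h
    refine ⟨fun n hn => h 0 n (by omega), fun j n hjn => ?_⟩
    rw [pathSum_dropCols_rowTop hr hx, pathSum_dropCols_rowTop hr hx']
    exact h (j + 1) n (by omega)
  · rintro ⟨h0, h⟩ j n hjn
    rcases j with _ | j
    · exact h0 n (by omega)
    · rw [← pathSum_dropCols_rowTop hr hx, ← pathSum_dropCols_rowTop hr hx']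
      exact h j n (by omega)

/-- The rule `growth_rowTop_rule` can be solved for the new entry; the other new entries in it have
smaller `b` or smaller `k`. -/
theorem SameColShapes.rowTop {r s : ℕ} (hx : ∀ a b, 0 < x a b) (hx' : ∀ a b, 0 < x' a b)
    (h : SameColShapes r (s + 1) x x') : SameColShapes r s (rowTop r x) (rowTop r x') := by
  suffices ∀ b k a, a + k + 1 = r → k + b < s →
      growth k (_root_.rowTop r x) a b = growth k (_root_.rowTop r x') a b from
    fun k a b => this b k a
  refine pair_induction fun b k h1 h2 a ha hs => ?_
  have e := growth_rowTop_rule hx ha b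
  have e' := growth_rowTop_rule hx' ha b
  have f0 : (if k = 0 then 0 else 1 / growth (k - 1) (_root_.rowTop r x) (a + 1) b) =
      (if k = 0 then 0 else 1 / growth (k - 1) (_root_.rowTop r x') (a + 1) b) := by
    split_ifs with hk
    · rfl
    · rw [h2 (k - 1) (by omega) (a + 1) (by omega) (by omega)]
  rw [← h k a b ha (by omega), ← h k a (b + 1) ha (by omega), ← f0,
    ← belowMix_congr (fun i hi => h (k + 1) i b (by omega) (by omega))
    (fun j hj => h1 j hj a ha (by omega)), ← e, mul_assoc, mul_assoc] at e'
  have p1 := growth_pos hx k a b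
  have p2 := growth_pos hx k a (b + 1)
  have p3 := growth_pos (rowTop_pos r hx) (k - 1) (a + 1) b
  exact (mul_right_cancel₀ (by split_ifs <;> positivity) e').symm

/-- The path sums between the bottom row and the top row determine, and are determined by, the shapes of
the initial column intervals. -/
theorem sameCols_iff {r s : ℕ} (hr : 0 < r) (hx : ∀ a b, 0 < x a b) (hx' : ∀ a b, 0 < x' a b) :
    SameCols r s x x' ↔ SameColShapes r s x x' := by
  induction s generalizing x x' with
  | zero => exact ⟨fun _ _ _ _ _ h => absurd h (by omega), fun _ _ _ h => absurd h (by omega)⟩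
  | succ s ih =>
    -- Rowmotion trades one column of `x` for the path sums starting in column `0`, so the induction
    -- runs over both `x` and its rowmotion image.
    rw [sameCols_rowTop_iff hr hx hx', ih (rowTop_pos r hx) (rowTop_pos r hx')]
    constructor
    · rintro ⟨h0, hy⟩
      have hs : SameColShapes r s x x' := by
        refine (ih hx hx').1 ?_
        have := (ih (rowTop_pos r hx) (rowTop_pos r hx')).2 hy
        have := (sameCols_rowTop_iff hr hx hx').2 ⟨h0, this⟩
        exact fun j n hjn => this j n (by omega)
      intro k
      induction k with
      | zero =>
        intro a b ha hb
        obtain rfl : a = r - 1 := by omega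
        exact h0 b (by omega)
      | succ k ihk =>
        intro a b ha hb
        by_cases hb' : k + 1 + b < s
        · exact hs _ _ _ ha hb'
        -- Only the full width remains. The same rule is now solved for the old entry with part
        -- number `k + 1`, the new entries being known from the rowmotion image.
        have e := growth_rowTop_rule hx (r := r) (a := a + 1) (k := k) (by omega) b
        have e' := growth_rowTop_rule hx' (r := r) (a := a + 1) (k := k) (by omega) b
        have f0 : (if k = 0 then 0 else 1 / growth (k - 1) (rowTop r x) (a + 1 + 1) b) =
            (if k = 0 then 0 else 1 / growth (k - 1) (rowTop r x') (a + 1 + 1) b) := by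
          split_ifs with hk
          · rfl
          · rw [hy (k - 1) (a + 1 + 1) b (by omega) (by omega)]
        rw [hy k (a + 1) b (by omega) (by omega), hs k (a + 1) b (by omega) (by omega),
          ihk (a + 1) (b + 1) (by omega) (by omega), f0, e'] at e
        rcases b with _ | b
        · exact e.symm
        · simp only [belowMix] at e
          rw [hy k (a + 1) b (by omega) (by omega)] at e
          exact (add_right_cancel e).symm
    · intro h
      refine ⟨fun n hn => h 0 (r - 1) n (by omega) (by omega), h.rowTop hx hx'⟩

/-- Equality of all path sums from the first to the last column of an `r × s` rectangle. -/
def SameRows (r s : ℕ) (x x' : ℕ → ℕ → ℝ) : Prop :=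
  ∀ i m, i + m < r → pathSum (dropRows i x) m (s - 1) = pathSum (dropRows i x') m (s - 1)

/-- Equality of the shapes of the initial row intervals of an `r × s` rectangle. -/
def SameRowShapes (r s : ℕ) (x x' : ℕ → ℕ → ℝ) : Prop :=
  ∀ k a b, b + k + 1 = s → k + a < r → growth k x a b = growth k x' a b

theorem sameCols_flip {r s : ℕ} : SameCols s r (flip x) (flip x') ↔ SameRows r s x x' := by
  simp only [SameCols, SameRows, dropCols_flip, pathSum_flip]

theorem sameRows_flip {r s : ℕ} : SameRows s r (flip x) (flip x') ↔ SameCols r s x x' := by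
  simp only [SameCols, SameRows, dropRows_flip, pathSum_flip]

theorem sameColShapes_flip {r s : ℕ} :
    SameColShapes s r (flip x) (flip x') ↔ SameRowShapes r s x x' := by
  simp only [SameColShapes, SameRowShapes, growth_flip]
  exact ⟨fun h k a b => h k b a, fun h k a b => h k b a⟩

theorem sameShape_flip {r s : ℕ} : SameShape s r (flip x) (flip x') ↔ SameShape r s x x' := by
  simp only [SameShape, growth_flip]
  exact ⟨fun h k a b ha hb => h k b a hb ha, fun h k a b ha hb => h k b a hb ha⟩

theorem sameRows_iff {r s : ℕ} (hs : 0 < s) (hx : ∀ a b, 0 < x a b) (hx' : ∀ a b, 0 < x' a b) :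
    SameRows r s x x' ↔ SameRowShapes r s x x' := by
  rw [← sameCols_flip, ← sameColShapes_flip]
  exact sameCols_iff hs (fun a b => hx b a) (fun a b => hx' b a)

theorem SameCols.sameShape {r s : ℕ} (hr : 0 < r) (hx : ∀ a b, 0 < x a b)
    (hx' : ∀ a b, 0 < x' a b) (h : SameCols r s x x') : SameShape r s x x' :=
  fun k a b ha hb => (sameCols_iff hr hx hx').1 h k a b ha (by omega)

theorem SameRows.sameShape {r s : ℕ} (hs : 0 < s) (hx : ∀ a b, 0 < x a b)
    (hx' : ∀ a b, 0 < x' a b) (h : SameRows r s x x') : SameShape r s x x' :=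
  fun k a b ha hb => (sameRows_iff hs hx hx').1 h k a b hb (by omega)

/-- When a column is added, the shape of the full rectangle is the only new one among the shapes
that encode the column path sums. -/
theorem SameCols.of_sameShape {r s : ℕ} (hr : 0 < r) (hx : ∀ a b, 0 < x a b)
    (hx' : ∀ a b, 0 < x' a b) (h : SameCols r s x x') (h' : SameShape r (s + 1) x x') :
    SameCols r (s + 1) x x' := by
  rw [sameCols_iff hr hx hx'] at h ⊢
  intro k a b ha hb
  by_cases hb' : k + b < s
  · exact h k a b ha hb'
  · exact h' k a b ha (by omega)

theorem SameRows.of_sameShape {r s : ℕ} (hs : 0 < s) (hx : ∀ a b, 0 < x a b)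
    (hx' : ∀ a b, 0 < x' a b) (h : SameRows r s x x') (h' : SameShape (r + 1) s x x') :
    SameRows (r + 1) s x x' := by
  rw [← sameCols_flip] at h ⊢
  exact h.of_sameShape hs (fun a b => hx b a) (fun a b => hx' b a) (sameShape_flip.2 h')

/-- A label is the quotient of its path sum by the sum over the lower neighbours. -/
theorem eq_of_pathSum_eq {r s : ℕ} (hx : ∀ a b, 0 < x a b)
    (h : ∀ a b, a < r → b < s → pathSum x a b = pathSum x' a b) {a b : ℕ} (ha : a < r)
    (hb : b < s) : x a b = x' a b := by
  have e := pathSum_eq x a b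
  have e' := pathSum_eq x' a b
  rw [← h a b ha hb, ← belowMix_congr (fun i hi => h i b (by omega) hb)
    (fun j hj => h a j ha (by omega)), e] at e'
  exact mul_right_cancel₀ (belowMix_pos (fun i _ => pathSum_pos hx i b)
    fun j _ => pathSum_pos hx a j).ne' e'

/-- The labels of a rectangle are determined by the shapes of its initial intervals. -/
theorem eq_of_sameShapes {r s : ℕ} (hx : ∀ a b, 0 < x a b) (hx' : ∀ a b, 0 < x' a b)
    (hQ : SameColShapes r s x x') (hP : SameRowShapes r s x x') :
    ∀ a b, a < r → b < s → x a b = x' a b := by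
  induction r generalizing s x x' with
  | zero => intro a b ha; omega
  | succ r ih =>
    rcases s with _ | s
    · intro a b _ hb; omega
    -- Deleting the parts with number `0` leaves the shapes of `derived`, on a rectangle with one
    -- row and one column less.
    have hD := ih (s := s) (derived_pos hx) (derived_pos hx')
      (fun k a b ha hb => hQ (k + 1) a b (by omega) (by omega))
      (fun k a b ha hb => hP (k + 1) a b (by omega) (by omega))
    -- Path sums on the upper boundary are parts with number `0`. From there the definition of
    -- `derived` is inverted downwards: it gives the path sum at a box from those at the two boxes
    -- above.
    have key : ∀ n a b, a ≤ r → b ≤ s → r + s ≤ a + b + n → pathSum x a b = pathSum x' a b := by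
      intro n
      induction n with
      | zero =>
        intro a b ha hb hn
        exact hQ 0 a b (by omega) (by omega)
      | succ n ihn =>
        intro a b ha hb hn
        by_cases ha' : a = r
        · exact hQ 0 a b (by omega) (by omega)
        by_cases hb' : b = s
        · exact hP 0 a b (by omega) (by omega)
        have e := hD a b (by omega) (by omega)
        unfold derived at e
        rw [← ihn (a + 1) b (by omega) (by omega) (by omega),
          ← ihn a (b + 1) (by omega) (by omega) (by omega)] at e
        have p1 := pathSum_pos hx (a + 1) b
        have p2 := pathSum_pos hx a (b + 1)
        have p3 : 0 < 1 / pathSum x (a + 1) b + 1 / pathSum x a (b + 1) := by positivity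
        rw [one_div (_ * _), one_div (_ * _)] at e
        exact mul_right_cancel₀ p3.ne' (inv_injective e)
    intro a b ha hb
    exact eq_of_pathSum_eq hx (fun a b ha hb => key (r + s) a b (by omega) (by omega) (by omega)) ha hb

/-- Removal of the last column. -/
theorem SameRows.removeLast {r s : ℕ} (hs : 0 < s) (hx : ∀ a b, 0 < x a b)
    (hx' : ∀ a b, 0 < x' a b) (h : SameRows r (s + 1) x x') (h' : SameShape r s x x') :
    SameRows r s x x' ∧ ∀ a < r, x a s = x' a s := by
  rw [sameRows_iff (by omega) hx hx'] at h
  -- The shapes ending in the last column and the shape of the rectangle without that column are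
  -- known. The local rule, solved for the entry with part number `k`, propagates this knowledge
  -- down through the rows; `n` counts the rows below the top.
  have key : SameRowShapes r s x x' := by
    suffices ∀ b n k a, b + k + 1 = s → k + a + 1 + n = r → growth k x a b = growth k x' a b from
      fun k a b hb ha => this b (r - (k + a + 1)) k a hb (by omega)
    intro b
    induction b with
    | zero =>
      intro n
      induction n with
      | zero => exact fun k a hb ha => h' k a _ (by omega) hb
      | succ n ihn =>
        intro k a hb ha
        have e := growth_rule hx k a 0
        have e' := growth_rule hx' k a 0
        rw [← h (k + 1) a 0 (by omega) (by omega), ← h k a (0 + 1) (by omega) (by omega),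
          ← ihn k (a + 1) hb (by omega),
          ← belowMix_congr (p := growth (k + 1) x) (q := growth (k + 1) x)
          (fun i hi => h (k + 1) i 0 (by omega) (by omega)) (by omega), ← e] at e'
        have p1 := growth_pos hx (k + 1) a 0
        have p2 := growth_pos hx k a (0 + 1)
        have p3 := growth_pos hx k (a + 1) 0
        rw [mul_assoc, mul_assoc] at e'
        exact (mul_right_cancel₀ (by positivity) (mul_left_cancel₀ p1.ne' e')).symm
    | succ b ihb =>
      intro n
      induction n with
      | zero => exact fun k a hb ha => h' k a _ (by omega) hb
      | succ n ihn =>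
        intro k a hb ha
        have e := growth_rule hx k a (b + 1)
        have e' := growth_rule hx' k a (b + 1)
        rw [← h (k + 1) a (b + 1) (by omega) (by omega),
          ← h k a (b + 1 + 1) (by omega) (by omega),
          ← ihn k (a + 1) hb (by omega),
          ← belowMix_congr (p := growth (k + 1) x) (q := growth (k + 1) x)
          (fun i hi => h (k + 1) i (b + 1) (by omega) (by omega))
          (fun j hj => by obtain rfl : j = b := by omega
                          exact ihb n (k + 1) a (by omega) (by omega)), ← e] at e'
        have p1 := growth_pos hx (k + 1) a (b + 1)
        have p2 := growth_pos hx k a (b + 1 + 1)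
        have p3 := growth_pos hx k (a + 1) (b + 1)
        rw [mul_assoc, mul_assoc] at e'
        exact (mul_right_cancel₀ (by positivity) (mul_left_cancel₀ p1.ne' e')).symm
  refine ⟨(sameRows_iff hs hx hx').2 key, fun a ha => ?_⟩
  obtain ⟨s, rfl⟩ : ∃ n, s = n + 1 := ⟨s - 1, by omega⟩
  -- The path sums in the last two columns are parts with number `0`, so the labels of the last
  -- column can be read off.
  have e := pathSum_eq x a (s + 1)
  have e' := pathSum_eq x' a (s + 1)
  have h0 : ∀ a < r, growth 0 x a (s + 1) = growth 0 x' a (s + 1) :=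
    fun a ha => h 0 a (s + 1) (by omega) (by omega)
  have h1 := key 0 a s (by omega) (by omega)
  simp only [growth_zero] at h0 h1
  rw [← h0 a ha, ← belowMix_congr (fun i hi => h0 i (by omega))
    (fun j hj => by obtain rfl : j = s := by omega
                    exact h1), e] at e'
  exact mul_right_cancel₀ (belowMix_pos (fun i _ => pathSum_pos hx _ _)
    fun j _ => pathSum_pos hx _ _).ne' e'

end ArrayData

/-! ### Columns as linear operators -/

section Push

variable {x x' : ℕ → ℕ → ℝ}

/-- Transfer of a vector indexed by the rows through one column. -/
def pushCol (c f : ℕ → ℝ) : ℕ → ℝ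
  | 0 => c 0 * f 0
  | i + 1 => c (i + 1) * (pushCol c f i + f (i + 1))

/-- Transfer of a vector indexed by the rows through the first `s` columns of an array. -/
def push (x : ℕ → ℕ → ℝ) (f : ℕ → ℝ) : ℕ → ℕ → ℝ
  | 0 => f
  | s + 1 => pushCol (fun i => x i s) (push x f s)

theorem pushCol_congr {c c' f f' : ℕ → ℝ} {i : ℕ} (hc : ∀ k ≤ i, c k = c' k)
    (hf : ∀ k ≤ i, f k = f' k) : pushCol c f i = pushCol c' f' i := by
  induction i with
  | zero => simp [pushCol, hc, hf]
  | succ i ih =>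
    rw [pushCol, pushCol, hc _ le_rfl, hf _ le_rfl, ih (fun k hk => hc k (by omega))
      fun k hk => hf k (by omega)]

theorem push_congr {f f' : ℕ → ℝ} {s i : ℕ} (hx : ∀ k j, k ≤ i → j < s → x k j = x' k j)
    (hf : ∀ k ≤ i, f k = f' k) : push x f s i = push x' f' s i := by
  induction s generalizing i with
  | zero => exact hf i le_rfl
  | succ s ih =>
    exact pushCol_congr (fun k hk => hx k s hk (by omega))
      fun k hk => ih (fun a j ha hj => hx a j (by omega) (by omega)) fun a ha => hf a (by omega)

theorem push_add (f : ℕ → ℝ) (s n : ℕ) :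
    push x f (s + n) = push (dropCols s x) (push x f s) n := by
  induction n with
  | zero => rfl
  | succ n ih =>
    rw [← add_assoc, push, push, ih]
    simp only [dropCols, add_comm]

theorem push_sum (f : ℕ → ℝ) (s : ℕ) {r i : ℕ} (hi : i < r) :
    push x f s i = ∑ k ∈ Finset.range r, f k * push x (fun j => if j = k then 1 else 0) s i := by
  induction s generalizing i with
  | zero => simp [push, hi]
  | succ s ihs =>
    induction i with
    | zero =>
      simp only [push, pushCol]
      rw [ihs hi, Finset.mul_sum]
      exact Finset.sum_congr rfl fun k _ => by ring
    | succ i ih =>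
      have := ih (by omega)
      simp only [push, pushCol] at this ⊢
      rw [ihs hi, this, ← Finset.sum_add_distrib, Finset.mul_sum]
      exact Finset.sum_congr rfl fun k _ => by ring

theorem push_single_of_lt (k s : ℕ) {i : ℕ} (h : i < k) :
    push x (fun j => if j = k then 1 else 0) s i = 0 := by
  induction s generalizing i with
  | zero => simp [push, h.ne]
  | succ s ihs =>
    induction i with
    | zero => simp [push, pushCol, ihs h]
    | succ i ih =>
      have := ih (by omega)
      simp only [push, pushCol] at this ⊢
      rw [this, ihs h]
      simp

/-- The matrix entries of the operator of a block of columns are its path sums between rows. -/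
theorem push_single_add (k s i : ℕ) :
    push x (fun j => if j = k then 1 else 0) (s + 1) (i + k) = pathSum (dropRows k x) i s := by
  refine pathSum_unique (c := fun i s => push x (fun j => if j = k then 1 else 0) (s + 1) (i + k))
    (r := i + 1) (s := s + 1) (fun a b ha hb => ?_) (by omega) (by omega)
  have h0 : ∀ s, push x (fun j => if j = k then 1 else 0) (s + 1) (0 + k) =
      x k s * push x (fun j => if j = k then 1 else 0) s k := by
    intro s
    rcases k with _ | k
    · simp [push, pushCol]
    · have := push_single_of_lt (x := x) (k + 1) (s + 1) (i := k) (by omega)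
      rw [zero_add, push, pushCol]
      rw [push] at this
      rw [this, zero_add]
  have h1 : ∀ s a, push x (fun j => if j = k then 1 else 0) (s + 1) (a + 1 + k) =
      x (a + 1 + k) s * (push x (fun j => if j = k then 1 else 0) (s + 1) (a + k) +
        push x (fun j => if j = k then 1 else 0) s (a + 1 + k)) := by
    intro s a
    rw [show a + 1 + k = a + k + 1 by ring]
    rw [push, pushCol]
  rcases a with _ | a <;> rcases b with _ | b <;> simp only [belowMix, dropRows, h0, h1]
  · simp [push]
  · rw [← h0 b]; simp
  · simp [push]

/-- Equality of the transfer maps of two `r × s` rectangles. -/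
def SamePush (r s : ℕ) (x x' : ℕ → ℕ → ℝ) : Prop :=
  ∀ f i, i < r → push x f s i = push x' f s i

/-- Turns a family of numerical identities into the equality of two operators. Operators of adjacent
blocks compose, and those of single columns are invertible, so blocks can be appended or cancelled.
-/
theorem sameRows_iff_samePush {r s : ℕ} (hs : 0 < s) : SameRows r s x x' ↔ SamePush r s x x' := by
  obtain ⟨s, rfl⟩ : ∃ n, s = n + 1 := ⟨s - 1, by omega⟩
  constructor
  · intro h f i hi
    rw [push_sum f _ hi, push_sum f _ hi]
    refine Finset.sum_congr rfl fun k _ => ?_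
    by_cases hk : i < k
    · rw [push_single_of_lt _ _ hk, push_single_of_lt _ _ hk]
    · obtain ⟨m, rfl⟩ : ∃ m, i = m + k := ⟨i - k, by omega⟩
      rw [push_single_add, push_single_add]
      congr 1
      exact h k m (by omega)
  · intro h k m hm
    rw [Nat.add_sub_cancel, ← push_single_add, ← push_single_add]
    exact h _ _ (by omega)

theorem SamePush.append {r s n : ℕ} (h : SamePush r s x x')
    (h' : SamePush r n (dropCols s x) (dropCols s x')) : SamePush r (s + n) x x' := by
  intro f i hi
  rw [push_add, push_add, h' _ i hi]
  exact push_congr (fun _ _ _ _ => rfl) fun k hk => h f k (by omega)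

theorem samePush_of_eq {r s : ℕ} (h : ∀ a b, a < r → b < s → x a b = x' a b) :
    SamePush r s x x' :=
  fun _ _ hi => push_congr (fun k j hk hj => h k j (by omega) hj) fun _ _ => rfl

theorem SamePush.dropFirst {r s : ℕ} (hx : ∀ a b, 0 < x a b)
    (h : SamePush r (1 + s) x x') (h0 : ∀ a < r, x a 0 = x' a 0) :
    SamePush r s (dropCols 1 x) (dropCols 1 x') := by
  intro g i hi
  -- The preimage of `g` under the first column, obtained by solving `g i = x i 0 * (g (i - 1) + f
  -- i)`.
  let f : ℕ → ℝ := fun i => g i / x i 0 - (if i = 0 then 0 else g (i - 1))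
  have e : ∀ i, push x f 1 i = g i := by
    intro i
    induction i with
    | zero =>
      have := hx 0 0
      simp only [push, pushCol, f]
      field_simp
      simp
    | succ i ih =>
      have := hx (i + 1) 0
      simp only [push] at ih
      simp only [push, pushCol, ih]
      simp [f]
      field_simp
  have e' : ∀ i < r, push x' f 1 i = g i := fun i hi => by
    rw [← e i]
    refine push_congr (fun k j hk hj => ?_) fun _ _ => rfl
    obtain rfl : j = 0 := by omega
    exact (h0 k (by omega)).symm
  have := h f i hi
  rw [push_add, push_add] at this
  rw [push_congr (fun _ _ _ _ => rfl) fun k _ => (e k).symm, this]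
  exact push_congr (fun _ _ _ _ => rfl) fun k hk => e' k (by omega)

theorem dropRows_dropRows (i j : ℕ) (x : ℕ → ℕ → ℝ) :
    dropRows j (dropRows i x) = dropRows (i + j) x := by
  funext a b
  rw [dropRows, dropRows, dropRows, show a + j + i = a + (i + j) by omega]

theorem dropCols_dropCols (i j : ℕ) (x : ℕ → ℕ → ℝ) :
    dropCols j (dropCols i x) = dropCols (i + j) x := by
  funext a b
  rw [dropCols, dropCols, dropCols, show b + j + i = b + (i + j) by omega]

theorem SameRows.mono {r s n : ℕ} (h : SameRows r s x x') (hn : n ≤ r) : SameRows n s x x' :=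
  fun j m hm => h j m (by omega)

/-- Sorts the paths by their first step instead of their last. Constant arrays are fed to `belowMix`
because only its case distinction at the boundary is wanted. -/
theorem pathSum_firstStep (x : ℕ → ℕ → ℝ) (a b : ℕ) : pathSum x a b = x 0 0 *
    belowMix (fun _ _ => pathSum (dropRows 1 x) (a - 1) b)
      (fun _ _ => pathSum (dropCols 1 x) a (b - 1)) a b := by
  refine (pathSum_unique (r := a + 1) (s := b + 1) (c := fun a b => x 0 0 *
    belowMix (fun _ _ => pathSum (dropRows 1 x) (a - 1) b)
      (fun _ _ => pathSum (dropCols 1 x) a (b - 1)) a b)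
    (fun a b _ _ => ?_) (by omega) (by omega)).symm
  have q0 : ∀ z b, pathSum z 0 (b + 1) = z 0 (b + 1) * pathSum z 0 b := fun z b => by rw [pathSum]
  have q1 : ∀ z a, pathSum z (a + 1) 0 = z (a + 1) 0 * pathSum z a 0 := fun z a => by rw [pathSum]
  have q2 : ∀ z a b, pathSum z (a + 1) (b + 1) =
      z (a + 1) (b + 1) * (pathSum z a (b + 1) + pathSum z (a + 1) b) := fun z a b => by rw [pathSum]
  have q : ∀ z, pathSum z 0 0 = z 0 0 := fun z => by rw [pathSum]
  rcases a with _ | _ | a <;> rcases b with _ | _ | b <;>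
    simp only [belowMix, Nat.add_sub_cancel, q, q0, q1, q2] <;>
    simp only [dropRows, dropCols, zero_add] <;> ring

end Push

/-! ### Rowmotion on a rectangle and removal of the first column -/

section RowMap

variable {x x' : ℕ → ℕ → ℝ}

/-- The reciprocal weight above a position of an `r × s` rectangle. -/
noncomputable def above (r s : ℕ) (w : ℝ) (u : ℕ → ℕ → ℝ) (a b : ℕ) : ℝ :=
  (if a + 1 < r then 1 / u (a + 1) b else 0) + (if b + 1 < s then 1 / u a (b + 1) else 0) +
    (if a + 1 < r ∨ b + 1 < s then 0 else 1 / w)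

/-- The labels after rowmotion on an `r × s` rectangle with top weight `w`. -/
noncomputable def rowMap (r s : ℕ) (w : ℝ) (x : ℕ → ℕ → ℝ) (a b : ℕ) : ℝ :=
  1 / (pathSum x a b * above r s w (pathSum x) a b)

theorem above_pos {r s : ℕ} {w : ℝ} (hw : 0 < w) {u : ℕ → ℕ → ℝ} (hu : ∀ a b, 0 < u a b)
    (a b : ℕ) : 0 < above r s w u a b := by
  have h2 := hu (a + 1) b
  have h3 := hu a (b + 1)
  unfold above
  split_ifs <;> first | positivity | (exfalso; tauto)

theorem above_flip (r s : ℕ) (w : ℝ) (u : ℕ → ℕ → ℝ) (a b : ℕ) :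
    above s r w (flip u) b a = above r s w u a b := by
  simp only [above, flip, or_comm, add_comm]

theorem rowMap_pos {r s : ℕ} {w : ℝ} (hw : 0 < w) (hx : ∀ a b, 0 < x a b) (a b : ℕ) :
    0 < rowMap r s w x a b := by
  have h1 := pathSum_pos hx a b
  have h2 := above_pos (r := r) (s := s) hw (pathSum_pos hx) a b
  unfold rowMap
  positivity

theorem rowMap_flip (r s : ℕ) (w : ℝ) (x : ℕ → ℕ → ℝ) :
    rowMap s r w (flip x) = flip (rowMap r s w x) := by
  funext a b
  have e : pathSum (flip x) = flip (pathSum x) := by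
    funext a b; exact pathSum_flip x a b
  simp only [rowMap, e, above_flip, flip]

theorem rowMap_eq_rowTop {r s : ℕ} (w : ℝ) (x : ℕ → ℕ → ℝ) (a : ℕ) {b : ℕ} (hb : b + 1 < s) :
    rowMap r s w x a b = rowTop r x a b := by
  simp [rowMap, rowTop, above, hb]

theorem rowMap_eq_derived {r s : ℕ} (w : ℝ) (x : ℕ → ℕ → ℝ) {a b : ℕ} (ha : a + 1 < r)
    (hb : b + 1 < s) : rowMap r s w x a b = derived x a b := by
  rw [rowMap_eq_rowTop w x a hb, rowTop_eq_derived ha]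

/-- Away from the last column, rowmotion on the rectangle is rowmotion on the strip. -/
theorem pathSum_dropCols_rowMap {r s : ℕ} (hr : 0 < r) (w : ℝ) (hx : ∀ a b, 0 < x a b) {j n : ℕ}
    (h : j + n + 1 < s) : pathSum (dropCols j (rowMap r s w x)) (r - 1) n =
      pathSum (dropCols (j + 1) x) (r - 1) n := by
  rw [← pathSum_dropCols_rowTop hr hx]
  exact pathSum_congr fun a b _ hb => rowMap_eq_rowTop w x a (by omega)

theorem pathSum_dropRows_rowMap {r s : ℕ} (hs : 0 < s) (w : ℝ) (hx : ∀ a b, 0 < x a b) {i m : ℕ}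
    (h : i + m + 1 < r) : pathSum (dropRows i (rowMap r s w x)) m (s - 1) =
      pathSum (dropRows (i + 1) x) m (s - 1) := by
  have := pathSum_dropCols_rowMap hs w (x := flip x) (fun a b => hx b a) h
  rwa [rowMap_flip, dropCols_flip, dropCols_flip, pathSum_flip, pathSum_flip] at this

/-- For positive `k` this is the local rule of the new array at part number `k - 1`, where one of
the entries is an old one with part number `k`; for `k = 0` it is the definition at the top box. -/
theorem growth_rowMap_rule {r s : ℕ} {w : ℝ} (hw : 0 < w) (hx : ∀ a b, 0 < x a b) {k a b : ℕ}
    (ha : a + k + 1 = r) (hb : b + k + 1 = s) :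
    growth k (rowMap r s w x) a b * growth k x a b *
      (if k = 0 then 1 / w else 1 / growth (k - 1) (rowMap r s w x) (a + 1) b +
        1 / growth (k - 1) (rowMap r s w x) a (b + 1)) =
      belowMix (growth k (rowMap r s w x)) (growth k (rowMap r s w x)) a b := by
  rcases k with _ | k
  · have p := pathSum_pos hx a b
    have e : rowMap r s w x a b = 1 / (pathSum x a b * (1 / w)) := by
      simp [rowMap, above, show ¬ a + 1 < r by omega, show ¬ b + 1 < s by omega]
    rw [growth_zero, growth_zero]
    nth_rewrite 1 [pathSum_eq (rowMap r s w x)]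
    rw [e, if_pos rfl]
    field_simp
  · have := growth_rule (rowMap_pos (r := r) (s := s) hw hx) k a b
    rw [if_neg (by omega), Nat.add_sub_cancel, ← this]
    congr 2
    rw [growth_succ k x]
    exact (growth_congr fun i j hi hj => rowMap_eq_derived w x (by omega) (by omega)).symm

/-- Reciprocity: rowmotion turns path sums from the bottom into reciprocals of path sums to the top.
The recursion by the first step, read from the top downwards, is the definition of `rowMap`. -/
theorem pathSum_rowMap_top {r s : ℕ} {w : ℝ} (hw : 0 < w) (hx : ∀ a b, 0 < x a b) {i j : ℕ}
    (hi : i < r) (hj : j < s) :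
    pathSum (dropRows i (dropCols j (rowMap r s w x))) (r - 1 - i) (s - 1 - j) * pathSum x i j =
      w := by
  suffices ∀ m n i j, i + m + 1 = r → j + n + 1 = s →
      pathSum (dropRows i (dropCols j (rowMap r s w x))) m n * pathSum x i j = w from
    this _ _ i j (by omega) (by omega)
  refine pair_induction fun m n h1 h2 i j hi hj => ?_
  have key : rowMap r s w x i j * (pathSum x i j * above r s w (pathSum x) i j) = 1 := by
    have p := pathSum_pos hx i j
    have p2 := above_pos (r := r) (s := s) hw (pathSum_pos hx) i j
    unfold rowMap
    field_simp
  rw [pathSum_firstStep]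
  have e0 : dropRows i (dropCols j (rowMap r s w x)) 0 0 = rowMap r s w x i j := by
    simp [dropRows, dropCols]
  have e1 : dropRows 1 (dropRows i (dropCols j (rowMap r s w x))) =
      dropRows (i + 1) (dropCols j (rowMap r s w x)) := by
    rw [dropRows_dropRows]
  have e2 : dropCols 1 (dropRows i (dropCols j (rowMap r s w x))) =
      dropRows i (dropCols (j + 1) (rowMap r s w x)) := by
    rw [← dropCols_dropCols]; rfl
  have g1 : ∀ m', m' + 1 = m → pathSum (dropRows (i + 1) (dropCols j (rowMap r s w x))) m' n =
      w * (1 / pathSum x (i + 1) j) := fun m' hm => by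
    have p := pathSum_pos hx (i + 1) j
    rw [mul_one_div, eq_div_iff p.ne']
    exact h1 m' hm (i + 1) j (by omega) hj
  have g2 : ∀ n', n' + 1 = n → pathSum (dropRows i (dropCols (j + 1) (rowMap r s w x))) m n' =
      w * (1 / pathSum x i (j + 1)) := fun n' hn => by
    have p := pathSum_pos hx i (j + 1)
    rw [mul_one_div, eq_div_iff p.ne']
    exact h2 n' hn i (j + 1) hi (by omega)
  have e3 : belowMix (fun _ _ => pathSum (dropRows (i + 1) (dropCols j (rowMap r s w x))) (m - 1) n)
      (fun _ _ => pathSum (dropRows i (dropCols (j + 1) (rowMap r s w x))) m (n - 1)) m n =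
      w * above r s w (pathSum x) i j := by
    rcases m with _ | m <;> rcases n with _ | n <;> simp only [belowMix, Nat.add_sub_cancel]
    · simp [above, show ¬ i + 1 < r by omega, show ¬ j + 1 < s by omega, hw.ne']
    · rw [g2 n rfl]
      simp [above, show ¬ i + 1 < r by omega, show j + 1 < s by omega]
    · rw [g1 m rfl]
      simp [above, show i + 1 < r by omega, show ¬ j + 1 < s by omega]
    · rw [g1 m rfl, g2 n rfl]
      simp [above, show i + 1 < r by omega, show j + 1 < s by omega, mul_add]
  rw [e0, e1, e2, e3]
  linear_combination w * key

/-- Removal of the first column. -/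
theorem SameRows.removeFirst {r s : ℕ} (hs : 0 < s) (hx : ∀ a b, 0 < x a b)
    (hx' : ∀ a b, 0 < x' a b) (h : SameRows r (s + 1) x x')
    (h' : SameShape r s (dropCols 1 x) (dropCols 1 x')) :
    SameRows r s (dropCols 1 x) (dropCols 1 x') ∧ ∀ a < r, x a 0 = x' a 0 := by
  rcases Nat.eq_zero_or_pos r with rfl | hr
  · exact ⟨fun _ _ h => absurd h (by omega), fun _ h => absurd h (by omega)⟩
  -- Rowmotion moves the rectangle without its first column to the rectangle without its last
  -- column, whose shape is then known. The top weight plays no role and is taken to be `1`.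
  have hy := rowMap_pos (r := r) (s := s + 1) one_pos hx
  have hy' := rowMap_pos (r := r) (s := s + 1) one_pos hx'
  have shift : ∀ z : ℕ → ℕ → ℝ, (∀ a b, 0 < z a b) →
      SameCols r s (rowMap r (s + 1) 1 z) (dropCols 1 z) := fun z hz j n hjn => by
    rw [pathSum_dropCols_rowMap hr 1 hz (by omega)]
    rw [dropCols_dropCols, add_comm]
  have hdc : ∀ z : ℕ → ℕ → ℝ, (∀ a b, 0 < z a b) → ∀ a b, 0 < dropCols 1 z a b :=
    fun z hz a b => hz _ _
  have sh1 : SameShape r s (rowMap r (s + 1) 1 x) (rowMap r (s + 1) 1 x') := by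
    intro k a b ha hb
    rw [(shift x hx).sameShape hr hy (hdc x hx) k a b ha hb,
      (shift x' hx').sameShape hr hy' (hdc x' hx') k a b ha hb]
    exact h' k a b ha hb
  have rows1 : SameRows (r - 1) (s + 1) (rowMap r (s + 1) 1 x) (rowMap r (s + 1) 1 x') := by
    intro i m him
    rw [pathSum_dropRows_rowMap (by omega) 1 hx (by omega),
      pathSum_dropRows_rowMap (by omega) 1 hx' (by omega)]
    exact h (i + 1) m (by omega)
  have sh2 : SameShape (r - 1) (s + 1) (rowMap r (s + 1) 1 x) (rowMap r (s + 1) 1 x') :=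
    rows1.sameShape (by omega) hy hy'
  have sh0 : SameShape r (s + 1) x x' := h.sameShape (by omega) hx hx'
  -- The shapes of the image without its last column (`sh1`) and without its last row (`sh2`) and
  -- the old full shape (`sh0`) determine the new full shape.
  have sh : SameShape r (s + 1) (rowMap r (s + 1) 1 x) (rowMap r (s + 1) 1 x') := by
    intro k a b ha hb
    have e := growth_rowMap_rule one_pos hx ha hb
    have e' := growth_rowMap_rule one_pos hx' ha hb
    have f0 : (if k = 0 then 1 / 1 else 1 / growth (k - 1) (rowMap r (s + 1) 1 x) (a + 1) b +
          1 / growth (k - 1) (rowMap r (s + 1) 1 x) a (b + 1)) =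
        (if k = 0 then 1 / 1 else 1 / growth (k - 1) (rowMap r (s + 1) 1 x') (a + 1) b +
          1 / growth (k - 1) (rowMap r (s + 1) 1 x') a (b + 1)) := by
      split_ifs with hk
      · rfl
      · rw [sh1 (k - 1) (a + 1) b (by omega) (by omega),
          sh2 (k - 1) a (b + 1) (by omega) (by omega)]
    rw [← sh0 k a b ha hb, ← f0, ← belowMix_congr (fun i hi => sh2 k i b (by omega) hb)
      (fun j hj => sh1 k a j ha (by omega)), ← e, mul_assoc, mul_assoc] at e'
    have p1 := growth_pos hx k a b
    have p2 := growth_pos hy (k - 1) (a + 1) b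
    have p3 := growth_pos hy (k - 1) a (b + 1)
    exact (mul_right_cancel₀ (by split_ifs <;> positivity) e').symm
  have rows : SameRows r (s + 1) (rowMap r (s + 1) 1 x) (rowMap r (s + 1) 1 x') := by
    have := rows1.of_sameShape (by omega) hy hy' (by rwa [Nat.sub_add_cancel hr])
    rwa [Nat.sub_add_cancel hr] at this
  -- By reciprocity the path sums of `x` in its first column are the reciprocals of row path sums of
  -- the image, which have just been shown to agree.
  have u0 : ∀ a b, a < r → b < 1 → pathSum x a b = pathSum x' a b := by
    intro a b ha hb
    obtain rfl : b = 0 := by omega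
    have t := pathSum_rowMap_top one_pos hx ha (Nat.succ_pos s)
    have t' := pathSum_rowMap_top one_pos hx' ha (Nat.succ_pos s)
    have e := rows a (r - 1 - a) (by omega)
    change pathSum (_root_.dropRows a (rowMap r (s + 1) 1 x)) _ _ * _ = _ at t
    change pathSum (_root_.dropRows a (rowMap r (s + 1) 1 x')) _ _ * _ = _ at t'
    simp only [Nat.sub_zero] at t t'
    rw [← e] at t'
    exact mul_left_cancel₀ (left_ne_zero_of_mul_eq_one t) (t.trans t'.symm)
  have x0 : ∀ a < r, x a 0 = x' a 0 := fun a ha =>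
    eq_of_pathSum_eq hx u0 ha (Nat.one_pos)
  refine ⟨?_, x0⟩
  -- With equal first columns, their operator can be cancelled.
  rw [sameRows_iff_samePush hs]
  rw [sameRows_iff_samePush (by omega), add_comm] at h
  exact h.dropFirst hx x0

end RowMap

/-! ### Commutation of the deformed maps on two crossing rectangles -/

section Commutation

/-- The number of steps by which a map of the given kind moves the up-diagonals. -/
def ShiftKind.rowStep : ShiftKind → ℕ
  | .proP => 0
  | .proQ => 1
  | .row => 1

/-- The number of steps by which a map of the given kind moves the down-diagonals. -/
def ShiftKind.colStep : ShiftKind → ℕ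
  | .proP => 1
  | .proQ => 0
  | .row => 1

/-- The kind obtained by exchanging the two coordinates. -/
def ShiftKind.swap : ShiftKind → ShiftKind
  | .proP => .proQ
  | .proQ => .proP
  | .row => .row

theorem ShiftKind.rowStep_swap (k : ShiftKind) : k.swap.rowStep = k.colStep := by cases k <;> rfl

theorem ShiftKind.colStep_swap (k : ShiftKind) : k.swap.colStep = k.rowStep := by cases k <;> rfl

/-- The change of the shape of an `r × s` rectangle under a map of the given kind. -/
def ShapeRule (k : ShiftKind) (r s : ℕ) (w : ℝ) (x x' : ℕ → ℕ → ℝ) : Prop :=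
  match k with
  | .row => ∀ k a b, a + k + 1 = r → b + k + 1 = s →
      growth k x' a b * growth k x a b *
        (if k = 0 then 1 / w else 1 / growth (k - 1) x' (a + 1) b +
          1 / growth (k - 1) x' a (b + 1)) =
      belowMix (growth k x') (growth k x') a b
  | _ => SameShape r s x x'

/-- The effect of a map of the given kind on path sums and shapes. -/
structure ChainShift (k : ShiftKind) (r s : ℕ) (w : ℝ) (x x' : ℕ → ℕ → ℝ) : Prop where
  rows : ∀ i m, i + m + k.rowStep < r → m + 1 < r →
    pathSum (dropRows i x') m (s - 1) = pathSum (dropRows (i + k.rowStep) x) m (s - 1)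
  cols : ∀ j n, j + n + k.colStep < s → n + 1 < s →
    pathSum (dropCols j x') (r - 1) n = pathSum (dropCols (j + k.colStep) x) (r - 1) n
  shape : ShapeRule k r s w x x'

theorem ChainShift.flip {k : ShiftKind} {r s : ℕ} {w : ℝ} {x x' : ℕ → ℕ → ℝ}
    (h : ChainShift k r s w x x') : ChainShift k.swap s r w (flip x) (flip x') where
  rows i m h1 h2 := by
    rw [k.rowStep_swap] at *
    rw [dropRows_flip, dropRows_flip, pathSum_flip, pathSum_flip]
    exact h.cols i m h1 h2
  cols i m h1 h2 := by
    rw [k.colStep_swap] at *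
    rw [dropCols_flip, dropCols_flip, pathSum_flip, pathSum_flip]
    exact h.rows i m h1 h2
  shape := by
    have := h.shape
    cases k with
    | proP => exact sameShape_flip.2 this
    | proQ => exact sameShape_flip.2 this
    | row =>
      intro k a b ha hb
      have e := this k b a hb ha
      have e2 : ∀ k, growth k (_root_.flip x') = _root_.flip (growth k x') := fun k => by
        funext a b; exact growth_flip k x' a b
      simp only [e2, belowMix_flip, growth_flip]
      rw [← e]
      simp only [add_comm]

/-- The extra hypotheses serve rowmotion only, whose rule expresses the new shape by the old shape
and by the new shapes of the rectangles with one row or one column less. -/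
theorem ShapeRule.sameShape {k : ShiftKind} {r s : ℕ} {w : ℝ} (hw : 0 < w) {x x' y y' : ℕ → ℕ → ℝ}
    (hx : ∀ a b, 0 < x a b) (hx' : ∀ a b, 0 < x' a b) (h : ShapeRule k r s w x x')
    (h' : ShapeRule k r s w y y') (h0 : SameShape r s x y)
    (h1 : k = .row → SameShape (r - 1) s x' y') (h2 : k = .row → SameShape r (s - 1) x' y') :
    SameShape r s x' y' := by
  have triv : SameShape r s x x' → SameShape r s y y' → SameShape r s x' y' :=
    fun e e' k a b ha hb => by rw [← e k a b ha hb, ← e' k a b ha hb, h0 k a b ha hb]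
  cases k with
  | proP => exact triv h h'
  | proQ => exact triv h h'
  | row =>
    intro k a b ha hb
    have e := h k a b ha hb
    have e' := h' k a b ha hb
    have f0 : (if k = 0 then 1 / w else 1 / growth (k - 1) x' (a + 1) b +
          1 / growth (k - 1) x' a (b + 1)) =
        (if k = 0 then 1 / w else 1 / growth (k - 1) y' (a + 1) b +
          1 / growth (k - 1) y' a (b + 1)) := by
      split_ifs with hk
      · rfl
      · rw [h2 rfl (k - 1) (a + 1) b (by omega) (by omega),
          h1 rfl (k - 1) a (b + 1) (by omega) (by omega)]
    rw [← h0 k a b ha hb, ← f0, ← belowMix_congr (fun i hi => h1 rfl k i b (by omega) hb)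
      (fun j hj => h2 rfl k a j ha (by omega)), ← e, mul_assoc, mul_assoc] at e'
    have p1 := growth_pos hx k a b
    have p2 := growth_pos hx' (k - 1) (a + 1) b
    have p3 := growth_pos hx' (k - 1) a (b + 1)
    exact (mul_right_cancel₀ (by split_ifs <;> positivity) e').symm

theorem SameShape.symm {r s : ℕ} {x x' : ℕ → ℕ → ℝ} (h : SameShape r s x x') :
    SameShape r s x' x := fun k a b ha hb => (h k a b ha hb).symm

theorem SameShape.trans {r s : ℕ} {x y z : ℕ → ℕ → ℝ} (h : SameShape r s x y)
    (h' : SameShape r s y z) : SameShape r s x z :=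
  fun k a b ha hb => (h k a b ha hb).trans (h' k a b ha hb)

/-- Operators of blocks compose, so equality in the middle block and equal labels in the outer
columns suffice. -/
theorem SamePush.widen {n d s e : ℕ} {x x' : ℕ → ℕ → ℝ}
    (h : SamePush n s (dropCols d x) (dropCols d x'))
    (h' : ∀ a b, a < n → b < d + s + e → (b < d ∨ d + s ≤ b) → x a b = x' a b) :
    SamePush n (d + s + e) x x' := by
  refine SamePush.append (SamePush.append (samePush_of_eq fun a b ha hb => ?_) h)
    (samePush_of_eq fun a b ha hb => ?_)
  · exact h' a b ha (by omega) (Or.inl hb)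
  · exact h' a _ ha (by omega) (Or.inr (by omega))

/-- The labels of a rectangle with lower corner `(a, b)`. -/
def corner (X : ℤ → ℤ → ℝ) (a b : ℤ) : ℕ → ℕ → ℝ := fun i j => X (a + i) (b + j)

theorem dropRows_corner (X : ℤ → ℤ → ℝ) (a b : ℤ) (n : ℕ) :
    dropRows n (corner X a b) = corner X (a + n) b := by
  funext i j
  simp only [dropRows, corner]
  push_cast
  rw [add_comm (i : ℤ), add_assoc]

theorem dropCols_corner (X : ℤ → ℤ → ℝ) (a b : ℤ) (n : ℕ) :
    dropCols n (corner X a b) = corner X a (b + n) := by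
  funext i j
  simp only [dropCols, corner]
  push_cast
  rw [add_comm (j : ℤ), add_assoc]

theorem corner_flip (X : ℤ → ℤ → ℝ) (a b : ℤ) : corner (flip X) b a = flip (corner X a b) := rfl

/-- A map acting on a rectangle with more rows and fewer columns moves the path sums of the rows of a
wider rectangle. -/
theorem ChainShift.sameRows_wide {k : ShiftKind} {r s : ℕ} {w : ℝ} {X X' : ℤ → ℤ → ℝ} {a b : ℤ}
    (h : ChainShift k r s w (corner X a b) (corner X' a b)) (hs : 0 < s) {i c : ℤ} {n t : ℕ}
    (hn : n < r) (hi : a ≤ i) (hi' : i + n + k.rowStep ≤ a + r) (hc : c ≤ b)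
    (hc' : b + s ≤ c + t)
    (ho : ∀ i' j, i ≤ i' → i' < i + n → c ≤ j → j < c + t → (j < b ∨ b + s ≤ j) →
      X' i' j = X (i' + k.rowStep) j) :
    SameRows n t (corner X' i c) (corner X (i + k.rowStep) c) := by
  obtain ⟨d, rfl⟩ : ∃ d : ℕ, b = c + d := ⟨(b - c).toNat, by omega⟩
  obtain ⟨e, rfl⟩ : ∃ e : ℕ, t = d + s + e := ⟨t - d - s, by omega⟩
  obtain ⟨i, rfl⟩ : ∃ l : ℕ, i = a + l := ⟨(i - a).toNat, by omega⟩
  rw [sameRows_iff_samePush (by omega)]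
  refine SamePush.widen ?_ ?_
  · rw [← sameRows_iff_samePush hs, dropCols_corner, dropCols_corner]
    intro l m hlm
    have := h.rows (i + l) m (by omega) (by omega)
    simp only [dropRows_corner] at this ⊢
    push_cast at this ⊢
    rw [show a + (i : ℤ) + l = a + (i + l) by ring,
      show a + (i : ℤ) + k.rowStep + l = a + (i + l + k.rowStep) by ring]
    exact this
  · intro l j hl hj hlj
    have := ho (a + i + l) (c + j) (by omega) (by omega) (by omega) (by omega) (by omega)
    simp only [corner]
    rw [this]
    congr 1
    ring

section Half

variable {k₁ k₂ : ShiftKind} {a₁ b₁ a₂ b₂ a' b' : ℤ} {r₁ s₁ r₂ s₂ : ℕ} {w : ℝ}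
  {X X' Y Z W : ℤ → ℤ → ℝ}

/-- The comparison of the two orders of applying two maps, seen from the rectangle with fewer rows and
more columns. -/
theorem commute_half (ea : a' + k₁.rowStep = a₂) (eb : b' + k₂.colStep = b₁)
    (hw : 0 < w) (hr₂ : 0 < r₂) (hs₁ : 0 < s₁) (hr : r₂ < r₁)
    (hX : ∀ i j, 0 < X i j) (hX' : ∀ i j, 0 < X' i j) (hY : ∀ i j, 0 < Y i j)
    (hZ : ∀ i j, 0 < Z i j) (hW : ∀ i j, 0 < W i j)
    (ha : a₁ + k₁.rowStep ≤ a₂) (ha' : a₂ + r₂ ≤ a₁ + r₁) (hb : b₂ + k₂.colStep ≤ b₁)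
    (hb' : b₁ + s₁ ≤ b₂ + s₂) (hs : s₁ < s₂)
    (h1 : ChainShift k₁ r₁ s₁ w (corner X a₁ b₁) (corner X' a₁ b₁))
    (h1o : ∀ i j, a' ≤ i → i < a' + r₂ → b₂ ≤ j → j < b₂ + s₂ →
      (j < b₁ ∨ b₁ + s₁ ≤ j) → X' i j = X (i + k₁.rowStep) j)
    (h2 : ChainShift k₂ r₂ s₂ w (corner X a₂ b₂) (corner Z a₂ b₂))
    (h3 : ChainShift k₂ r₂ s₂ w (corner X' a' b₂)
      (corner Y a' b₂))
    (h4 : ChainShift k₁ r₁ s₁ w (corner Z a₁ b') (corner W a₁ b'))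
    (h4o : ∀ i j, a' ≤ i → i < a' + r₂ → b₂ ≤ j → j < b₂ + s₂ →
      (j < b' ∨ b' + s₁ ≤ j) → W i j = Z (i + k₁.rowStep) j) :
    SameRows r₂ s₁ (corner Y a' b')
      (corner W a' b') ∧
    ∀ i j, a' ≤ i → i < a' + r₂ → b₂ ≤ j → j < b₂ + s₂ →
      (j < b' ∨ b' + s₁ ≤ j) → Y i j = W i j := by
  have pos : ∀ {F : ℤ → ℤ → ℝ}, (∀ i j, 0 < F i j) → ∀ a b i j, 0 < corner F a b i j :=
    fun hF a b i j => hF _ _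
  -- the map of the first kind, seen from a wide rectangle
  have E1 : ∀ (c : ℤ) (t : ℕ), b₂ ≤ c → c ≤ b₁ → b₁ + s₁ ≤ c + t → c + t ≤ b₂ + s₂ →
      SameRows r₂ t (corner X' a' c) (corner X a₂ c) := fun c t hc1 hc2 hc3 hc4 => by
    have := h1.sameRows_wide hs₁ (i := a') (c := c) (n := r₂) (t := t) hr (by omega) (by omega)
      hc2 hc3 fun i j hi1 hi2 hj1 hj2 hj => h1o i j hi1 hi2 (by omega) (by omega) hj
    rwa [ea] at this
  have E4 : ∀ (c : ℤ) (t : ℕ), b₂ ≤ c → c ≤ b' → b' + s₁ ≤ c + t → c + t ≤ b₂ + s₂ →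
      SameRows r₂ t (corner W a' c) (corner Z a₂ c) := fun c t hc1 hc2 hc3 hc4 => by
    have := h4.sameRows_wide hs₁ (i := a') (c := c) (n := r₂) (t := t) hr (by omega) (by omega)
      hc2 hc3 fun i j hi1 hi2 hj1 hj2 hj => h4o i j hi1 hi2 (by omega) (by omega) hj
    rwa [ea] at this
  -- The second map translates the path sums of proper column intervals of the wide rectangle.
  have C : ∀ {F F' : ℤ → ℤ → ℝ} {a : ℤ}, ChainShift k₂ r₂ s₂ w (corner F a b₂) (corner F' a b₂) →
      ∀ (c : ℤ) (t : ℕ), b₂ ≤ c → c + t + k₂.colStep ≤ b₂ + s₂ → t < s₂ →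
      SameCols r₂ t (corner F' a c) (corner F a (c + k₂.colStep)) := by
    intro F F' a h c t hc1 hc2 ht j n hjn
    obtain ⟨l, rfl⟩ : ∃ l : ℕ, c = b₂ + l := ⟨(c - b₂).toNat, by omega⟩
    have := h.cols (l + j) n (by omega) (by omega)
    simp only [dropCols_corner] at this ⊢
    push_cast at this ⊢
    rw [show b₂ + (l : ℤ) + j = b₂ + (l + j) by ring,
      show b₂ + (l : ℤ) + k₂.colStep + j = b₂ + (l + j + k₂.colStep) by ring]
    exact this
  -- A chain of comparisons from `Y` through `X'` and `X` to `Z`: column path sums for the second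
  -- map, row path sums for the first, column path sums again. Each preserves the shape.
  have U2 : ∀ (c : ℤ) (t : ℕ), b₂ ≤ c → c ≤ b' → b' + s₁ ≤ c + t →
      c + t + k₂.colStep ≤ b₂ + s₂ → t < s₂ → SameShape r₂ t (corner Y a' c) (corner Z a₂ c) := by
    intro c t hc1 hc2 hc3 hc4 ht
    refine ((C h3 c t hc1 hc4 ht).sameShape hr₂ (pos hY _ _) (pos hX' _ _)).trans ?_
    refine (((E1 (c + k₂.colStep) t (by omega) (by omega) (by omega) (by omega)).sameShape
      (by omega) (pos hX' _ _) (pos hX _ _))).trans ?_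
    exact ((C h2 c t hc1 hc4 ht).sameShape hr₂ (pos hZ _ _) (pos hX _ _)).symm
  have EW := E4 b₂ s₂ le_rfl (by omega) (by omega) le_rfl
  have EX := E1 b₂ s₂ le_rfl (by omega) (by omega) le_rfl
  -- Proper row intervals are translated by both maps. The full height is missing here and is
  -- supplied by the shape `sh0`.
  have rows0 : SameRows (r₂ - 1) s₂ (corner Y a' b₂) (corner W a' b₂) := by
    intro i m him
    have hq : k₂.rowStep ≤ 1 := by cases k₂ <;> decide
    rw [h3.rows i m (by omega) (by omega), EX (i + k₂.rowStep) m (by omega),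
      ← h2.rows i m (by omega) (by omega), EW i m (by omega)]
  have sh0 : SameShape r₂ s₂ (corner Y a' b₂) (corner W a' b₂) := by
    refine SameShape.trans ?_ (EW.sameShape (by omega) (pos hW _ _) (pos hZ _ _)).symm
    refine h3.shape.sameShape hw (pos hX' _ _) (pos hY _ _) h2.shape
      (EX.sameShape (by omega) (pos hX' _ _) (pos hX _ _)) (fun _ => ?_) (fun hk => ?_)
    · refine (rows0.sameShape (by omega) (pos hY _ _) (pos hW _ _)).trans ?_
      exact (EW.mono (by omega)).sameShape (by omega) (pos hW _ _) (pos hZ _ _)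
    · have : k₂.colStep = 1 := by rw [hk]; rfl
      exact U2 b₂ (s₂ - 1) le_rfl (by omega) (by omega) (by omega) (by omega)
  have full : SameRows r₂ s₂ (corner Y a' b₂) (corner W a' b₂) := by
    have := rows0.of_sameShape (by omega) (pos hY _ _) (pos hW _ _)
      (by rwa [Nat.sub_add_cancel hr₂])
    rwa [Nat.sub_add_cancel hr₂] at this
  have sh : ∀ (c : ℤ) (t : ℕ), b₂ ≤ c → c ≤ b' → b' + s₁ ≤ c + t →
      c + t + k₂.colStep ≤ b₂ + s₂ → t < s₂ → SameShape r₂ t (corner Y a' c) (corner W a' c) :=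
    fun c t hc1 hc2 hc3 hc4 ht => (U2 c t hc1 hc2 hc3 hc4 ht).trans
      ((E4 c t hc1 hc2 hc3 (by omega)).sameShape (by omega) (pos hW _ _) (pos hZ _ _)).symm
  have hp : k₂.colStep ≤ 1 := by cases k₂ <;> decide
  -- The columns to the right of the tall rectangle are stripped off; `e` counts those already
  -- removed.
  have right : ∀ e t : ℕ, t + e = s₂ → b' + s₁ ≤ b₂ + t →
      SameRows r₂ t (corner Y a' b₂) (corner W a' b₂) ∧
      ∀ i j, i < r₂ → t ≤ j → j < s₂ → corner Y a' b₂ i j = corner W a' b₂ i j := by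
    intro e
    induction e with
    | zero =>
      intro t ht _
      obtain rfl : t = s₂ := by omega
      exact ⟨full, fun i j _ h h' => absurd h (by omega)⟩
    | succ e ih =>
      intro t ht hbt
      obtain ⟨g1, g2⟩ := ih (t + 1) (by omega) (by omega)
      obtain ⟨f1, f2⟩ := g1.removeLast (by omega) (pos hY _ _) (pos hW _ _)
        (sh b₂ t le_rfl (by omega) hbt (by omega) (by omega))
      refine ⟨f1, fun i j hi hj hj' => ?_⟩
      rcases Nat.eq_or_lt_of_le hj with rfl | hj
      · exact f2 i hi
      · exact g2 i j hi hj hj'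
  obtain ⟨d, hd⟩ : ∃ d : ℕ, b' = b₂ + d := ⟨(b' - b₂).toNat, by omega⟩
  obtain ⟨g1, g2⟩ := right (s₂ - (d + s₁)) (d + s₁) (by omega) (by omega)
  -- The `d` columns to the left are stripped off in the same way, so that the row path sums of the
  -- intersection remain.
  have left : ∀ l : ℕ, l ≤ d →
      SameRows r₂ (d + s₁ - l) (corner Y a' (b₂ + l)) (corner W a' (b₂ + l)) ∧
      ∀ i j, i < r₂ → j < l → corner Y a' b₂ i j = corner W a' b₂ i j := by
    intro l
    induction l with
    | zero => exact fun _ => ⟨by simpa using g1, fun i j _ h => absurd h (by omega)⟩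
    | succ l ih =>
      intro hl
      obtain ⟨f1, f2⟩ := ih (by omega)
      rw [show d + s₁ - l = d + s₁ - (l + 1) + 1 by omega] at f1
      have e := f1.removeFirst (by omega) (pos hY _ _) (pos hW _ _) (by
        rw [dropCols_corner, dropCols_corner]
        exact sh _ _ (by omega) (by omega) (by omega) (by omega) (by omega))
      rw [dropCols_corner, dropCols_corner] at e
      refine ⟨by
        push_cast
        rw [← add_assoc]
        exact e.1, fun i j hi hj => ?_⟩
      rcases Nat.eq_or_lt_of_le (Nat.le_of_lt_succ hj) with rfl | hj
      · simpa [corner] using e.2 i hi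
      · exact f2 i j hi hj
  obtain ⟨f1, f2⟩ := left d le_rfl
  rw [hd, show s₁ = d + s₁ - d by omega]
  refine ⟨f1, fun i j hi1 hi2 hj1 hj2 hj => ?_⟩
  obtain ⟨i, rfl⟩ : ∃ l : ℕ, i = a' + l := ⟨(i - a').toNat, by omega⟩
  obtain ⟨j, rfl⟩ : ∃ l : ℕ, j = b₂ + l := ⟨(j - b₂).toNat, by omega⟩
  rcases hj with hj | hj
  · exact f2 i j (by omega) (by omega)
  · exact g2 i j (by omega) (by omega) (by omega)

/-- The maps of two crossing rectangles commute. -/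
theorem commute_labels (ea : a' + k₁.rowStep = a₂) (eb : b' + k₂.colStep = b₁)
    (hw : 0 < w) (hr₂ : 0 < r₂) (hs₁ : 0 < s₁) (hr : r₂ < r₁) (hs : s₁ < s₂)
    (hX : ∀ i j, 0 < X i j) (hX' : ∀ i j, 0 < X' i j) (hY : ∀ i j, 0 < Y i j)
    (hZ : ∀ i j, 0 < Z i j) (hW : ∀ i j, 0 < W i j)
    (ha : a₁ + k₁.rowStep ≤ a₂) (ha' : a₂ + r₂ ≤ a₁ + r₁) (hb : b₂ + k₂.colStep ≤ b₁)
    (hb' : b₁ + s₁ ≤ b₂ + s₂)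
    (h1 : ChainShift k₁ r₁ s₁ w (corner X a₁ b₁) (corner X' a₁ b₁))
    (h1o : ∀ i j, a' ≤ i → i < a' + r₂ → b₂ ≤ j → j < b₂ + s₂ →
      (j < b₁ ∨ b₁ + s₁ ≤ j) → X' i j = X (i + k₁.rowStep) j)
    (h2 : ChainShift k₂ r₂ s₂ w (corner X a₂ b₂) (corner Z a₂ b₂))
    (h2o : ∀ i j, b' ≤ j → j < b' + s₁ → a₁ ≤ i → i < a₁ + r₁ →
      (i < a₂ ∨ a₂ + r₂ ≤ i) → Z i j = X i (j + k₂.colStep))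
    (h3 : ChainShift k₂ r₂ s₂ w (corner X' a' b₂)
      (corner Y a' b₂))
    (h3o : ∀ i j, b' ≤ j → j < b' + s₁ → a₁ ≤ i → i < a₁ + r₁ →
      (i < a' ∨ a' + r₂ ≤ i) → Y i j = X' i (j + k₂.colStep))
    (h4 : ChainShift k₁ r₁ s₁ w (corner Z a₁ b') (corner W a₁ b'))
    (h4o : ∀ i j, a' ≤ i → i < a' + r₂ → b₂ ≤ j → j < b₂ + s₂ →
      (j < b' ∨ b' + s₁ ≤ j) → W i j = Z (i + k₁.rowStep) j)
    {i j : ℤ} (hij : (a' ≤ i ∧ i < a' + r₂ ∧ b₂ ≤ j ∧ j < b₂ + s₂) ∨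
      (a₁ ≤ i ∧ i < a₁ + r₁ ∧ b' ≤ j ∧ j < b' + s₁)) :
    Y i j = W i j := by
  obtain ⟨p1, p2⟩ := commute_half ea eb hw hr₂ hs₁ hr hX hX' hY hZ hW ha ha' hb hb' hs h1 h1o h2 h3 h4 h4o
  -- Transposition makes the second rectangle the tall one, so the two orders of composition, and
  -- with them `Y` and `W`, exchange roles.
  have q := commute_half (k₁ := k₂.swap) (k₂ := k₁.swap) (X := flip X) (X' := flip Z)
    (Y := flip W) (Z := flip X') (W := flip Y)
    (by rwa [k₂.rowStep_swap]) (by rwa [k₁.colStep_swap]) hw hs₁ hr₂ hs (fun i j => hX j i)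
    (fun i j => hZ j i) (fun i j => hW j i) (fun i j => hX' j i) (fun i j => hY j i)
    (by rwa [k₂.rowStep_swap]) hb' (by rwa [k₁.colStep_swap]) ha' hr
    h2.flip
    (by rw [k₂.rowStep_swap]; exact fun i j => h2o j i)
    h1.flip
    h4.flip
    h3.flip
    (by rw [k₂.rowStep_swap]; exact fun i j => h3o j i)
  rw [corner_flip, corner_flip, sameRows_flip] at q
  obtain ⟨q1, q2⟩ := q
  by_cases hi : a' ≤ i ∧ i < a' + r₂
  · by_cases hj : b' ≤ j ∧ j < b' + s₁
    · obtain ⟨i, rfl⟩ : ∃ l : ℕ, i = a' + l := ⟨(i - a').toNat, by omega⟩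
      obtain ⟨j, rfl⟩ : ∃ l : ℕ, j = b' + l := ⟨(j - b').toNat, by omega⟩
      have pY : ∀ i' j', 0 < corner Y a' b' i' j' := fun _ _ => hY _ _
      have pW : ∀ i' j', 0 < corner W a' b' i' j' := fun _ _ => hW _ _
      -- On the intersection, row and column path sums agree, which leaves no freedom for the
      -- labels.
      exact eq_of_sameShapes (r := r₂) (s := s₁) pY pW
        ((sameCols_iff hr₂ pY pW).1 fun j n h => (q1 j n h).symm)
        ((sameRows_iff hs₁ pY pW).1 p1) i j (by omega) (by omega)
    · exact p2 i j (by omega) (by omega) (by omega) (by omega) (by omega)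
  · exact (q2 j i (by omega) (by omega) (by omega) (by omega) (by omega)).symm

end Half

end Commutation

/-! ### From deformed maps on a rectangle to positive arrays -/

section Bridge

variable {R : Rectangle} {t : ℝ}

theorem Rectangle.mem_boxes {R : Rectangle} {p : ℤ × ℤ} :
    p ∈ R.boxes ↔ (R.i₀ ≤ p.1 ∧ p.1 ≤ R.i₁) ∧ R.j₀ ≤ p.2 ∧ p.2 ≤ R.j₁ := by
  simp [Rectangle.boxes]

theorem Rectangle.numRows_eq (R : Rectangle) : (R.numRows : ℤ) = R.i₁ - R.i₀ + 1 := by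
  have := R.hi
  unfold Rectangle.numRows
  omega

theorem Rectangle.numCols_eq (R : Rectangle) : (R.numCols : ℤ) = R.j₁ - R.j₀ + 1 := by
  have := R.hj
  unfold Rectangle.numCols
  omega

theorem Rectangle.numRows_pos (R : Rectangle) : 0 < R.numRows := by
  have := R.numRows_eq
  have := R.hi
  omega

theorem Rectangle.numCols_pos (R : Rectangle) : 0 < R.numCols := by
  have := R.numCols_eq
  have := R.hj
  omega

/-- The box of a rectangle with given coordinates relative to the least box. -/
def Rectangle.box (R : Rectangle) (a b : ℕ) (ha : a < R.numRows) (hb : b < R.numCols) : R.boxes :=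
  ⟨(R.i₀ + a, R.j₀ + b), Rectangle.mem_boxes.2 (by
    have := R.numRows_eq
    have := R.numCols_eq
    dsimp only
    omega)⟩

theorem Rectangle.box_eq_iff {p : R.boxes} {a b : ℕ} {ha : a < R.numRows} {hb : b < R.numCols} :
    p = R.box a b ha hb ↔ p.1.1 = R.i₀ + a ∧ p.1.2 = R.j₀ + b := by
  rw [Subtype.ext_iff, Prod.ext_iff]
  rfl

theorem Rectangle.covBy_iff {p q : R.boxes} : p ⋖ q ↔
    (p.1.1 + 1 = q.1.1 ∧ p.1.2 = q.1.2) ∨ (p.1.1 = q.1.1 ∧ p.1.2 + 1 = q.1.2) := by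
  obtain ⟨⟨i, j⟩, hp⟩ := p
  obtain ⟨⟨i', j'⟩, hq⟩ := q
  have hp' := Rectangle.mem_boxes.1 hp
  have hq' := Rectangle.mem_boxes.1 hq
  have lt_iff : ∀ {a b c d : ℤ} {h : (a, b) ∈ R.boxes} {h' : (c, d) ∈ R.boxes},
      (⟨(a, b), h⟩ : R.boxes) < ⟨(c, d), h'⟩ ↔ a ≤ c ∧ b ≤ d ∧ (a < c ∨ b < d) := by
    intro a b c d h h'
    rw [Subtype.mk_lt_mk, Prod.mk_lt_mk]
    omega
  dsimp only at hp' hq' ⊢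
  constructor
  · rintro ⟨h1, h2⟩
    rw [lt_iff] at h1
    by_contra hcon
    by_cases hi : i < i'
    · have hm : (i + 1, j) ∈ R.boxes := Rectangle.mem_boxes.2 (by dsimp only; omega)
      exact h2 (c := ⟨(i + 1, j), hm⟩) (lt_iff.2 (by omega)) (lt_iff.2 (by omega))
    · have hm : (i, j + 1) ∈ R.boxes := Rectangle.mem_boxes.2 (by dsimp only; omega)
      exact h2 (c := ⟨(i, j + 1), hm⟩) (lt_iff.2 (by omega)) (lt_iff.2 (by omega))
  · intro h
    refine ⟨lt_iff.2 (by omega), ?_⟩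
    rintro ⟨⟨k, l⟩, hc⟩ h1 h2
    rw [lt_iff] at h1 h2
    omega

/-- The array of the exponentials of the labels of a rectangle. -/
noncomputable def expArray (t : ℝ) (R : Rectangle) (x : R.boxes → ℝ) (a b : ℕ) : ℝ :=
  Real.exp (t * labelAt x (R.i₀ + a, R.j₀ + b))

theorem labelAt_of_mem {M : Finset (ℤ × ℤ)} (x : M → ℝ) {p : ℤ × ℤ} (h : p ∈ M) :
    labelAt x p = x ⟨p, h⟩ := by
  simp [labelAt, h]

theorem expArray_pos (t : ℝ) (R : Rectangle) (x : R.boxes → ℝ) (a b : ℕ) :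
    0 < expArray t R x a b := Real.exp_pos _

theorem expArray_box (t : ℝ) (x : R.boxes → ℝ) {a b : ℕ} (ha : a < R.numRows)
    (hb : b < R.numCols) : expArray t R x a b = Real.exp (t * x (R.box a b ha hb)) := by
  have e : labelAt x (R.i₀ + a, R.j₀ + b) = x (R.box a b ha hb) :=
    labelAt_of_mem x (R.box a b ha hb).2
  rw [expArray, e]

theorem exp_mul_log_div (ht : t ≠ 0) {S : ℝ} (hS : 0 < S) :
    Real.exp (t * (Real.log S / t)) = S := by
  rw [mul_div_cancel₀ _ ht, Real.exp_log hS]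

theorem exp_softMax (ht : t ≠ 0) (x : R.boxes → ℝ) {a b : ℕ} (ha : a < R.numRows)
    (hb : b < R.numCols) : Real.exp (t * softMax t x (R.box a b ha hb)) =
      belowMix (expArray t R x) (expArray t R x) a b := by
  classical
  unfold softMax
  rcases a with _ | a <;> rcases b with _ | b
  · have e : lowerCovers (R.box 0 0 ha hb) = ∅ := by
      refine Finset.eq_empty_of_forall_notMem fun q hq => ?_
      have := Rectangle.mem_boxes.1 q.2
      rw [mem_lowerCovers, Rectangle.covBy_iff] at hq
      simp only [Rectangle.box] at hq
      omega
    simp [e, belowMix]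
  · have e : lowerCovers (R.box 0 (b + 1) ha hb) = {R.box 0 b ha (by omega)} := by
      ext q
      have := Rectangle.mem_boxes.1 q.2
      rw [mem_lowerCovers, Rectangle.covBy_iff, Finset.mem_singleton, Rectangle.box_eq_iff]
      simp only [Rectangle.box]
      omega
    rw [if_pos (by simp [e]), e, Finset.sum_singleton, exp_mul_log_div ht (Real.exp_pos _),
      belowMix, expArray_box]
  · have e : lowerCovers (R.box (a + 1) 0 ha hb) = {R.box a 0 (by omega) hb} := by
      ext q
      have := Rectangle.mem_boxes.1 q.2
      rw [mem_lowerCovers, Rectangle.covBy_iff, Finset.mem_singleton, Rectangle.box_eq_iff]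
      simp only [Rectangle.box]
      omega
    rw [if_pos (by simp [e]), e, Finset.sum_singleton, exp_mul_log_div ht (Real.exp_pos _),
      belowMix, expArray_box]
  · have e : lowerCovers (R.box (a + 1) (b + 1) ha hb) =
        {R.box a (b + 1) (by omega) hb, R.box (a + 1) b ha (by omega)} := by
      ext q
      have := Rectangle.mem_boxes.1 q.2
      rw [mem_lowerCovers, Rectangle.covBy_iff, Finset.mem_insert, Finset.mem_singleton,
        Rectangle.box_eq_iff, Rectangle.box_eq_iff]
      simp only [Rectangle.box]
      omega
    rw [if_pos (by simp [e]), e, Finset.sum_pair (by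
      rw [Ne, Rectangle.box_eq_iff]
      simp only [Rectangle.box]
      omega), exp_mul_log_div ht (add_pos (Real.exp_pos _) (Real.exp_pos _)), belowMix,
      expArray_box _ _ (by omega) hb, expArray_box _ _ ha (by omega)]

/-- The soft minimum becomes a sum of reciprocals, and the empty minimum `1` becomes the weight `exp
t` above the top box. -/
theorem exp_neg_softMin (ht : t ≠ 0) (x : R.boxes → ℝ) {a b : ℕ} (ha : a < R.numRows)
    (hb : b < R.numCols) : Real.exp (-(t * softMin t x (R.box a b ha hb))) =
      above R.numRows R.numCols (Real.exp t) (expArray t R x) a b := by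
  classical
  have hr := R.numRows_eq
  have hs := R.numCols_eq
  have hinv : ∀ p, Real.exp (t * -x p) = 1 / Real.exp (t * x p) := fun p => by
    rw [mul_neg, Real.exp_neg, one_div]
  unfold softMin above
  by_cases ha' : a + 1 < R.numRows <;> by_cases hb' : b + 1 < R.numCols
  · have e : upperCovers (R.box a b ha hb) =
        {R.box (a + 1) b ha' hb, R.box a (b + 1) ha hb'} := by
      ext q
      have := Rectangle.mem_boxes.1 q.2
      rw [mem_upperCovers, Rectangle.covBy_iff, Finset.mem_insert, Finset.mem_singleton,
        Rectangle.box_eq_iff, Rectangle.box_eq_iff]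
      simp only [Rectangle.box]
      omega
    rw [if_pos (by simp [e]), e, Finset.sum_pair (by
      rw [Ne, Rectangle.box_eq_iff]
      simp only [Rectangle.box]
      omega), mul_neg, neg_neg, exp_mul_log_div ht (add_pos (Real.exp_pos _) (Real.exp_pos _)),
      hinv, hinv, expArray_box _ _ ha' hb, expArray_box _ _ ha hb']
    simp [ha', hb']
  · have e : upperCovers (R.box a b ha hb) = {R.box (a + 1) b ha' hb} := by
      ext q
      have := Rectangle.mem_boxes.1 q.2
      rw [mem_upperCovers, Rectangle.covBy_iff, Finset.mem_singleton, Rectangle.box_eq_iff]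
      simp only [Rectangle.box]
      omega
    rw [if_pos (by simp [e]), e, Finset.sum_singleton, mul_neg, neg_neg,
      exp_mul_log_div ht (Real.exp_pos _), hinv, expArray_box _ _ ha' hb]
    simp [ha', hb']
  · have e : upperCovers (R.box a b ha hb) = {R.box a (b + 1) ha hb'} := by
      ext q
      have := Rectangle.mem_boxes.1 q.2
      rw [mem_upperCovers, Rectangle.covBy_iff, Finset.mem_singleton, Rectangle.box_eq_iff]
      simp only [Rectangle.box]
      omega
    rw [if_pos (by simp [e]), e, Finset.sum_singleton, mul_neg, neg_neg,
      exp_mul_log_div ht (Real.exp_pos _), hinv, expArray_box _ _ ha hb']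
    simp [ha', hb']
  · have e : upperCovers (R.box a b ha hb) = ∅ := by
      refine Finset.eq_empty_of_forall_notMem fun q hq => ?_
      have := Rectangle.mem_boxes.1 q.2
      rw [mem_upperCovers, Rectangle.covBy_iff] at hq
      simp only [Rectangle.box] at hq
      omega
    simp [e, ha', hb', Real.exp_neg]

theorem expArray_softTransfer_inv (ht : t ≠ 0) (x : R.boxes → ℝ) {a b : ℕ} (ha : a < R.numRows)
    (hb : b < R.numCols) : expArray t R ((softTransfer t)⁻¹ x) a b =
      pathSum (expArray t R x) a b := by
  refine pathSum_unique (r := R.numRows) (s := R.numCols) (fun a b ha hb => ?_) ha hb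
  rw [expArray_box _ _ ha hb, expArray_box _ _ ha hb, ← exp_softMax ht _ ha hb, ← Real.exp_add,
    ← mul_add]
  congr 2
  exact softTransferInv_eq t x _

theorem expArray_softTransfer (ht : t ≠ 0) (x : R.boxes → ℝ) {a b : ℕ} (ha : a < R.numRows)
    (hb : b < R.numCols) : expArray t R (softTransfer t x) a b *
      belowMix (expArray t R x) (expArray t R x) a b = expArray t R x a b := by
  rw [expArray_box _ _ ha hb, expArray_box _ _ ha hb, ← exp_softMax ht _ ha hb, ← Real.exp_add,
    ← mul_add]
  congr 2
  simp [softTransfer]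

theorem expArray_softRowmotion_inv_of_mem (ht : t ≠ 0) (I : Finset R.boxes) (u : R.boxes → ℝ)
    {a b : ℕ} (ha : a < R.numRows) (hb : b < R.numCols) (h : R.box a b ha hb ∈ I) :
    expArray t R ((softRowmotion t I)⁻¹ u) a b * expArray t R u a b *
      above R.numRows R.numCols (Real.exp t) (expArray t R u) a b =
      belowMix (expArray t R ((softRowmotion t I)⁻¹ u))
        (expArray t R ((softRowmotion t I)⁻¹ u)) a b := by
  rw [expArray_box _ _ ha hb, expArray_box _ _ ha hb, ← exp_softMax ht _ ha hb,
    ← exp_neg_softMin ht _ ha hb, ← Real.exp_add, ← Real.exp_add,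
    softRowmotion_inv_apply_of_mem t h]
  congr 1
  ring

theorem expArray_softRowmotion_inv_of_notMem (I : Finset R.boxes) (u : R.boxes → ℝ)
    {a b : ℕ} (ha : a < R.numRows) (hb : b < R.numCols) (h : R.box a b ha hb ∉ I) :
    expArray t R ((softRowmotion t I)⁻¹ u) a b = expArray t R u a b := by
  rw [expArray_box _ _ ha hb, expArray_box _ _ ha hb, softRowmotion_inv_apply_of_notMem t h]

theorem Rectangle.mem_file {κ : ℤ} {p : R.boxes} : p ∈ R.file κ ↔ p.1.1 - p.1.2 = κ := by
  simp [Rectangle.file]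

theorem Rectangle.mem_ideal {i j : ℤ} {p : R.boxes} : p ∈ R.ideal i j ↔ p.1.1 ≤ i ∧ p.1.2 ≤ j := by
  simp [Rectangle.ideal]

theorem expArray_file_of_mem (ht : t ≠ 0) (κ : ℤ) (u : R.boxes → ℝ)
    {a b : ℕ} (ha : a < R.numRows) (hb : b < R.numCols) (h : R.i₀ + a - (R.j₀ + b) = κ) :
    expArray t R (softRowmotion t (R.file κ) u) a b * expArray t R u a b *
      above R.numRows R.numCols (Real.exp t) (expArray t R u) a b =
      belowMix (expArray t R u) (expArray t R u) a b := by
  rw [expArray_box _ _ ha hb, expArray_box _ _ ha hb, ← exp_softMax ht _ ha hb,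
    ← exp_neg_softMin ht _ ha hb, ← Real.exp_add, ← Real.exp_add,
    softRowmotion_apply_of_mem t (Rectangle.mem_file.2 h)]
  -- Elements covering a box lie in neighbouring files, so the toggles in this file do not alter
  -- them.
  have e : softMin t (softRowmotion t (R.file κ) u) (R.box a b ha hb) =
      softMin t u (R.box a b ha hb) := by
    refine softMin_congr fun q hq => softRowmotion_apply_of_notMem t ?_ u
    rw [Rectangle.mem_file]
    rw [Rectangle.covBy_iff] at hq
    simp only [Rectangle.box] at hq
    omega
  rw [e]
  congr 1
  ring

theorem expArray_file_of_ne (κ : ℤ) (u : R.boxes → ℝ)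
    {a b : ℕ} (ha : a < R.numRows) (hb : b < R.numCols) (h : R.i₀ + a - (R.j₀ + b) ≠ κ) :
    expArray t R (softRowmotion t (R.file κ) u) a b = expArray t R u a b := by
  rw [expArray_box _ _ ha hb, expArray_box _ _ ha hb,
    softRowmotion_apply_of_notMem t (fun h' => h (Rectangle.mem_file.1 h'))]

/-- The array of labels after RSK. -/
noncomputable def rskArray (r s : ℕ) (x : ℕ → ℕ → ℝ) (a b : ℕ) : ℝ :=
  growth (min (r - 1 - a) (s - 1 - b)) x a b

theorem rskArray_flip (r s : ℕ) (x : ℕ → ℕ → ℝ) (a b : ℕ) :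
    rskArray s r (flip x) b a = rskArray r s x a b := by
  simp only [rskArray, growth_flip, min_comm]

/-- Toggling from the bottom up in the ideals is the local rule of growth diagrams: every inverse
rowmotion raises the part number by one at the boxes of its ideal, and the upper neighbours of these
boxes still carry the previous part number. -/
theorem expArray_rowmotion_ideals (ht : t ≠ 0) (x : R.boxes → ℝ) (n : ℕ) :
    ∀ a b, a < R.numRows → b < R.numCols →
    expArray t R (((List.range n).map (fun k : ℕ =>
      (softRowmotion t (R.ideal (R.i₁ - n + k) (R.j₁ - n + k)))⁻¹)).prod
        ((softTransfer t)⁻¹ x)) a b =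
      growth (min n (min (R.numRows - 1 - a) (R.numCols - 1 - b))) (expArray t R x) a b := by
  have hr := R.numRows_eq
  have hs := R.numCols_eq
  induction n with
  | zero =>
    intro a b ha hb
    simpa [growth_zero] using expArray_softTransfer_inv ht x ha hb
  | succ n ih =>
    -- The new factor belongs to the smallest ideal and is applied last; the other factors are those
    -- of the induction hypothesis with the index moved by one.
    have e : ((List.range (n + 1)).map (fun k : ℕ =>
        (softRowmotion t (R.ideal (R.i₁ - (n + 1 : ℕ) + k) (R.j₁ - (n + 1 : ℕ) + k)))⁻¹)).prod =
        (softRowmotion t (R.ideal (R.i₁ - (n + 1 : ℕ)) (R.j₁ - (n + 1 : ℕ))))⁻¹ *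
        ((List.range n).map (fun k : ℕ =>
          (softRowmotion t (R.ideal (R.i₁ - n + k) (R.j₁ - n + k)))⁻¹)).prod := by
      rw [List.range_succ_eq_map, List.map_cons, List.prod_cons, List.map_map]
      congr 3
      · simp
      · funext k
        simp only [Function.comp_apply]
        push_cast
        ring_nf
    rw [e]
    simp only [Equiv.Perm.mul_apply]
    set u := ((List.range n).map (fun k : ℕ =>
      (softRowmotion t (R.ideal (R.i₁ - n + k) (R.j₁ - n + k)))⁻¹)).prod ((softTransfer t)⁻¹ x)
    set v := (softRowmotion t (R.ideal (R.i₁ - (n + 1 : ℕ)) (R.j₁ - (n + 1 : ℕ))))⁻¹ u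
    have hx := expArray_pos t R x
    suffices ∀ a b, a < R.numRows → b < R.numCols → a + n + 1 < R.numRows →
        b + n + 1 < R.numCols → expArray t R v a b = growth (n + 1) (expArray t R x) a b by
      intro a b ha hb
      by_cases h : a + n + 1 < R.numRows ∧ b + n + 1 < R.numCols
      · rw [this a b ha hb h.1 h.2, show min (n + 1) (min (R.numRows - 1 - a)
          (R.numCols - 1 - b)) = n + 1 by omega]
      · rw [expArray_softRowmotion_inv_of_notMem _ _ ha hb (fun hm => h (by
          rw [Rectangle.mem_ideal] at hm
          simp only [Rectangle.box] at hm
          push_cast at hm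
          omega)), ih a b ha hb]
        congr 1
        omega
    refine pair_induction fun a b h1 h2 ha hb ha' hb' => ?_
    have key := expArray_softRowmotion_inv_of_mem ht
      (R.ideal (R.i₁ - (n + 1 : ℕ)) (R.j₁ - (n + 1 : ℕ))) u ha hb (by
        rw [Rectangle.mem_ideal]
        simp only [Rectangle.box]
        push_cast
        omega)
    have rule := growth_rule hx n a b
    rw [belowMix_congr (p' := growth (n + 1) (expArray t R x))
      (q' := growth (n + 1) (expArray t R x))
      (fun i hi => h1 i hi (by omega) hb (by omega) hb')
      (fun j hj => h2 j hj ha (by omega) ha' (by omega)), ← rule] at key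
    have g : ∀ i j, i + n < R.numRows → j + n < R.numCols →
        expArray t R u i j = growth n (expArray t R x) i j := fun i j hi hj => by
      rw [ih i j (by omega) (by omega)]
      congr 1
      omega
    rw [g a b (by omega) (by omega), above, if_pos (by omega), if_pos (by omega),
      if_pos (by omega), g _ _ (by omega) (by omega), g _ _ (by omega) (by omega), add_zero,
      mul_assoc, mul_assoc] at key
    have p1 := growth_pos hx n a b
    have p2 := growth_pos hx n (a + 1) b
    have p3 := growth_pos hx n a (b + 1)
    exact mul_right_cancel₀ (by positivity) key

theorem expArray_softRSK (ht : t ≠ 0) (x : R.boxes → ℝ) {a b : ℕ} (ha : a < R.numRows)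
    (hb : b < R.numCols) : expArray t R (softRSK t R x) a b =
      rskArray R.numRows R.numCols (expArray t R x) a b := by
  have := R.numRows_pos
  have := R.numCols_pos
  have e := expArray_rowmotion_ideals ht x (min R.numRows R.numCols - 1) a b ha hb
  rw [show min (min R.numRows R.numCols - 1) (min (R.numRows - 1 - a) (R.numCols - 1 - b)) =
    min (R.numRows - 1 - a) (R.numCols - 1 - b) by omega] at e
  rw [rskArray, ← e]
  unfold softRSK
  rw [Equiv.Perm.mul_apply]
  congr 4
  funext k
  congr 3
  · omega
  · omega

/-- The effect of promotion in the files to the left of the top element. -/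
structure Promotes (r s : ℕ) (w v : ℕ → ℕ → ℝ) : Prop where
  left : ∀ a b, a < r → b < s → b + r < s + a →
    v a b * w a b * ((if a + 1 < r then 1 / v (a + 1) b else 0) + 1 / w a (b + 1)) =
      belowMix w v a b
  right : ∀ a b, a < r → b < s → s + a ≤ b + r → v a b = w a b

/-- Files are toggled from the left inwards. When a box is toggled, `(a + 1, b)` and `(a, b - 1)` in
the file to its left are new, while `(a - 1, b)` and `(a, b + 1)` in the file to its right are old.
-/
theorem promotes_softProP (ht : t ≠ 0) (w : R.boxes → ℝ) :
    Promotes R.numRows R.numCols (expArray t R w) (expArray t R (softProP t R w)) := by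
  have hr := R.numRows_eq
  have hs := R.numCols_eq
  have pr := R.numRows_pos
  have ps := R.numCols_pos
  -- The outermost `n` files have been toggled, and `c` files next to the file of the top element
  -- remain.
  have main : ∀ n c : ℕ, n + c + 1 = R.numCols → ∀ v, v = expArray t R (((List.range n).map
      (fun k : ℕ => softRowmotion t (R.file (R.i₁ - R.j₁ + 1 + (c + k : ℕ))))).prod w) →
      (∀ a b, a < R.numRows → b < R.numCols → b + R.numRows + c < R.numCols + a →
        v a b * expArray t R w a b * ((if a + 1 < R.numRows then 1 / v (a + 1) b else 0) +
          1 / expArray t R w a (b + 1)) = belowMix (expArray t R w) v a b) ∧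
      (∀ a b, a < R.numRows → b < R.numCols → R.numCols + a ≤ b + R.numRows + c →
        v a b = expArray t R w a b) := by
    intro n
    induction n with
    | zero =>
      intro c hc v hv
      refine ⟨fun a b ha hb h => by omega, fun a b ha hb h => by simp [hv]⟩
    | succ n ih =>
      intro c hc v hv
      obtain ⟨h1, h2⟩ := ih (c + 1) (by omega) _ rfl
      set u := ((List.range n).map
        (fun k : ℕ => softRowmotion t (R.file (R.i₁ - R.j₁ + 1 + (c + 1 + k : ℕ))))).prod w
      have e : v = expArray t R (softRowmotion t (R.file (R.i₁ - R.j₁ + 1 + c)) u) := by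
        rw [hv, List.range_succ_eq_map, List.map_cons, List.prod_cons, List.map_map,
          Equiv.Perm.mul_apply]
        simp only [Function.comp_def, Nat.succ_eq_add_one, add_comm _ 1, ← add_assoc,
          add_zero, u]
      have hne : ∀ a b, a < R.numRows → b < R.numCols →
          R.numCols + a ≠ b + R.numRows + (c + 1) → v a b = expArray t R u a b :=
        fun a b ha hb h => by
          rw [e]
          exact expArray_file_of_ne _ _ ha hb (by omega)
      refine ⟨fun a b ha hb h => ?_, fun a b ha hb h => by
        rw [hne a b ha hb (by omega), h2 a b ha hb (by omega)]⟩
      by_cases hc' : R.numCols + a = b + R.numRows + (c + 1)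
      · have key := expArray_file_of_mem ht (R.i₁ - R.j₁ + 1 + c) u ha hb (by omega)
        rw [← e, h2 a b ha hb (by omega), belowMix_congr (p' := expArray t R w) (q' := v)
          (fun i hi => h2 i b (by omega) hb (by omega))
          (fun j hj => (hne a j ha (by omega) (by omega)).symm), above,
          if_pos (show b + 1 < R.numCols by omega),
          if_pos (show a + 1 < R.numRows ∨ b + 1 < R.numCols by omega), add_zero,
          h2 a (b + 1) ha (by omega) (by omega)] at key
        rw [← key]
        by_cases ha' : a + 1 < R.numRows
        · rw [if_pos ha', if_pos ha', hne _ _ ha' hb (by omega)]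
        · rw [if_neg ha', if_neg ha']
      · rw [hne a b ha hb hc', belowMix_congr (p' := expArray t R w) (q' := expArray t R u)
          (fun _ _ => rfl) (fun j hj => hne a j ha (by omega) (by omega)),
          ← h1 a b ha hb (by omega)]
        by_cases ha' : a + 1 < R.numRows
        · rw [if_pos ha', if_pos ha', hne _ _ ha' hb (by omega)]
        · rw [if_neg ha', if_neg ha']
  obtain ⟨h1, h2⟩ := main (R.numCols - 1) 0 (by omega) _ rfl
  simp only [zero_add] at h1 h2
  exact ⟨fun a b ha hb h => h1 a b ha hb (by omega), fun a b ha hb h => h2 a b ha hb (by omega)⟩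

/-- The mirror image, phrased for the transposed array so that `ChainShift.of_promotes` serves both
promotions. -/
theorem promotes_softProQ (ht : t ≠ 0) (w : R.boxes → ℝ) :
    Promotes R.numCols R.numRows (flip (expArray t R w))
      (flip (expArray t R (softProQ t R w))) := by
  have hr := R.numRows_eq
  have hs := R.numCols_eq
  have pr := R.numRows_pos
  have ps := R.numCols_pos
  have main : ∀ n c : ℕ, n + c + 1 = R.numRows → ∀ v, v = expArray t R (((List.range n).map
      (fun k : ℕ => softRowmotion t (R.file (R.i₁ - R.j₁ - 1 - (c + k : ℕ))))).prod w) →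
      (∀ a b, a < R.numRows → b < R.numCols → a + R.numCols + c < R.numRows + b →
        v a b * expArray t R w a b * ((if b + 1 < R.numCols then 1 / v a (b + 1) else 0) +
          1 / expArray t R w (a + 1) b) = belowMix v (expArray t R w) a b) ∧
      (∀ a b, a < R.numRows → b < R.numCols → R.numRows + b ≤ a + R.numCols + c →
        v a b = expArray t R w a b) := by
    intro n
    induction n with
    | zero =>
      intro c hc v hv
      refine ⟨fun a b ha hb h => by omega, fun a b ha hb h => by simp [hv]⟩
    | succ n ih =>
      intro c hc v hv
      obtain ⟨h1, h2⟩ := ih (c + 1) (by omega) _ rfl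
      set u := ((List.range n).map
        (fun k : ℕ => softRowmotion t (R.file (R.i₁ - R.j₁ - 1 - (c + 1 + k : ℕ))))).prod w
      have e : v = expArray t R (softRowmotion t (R.file (R.i₁ - R.j₁ - 1 - c)) u) := by
        rw [hv, List.range_succ_eq_map, List.map_cons, List.prod_cons, List.map_map,
          Equiv.Perm.mul_apply]
        simp only [Function.comp_def, Nat.succ_eq_add_one, add_comm _ 1, ← add_assoc,
          add_zero, u]
      have hne : ∀ a b, a < R.numRows → b < R.numCols →
          R.numRows + b ≠ a + R.numCols + (c + 1) → v a b = expArray t R u a b :=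
        fun a b ha hb h => by
          rw [e]
          exact expArray_file_of_ne _ _ ha hb (by omega)
      refine ⟨fun a b ha hb h => ?_, fun a b ha hb h => by
        rw [hne a b ha hb (by omega), h2 a b ha hb (by omega)]⟩
      by_cases hc' : R.numRows + b = a + R.numCols + (c + 1)
      · have key := expArray_file_of_mem ht (R.i₁ - R.j₁ - 1 - c) u ha hb (by omega)
        rw [← e, h2 a b ha hb (by omega), belowMix_congr (p' := v) (q' := expArray t R w)
          (fun i hi => (hne i b (by omega) hb (by omega)).symm)
          (fun j hj => h2 a j ha (by omega) (by omega)), above,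
          if_pos (show a + 1 < R.numRows by omega),
          if_pos (show a + 1 < R.numRows ∨ b + 1 < R.numCols by omega), add_zero,
          h2 (a + 1) b (by omega) hb (by omega)] at key
        rw [← key, add_comm (1 / expArray t R w (a + 1) b)]
        by_cases hb' : b + 1 < R.numCols
        · rw [if_pos hb', if_pos hb', hne _ _ ha hb' (by omega)]
        · rw [if_neg hb', if_neg hb']
      · rw [hne a b ha hb hc', belowMix_congr (q' := expArray t R w) (p' := expArray t R u)
          (fun i hi => hne i b (by omega) hb (by omega)) (fun _ _ => rfl),
          ← h1 a b ha hb (by omega)]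
        by_cases hb' : b + 1 < R.numCols
        · rw [if_pos hb', if_pos hb', hne _ _ ha hb' (by omega)]
        · rw [if_neg hb', if_neg hb']
  obtain ⟨h1, h2⟩ := main (R.numRows - 1) 0 (by omega) _ rfl
  simp only [zero_add] at h1 h2
  refine ⟨fun b a hb ha h => ?_, fun b a hb ha h => h2 a b ha hb (by omega)⟩
  rw [belowMix_flip]
  exact h1 a b ha hb (by omega)

/-- After RSK, the boxes to the left of the file of the top element carry shapes of initial column
intervals; that file and the boxes to its right carry shapes of initial row intervals. The recursion
on the left is `growth_rowTop_rule`, so column shapes change as under rowmotion on a strip, which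
translates column path sums. Row shapes stay, and with them the row path sums and the shape. -/
theorem ChainShift.of_promotes {r s : ℕ} (hr : 0 < r) (hs : 0 < s) (w : ℝ) {x x' : ℕ → ℕ → ℝ}
    (hx : ∀ a b, 0 < x a b) (hx' : ∀ a b, 0 < x' a b)
    (h : Promotes r s (rskArray r s x) (rskArray r s x')) : ChainShift .proP r s w x x' := by
  have left : SameColShapes r (s - 1) x' (rowTop r x) := by
    suffices ∀ b k a, a + k + 1 = r → k + b < s - 1 → growth k x' a b = growth k (rowTop r x) a b
      from fun k a b => this b k a
    refine pair_induction fun b k h1 h2 a ha hkb => ?_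
    have e := h.left a b (by omega) (by omega) (by omega)
    have e' := growth_rowTop_rule hx ha b
    have f : ∀ {y : ℕ → ℕ → ℝ} {i j l : ℕ}, i + l + 1 = r → l + j < s →
        rskArray r s y i j = growth l y i j := fun hi hj => by
      rw [rskArray]
      congr 1
      omega
    rw [f ha (by omega), f ha (by omega), f (l := k) ha (by omega),
      belowMix_congr (p' := growth (k + 1) x) (q' := growth k (rowTop r x))
        (fun i hi => f (by omega) (by omega))
        (fun j hj => by rw [f ha (by omega)]; exact h1 j hj a ha (by omega)), ← e',
      show (if a + 1 < r then 1 / rskArray r s x' (a + 1) b else 0) =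
        if k = 0 then 0 else 1 / growth (k - 1) (rowTop r x) (a + 1) b by
        by_cases hk : k = 0
        · rw [if_pos hk, if_neg (by omega)]
        · rw [if_neg hk, if_pos (by omega), f (l := k - 1) (by omega) (by omega),
            h2 (k - 1) (by omega) (a + 1) (by omega) (by omega)], mul_assoc, mul_assoc] at e
    have p1 := growth_pos hx k a b
    have p2 := growth_pos hx k a (b + 1)
    have p3 := growth_pos (rowTop_pos r hx) (k - 1) (a + 1) b
    exact mul_right_cancel₀ (by split_ifs <;> positivity) e
  have right : SameRows r s x' x := by
    rw [sameRows_iff hs hx' hx]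
    intro k a b hb hk
    have e := h.right a b (by omega) (by omega) (by omega)
    rwa [rskArray, rskArray, show min (r - 1 - a) (s - 1 - b) = k by omega] at e
  refine ⟨fun i m him _ => right i m (by simpa [ShiftKind.rowStep] using him),
    fun j n hjn _ => ?_, (right.sameShape hs hx' hx).symm⟩
  change j + n + 1 < s at hjn
  exact ((sameCols_iff hr hx' (rowTop_pos r hx)).2 left j n (by omega)).trans
    (pathSum_dropCols_rowTop hr hx j n)

theorem ChainShift.congr {k : ShiftKind} {r s : ℕ} {w : ℝ} {x x' y y' : ℕ → ℕ → ℝ}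
    (hr : 0 < r) (hs : 0 < s)
    (h : ChainShift k r s w x x') (hx : ∀ a b, a < r → b < s → x a b = y a b)
    (hx' : ∀ a b, a < r → b < s → x' a b = y' a b) : ChainShift k r s w y y' := by
  have g : ∀ {z z' : ℕ → ℕ → ℝ} (_ : ∀ a b, a < r → b < s → z a b = z' a b) {k a b : ℕ},
      a + k < r → b + k < s → growth k z a b = growth k z' a b := fun hz _ _ _ ha hb =>
    growth_congr fun i j hi hj => hz i j (by omega) (by omega)
  refine ⟨fun i m h1 h2 => ?_, fun j n h1 h2 => ?_, ?_⟩
  · rw [← pathSum_congr (x := dropRows i x') (y := dropRows i y') (fun a b ha hb => hx' _ _ (by omega) (by omega)),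
      h.rows i m h1 h2]
    exact pathSum_congr fun a b ha hb => hx _ _ (by omega) (by omega)
  · rw [← pathSum_congr (x := dropCols j x') (y := dropCols j y') (fun a b ha hb => hx' _ _ (by omega) (by omega)),
      h.cols j n h1 h2]
    exact pathSum_congr fun a b ha hb => hx _ _ (by omega) (by omega)
  · have h3 := h.shape
    have tr : SameShape r s x x' → SameShape r s y y' := fun h k a b ha hb => by
      rw [← g hx (by omega) (by omega), ← g hx' (by omega) (by omega)]
      exact h k a b ha hb
    cases k with
    | proP => exact tr h3
    | proQ => exact tr h3
    | row =>
      intro k a b ha hb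
      rw [← g hx (by omega) (by omega), ← g hx' (by omega) (by omega),
        ← belowMix_congr (p := growth k x') (q := growth k x')
          (fun i hi => g hx' (by omega) (by omega)) (fun j hj => g hx' (by omega) (by omega)),
        ← h3 k a b ha hb]
      congr 1
      split_ifs with hk
      · rfl
      · rw [← g hx' (by omega) (by omega), ← g hx' (by omega) (by omega)]

theorem ChainShift.of_rowMap {r s : ℕ} (hr : 0 < r) (hs : 0 < s) {w : ℝ} (hw : 0 < w)
    {x : ℕ → ℕ → ℝ} (hx : ∀ a b, 0 < x a b) : ChainShift .row r s w x (rowMap r s w x) :=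
  ⟨fun _ _ h _ => pathSum_dropRows_rowMap hs w hx h,
    fun _ _ h _ => pathSum_dropCols_rowMap hr w hx h,
    fun _ _ _ ha hb => growth_rowMap_rule hw hx ha hb⟩

theorem Promotes.congr {r s : ℕ} {w v w' v' : ℕ → ℕ → ℝ} (h : Promotes r s w v)
    (hw : ∀ a b, a < r → b < s → w a b = w' a b) (hv : ∀ a b, a < r → b < s → v a b = v' a b) :
    Promotes r s w' v' := by
  refine ⟨fun a b ha hb hab => ?_, fun a b ha hb hab => by
    rw [← hw a b ha hb, ← hv a b ha hb, h.right a b ha hb hab]⟩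
  rw [← hw a b ha hb, ← hv a b ha hb, ← hw a (b + 1) ha (by omega),
    ← belowMix_congr (p := w) (q := v) (fun i hi => hw i b (by omega) hb)
      (fun j hj => hv a j ha (by omega)), ← h.left a b ha hb hab]
  by_cases ha' : a + 1 < r
  · rw [if_pos ha', if_pos ha', hv _ _ ha' hb]
  · rw [if_neg ha', if_neg ha']

/-- The effect of the deformed maps on path sums and shapes. -/
theorem chainShift_softRectMap (ht : t ≠ 0) (k : ShiftKind) (R : Rectangle) (x : R.boxes → ℝ) :
    ChainShift k R.numRows R.numCols (Real.exp t) (expArray t R x)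
      (expArray t R (softRectMap t k R x)) := by
  have hr := R.numRows_pos
  have hs := R.numCols_pos
  cases k with
  | proP =>
    refine ChainShift.of_promotes hr hs _ (expArray_pos t R x) (expArray_pos t R _) ?_
    refine (promotes_softProP ht (softRSK t R x)).congr
      (fun a b ha hb => expArray_softRSK ht x ha hb) fun a b ha hb => ?_
    rw [← expArray_softRSK ht _ ha hb]
    simp [softRectMap]
  | proQ =>
    have := ChainShift.of_promotes hs hr (Real.exp t) (x := flip (expArray t R x))
      (x' := flip (expArray t R (softRectMap t .proQ R x)))
      (fun a b => expArray_pos t R x b a) (fun a b => expArray_pos t R _ b a) (by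
        refine (promotes_softProQ ht (softRSK t R x)).congr
          (fun b a hb ha => ?_) fun b a hb ha => ?_
        · rw [rskArray_flip]
          exact expArray_softRSK ht x ha hb
        · rw [rskArray_flip, ← expArray_softRSK ht _ ha hb]
          simp [softRectMap, flip])
    exact this.flip
  | row =>
    -- Between the transfer maps, inverse rowmotion is `rowMap` with top weight `exp t`: the toggle
    -- relation becomes its definition after division by the sum over the lower covers.
    refine (ChainShift.of_rowMap hr hs (Real.exp_pos t) (expArray_pos t R x)).congr hr hs
      (fun _ _ _ _ => rfl) fun a b ha hb => ?_
    set u := (softTransfer t)⁻¹ x with hu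
    set v := (softRowmotion t (Finset.univ : Finset R.boxes))⁻¹ u with hv
    have e1 := expArray_softTransfer ht v ha hb
    have e2 := expArray_softRowmotion_inv_of_mem ht Finset.univ u ha hb (Finset.mem_univ _)
    have e3 : ∀ a b, a < R.numRows → b < R.numCols → expArray t R u a b =
      pathSum (expArray t R x) a b := fun a b ha hb => expArray_softTransfer_inv ht x ha hb
    have e4 : above R.numRows R.numCols (Real.exp t) (expArray t R u) a b =
        above R.numRows R.numCols (Real.exp t) (pathSum (expArray t R x)) a b := by
      unfold above
      congr 2
      · split_ifs with h
        · rw [e3 _ _ h hb]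
        · rfl
      · split_ifs with h
        · rw [e3 _ _ ha h]
        · rfl
    rw [← hv, ← e1, e4, e3 a b ha hb] at e2
    have p1 := belowMix_pos (p := expArray t R v) (q := expArray t R v) (a := a) (b := b)
      (fun i _ => expArray_pos t R v i b) (fun j _ => expArray_pos t R v a j)
    have p2 := pathSum_pos (expArray_pos t R x) a b
    have p3 := above_pos (r := R.numRows) (s := R.numCols) (Real.exp_pos t)
      (pathSum_pos (expArray_pos t R x)) a b
    have e5 : softRectMap t .row R x = softTransfer t v := rfl
    rw [e5, rowMap, div_eq_iff (mul_pos p2 p3).ne', eq_comm]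
    refine mul_right_cancel₀ p1.ne' ?_
    rw [one_mul]
    linarith [e2]

end Bridge

/-! ### Combinatorics of moon polyominoes and shifts -/

section Polyomino

/-- A moon polyomino, as a relation between the two coordinates. -/
structure MoonRel (m : ℤ → ℤ → Prop) : Prop where
  rows : ∀ i j k l, m i j → m i l → j ≤ k → k ≤ l → m i k
  cols : ∀ j i k l, m i j → m l j → i ≤ k → k ≤ l → m k j
  nested : ∀ i i' j j', m i j → m i' j' → m i j' ∨ m i' j

/-- A maximal rectangle of a moon polyomino, characterized by the existence of an up-diagonal and a
down-diagonal that do not leave it. -/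
structure MaxRel (R : Rectangle) (m : ℤ → ℤ → Prop) : Prop where
  sub : ∀ i j, R.i₀ ≤ i → i ≤ R.i₁ → R.j₀ ≤ j → j ≤ R.j₁ → m i j
  row : ∃ i, R.i₀ ≤ i ∧ i ≤ R.i₁ ∧ ∀ j, m i j → R.j₀ ≤ j ∧ j ≤ R.j₁
  col : ∃ j, R.j₀ ≤ j ∧ j ≤ R.j₁ ∧ ∀ i, m i j → R.i₀ ≤ i ∧ i ≤ R.i₁

/-- The rectangle with the coordinates exchanged. -/
def Rectangle.swap (R : Rectangle) : Rectangle := ⟨R.j₀, R.j₁, R.i₀, R.i₁, R.hj, R.hi⟩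

/-- The polyomino after moving the down-diagonals by `p` steps and the up-diagonals by `q` steps. -/
def shiftedRel (q p : ℤ) (R : Rectangle) (m : ℤ → ℤ → Prop) (i j : ℤ) : Prop :=
  ((R.i₀ ≤ i ∧ i ≤ R.i₁) ∧ R.j₀ ≤ j ∧ j ≤ R.j₁) ∨
  (¬(R.i₀ ≤ i ∧ i ≤ R.i₁) ∧ m i (j + p)) ∨ (¬(R.j₀ ≤ j ∧ j ≤ R.j₁) ∧ m (i + q) j)

/-- The boxes outside a rectangle can be moved without leaving its up- and down-diagonals. -/
structure AdmitsRel (q p : ℤ) (R : Rectangle) (m : ℤ → ℤ → Prop) : Prop where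
  rows : ∀ i j, m i j → ¬(R.i₀ ≤ i ∧ i ≤ R.i₁) → R.j₀ + p ≤ j ∧ j ≤ R.j₁
  cols : ∀ i j, m i j → ¬(R.j₀ ≤ j ∧ j ≤ R.j₁) → R.i₀ + q ≤ i ∧ i ≤ R.i₁

variable {m : ℤ → ℤ → Prop} {R R₁ R₂ : Rectangle} {q p q₁ p₁ q₂ p₂ : ℤ}

theorem MoonRel.flip (h : MoonRel m) : MoonRel (flip m) :=
  ⟨h.cols, h.rows, fun i i' j j' h1 h2 => (h.nested j j' i i' h1 h2).symm⟩

theorem MaxRel.flip (h : MaxRel R m) : MaxRel R.swap (flip m) :=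
  ⟨fun i j h1 h2 h3 h4 => h.sub j i h3 h4 h1 h2, h.col, h.row⟩

theorem AdmitsRel.flip (h : AdmitsRel q p R m) : AdmitsRel p q R.swap (flip m) :=
  ⟨fun i j => h.cols j i, fun i j => h.rows j i⟩

theorem shiftedRel_flip : shiftedRel p q R.swap (flip m) = flip (shiftedRel q p R m) := by
  funext i j
  simp only [shiftedRel, flip, Rectangle.swap, eq_iff_iff]
  tauto

/-- Apply nestedness to the given box and the crossing of an up-diagonal and a down-diagonal that do
not leave the rectangle. -/
theorem MaxRel.outside (hm : MoonRel m) (h : MaxRel R m) {i j : ℤ} (hij : m i j) :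
    (R.i₀ ≤ i ∧ i ≤ R.i₁) ∨ (R.j₀ ≤ j ∧ j ≤ R.j₁) := by
  by_contra hcon
  rw [not_or] at hcon
  obtain ⟨i', h1, h2, h3⟩ := h.row
  obtain ⟨j', g1, g2, g3⟩ := h.col
  rcases hm.nested i i' j j' hij (h.sub i' j' h1 h2 g1 g2) with h4 | h4
  · exact hcon.1 (g3 i h4)
  · exact hcon.2 (h3 j h4)

/-- Two maximal rectangles cross each other. -/
theorem MaxRel.crossing (hm : MoonRel m) (h₁ : MaxRel R₁ m) (h₂ : MaxRel R₂ m) (hne : R₁ ≠ R₂) :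
    (R₁.i₀ ≤ R₂.i₀ ∧ R₂.i₁ ≤ R₁.i₁ ∧ R₂.j₀ ≤ R₁.j₀ ∧ R₁.j₁ ≤ R₂.j₁ ∧
      ¬(R₂.i₀ ≤ R₁.i₀ ∧ R₁.i₁ ≤ R₂.i₁) ∧ ¬(R₁.j₀ ≤ R₂.j₀ ∧ R₂.j₁ ≤ R₁.j₁)) ∨
    (R₂.i₀ ≤ R₁.i₀ ∧ R₁.i₁ ≤ R₂.i₁ ∧ R₁.j₀ ≤ R₂.j₀ ∧ R₂.j₁ ≤ R₁.j₁ ∧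
      ¬(R₁.i₀ ≤ R₂.i₀ ∧ R₂.i₁ ≤ R₁.i₁) ∧ ¬(R₂.j₀ ≤ R₁.j₀ ∧ R₁.j₁ ≤ R₂.j₁)) := by
  obtain ⟨i₁, a1, a2, a3⟩ := h₁.row
  obtain ⟨i₂, b1, b2, b3⟩ := h₂.row
  obtain ⟨j₁, c1, c2, c3⟩ := h₁.col
  obtain ⟨j₂, d1, d2, d3⟩ := h₂.col
  have e1 := R₁.hi
  have e2 := R₁.hj
  have e3 := R₂.hi
  have e4 := R₂.hj
  have hne' : ¬(R₁.i₀ = R₂.i₀ ∧ R₁.i₁ = R₂.i₁ ∧ R₁.j₀ = R₂.j₀ ∧ R₁.j₁ = R₂.j₁) :=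
    fun h => hne (Rectangle.ext h.1 h.2.1 h.2.2.1 h.2.2.2)
  have key : ∀ {S T : Rectangle} (_ : MaxRel S m) (_ : MaxRel T m), S.j₀ ≤ T.j₀ → T.j₁ ≤ S.j₁ →
      T.i₀ ≤ S.i₀ ∧ S.i₁ ≤ T.i₁ := by
    intro S T hS hT h1 h2
    obtain ⟨j, f1, f2, f3⟩ := hT.col
    have := S.hi
    have g1 := f3 S.i₀ (hS.sub _ _ le_rfl S.hi (by omega) (by omega))
    have g2 := f3 S.i₁ (hS.sub _ _ S.hi le_rfl (by omega) (by omega))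
    exact ⟨g1.1, g2.2⟩
  have key' : ∀ {S T : Rectangle} (_ : MaxRel S m) (_ : MaxRel T m), S.i₀ ≤ T.i₀ → T.i₁ ≤ S.i₁ →
      T.j₀ ≤ S.j₀ ∧ S.j₁ ≤ T.j₁ := by
    intro S T hS hT h1 h2
    obtain ⟨i, f1, f2, f3⟩ := hT.row
    have := S.hj
    have g1 := f3 S.j₀ (hS.sub _ _ (by omega) (by omega) le_rfl S.hj)
    have g2 := f3 S.j₁ (hS.sub _ _ (by omega) (by omega) S.hj le_rfl)
    exact ⟨g1.1, g2.2⟩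
  -- Otherwise the up-diagonals that do not leave the two rectangles would be incomparable.
  have nest : (R₂.j₀ ≤ R₁.j₀ ∧ R₁.j₁ ≤ R₂.j₁) ∨ (R₁.j₀ ≤ R₂.j₀ ∧ R₂.j₁ ≤ R₁.j₁) := by
    by_contra hcon
    obtain ⟨l, hl⟩ : ∃ l, (R₁.j₀ ≤ l ∧ l ≤ R₁.j₁) ∧ ¬(R₂.j₀ ≤ l ∧ l ≤ R₂.j₁) := by
      by_cases h : R₂.j₀ ≤ R₁.j₀
      · exact ⟨R₁.j₁, by omega⟩
      · exact ⟨R₁.j₀, by omega⟩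
    obtain ⟨l', hl'⟩ : ∃ l, (R₂.j₀ ≤ l ∧ l ≤ R₂.j₁) ∧ ¬(R₁.j₀ ≤ l ∧ l ≤ R₁.j₁) := by
      by_cases h : R₁.j₀ ≤ R₂.j₀
      · exact ⟨R₂.j₁, by omega⟩
      · exact ⟨R₂.j₀, by omega⟩
    rcases hm.nested i₁ i₂ l l' (h₁.sub _ _ a1 a2 hl.1.1 hl.1.2)
      (h₂.sub _ _ b1 b2 hl'.1.1 hl'.1.2) with h | h
    · exact hl'.2 (a3 _ h)
    · exact hl.2 (b3 _ h)
  rcases nest with h | h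
  · left
    have f1 := key h₂ h₁ h.1 h.2
    refine ⟨f1.1, f1.2, h.1, h.2, fun h' => ?_, fun h' => ?_⟩
    · have := key' h₂ h₁ h'.1 h'.2
      omega
    · have := key h₁ h₂ h'.1 h'.2
      omega
  · right
    have f1 := key h₁ h₂ h.1 h.2
    refine ⟨f1.1, f1.2, h.1, h.2, fun h' => ?_, fun h' => ?_⟩
    · have := key' h₁ h₂ h'.1 h'.2
      omega
    · have := key h₂ h₁ h'.1 h'.2
      omega

/-- If the shifted polyomino is a moon polyomino, then no box leaves the up- and down-diagonals of the
rectangle. -/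
theorem AdmitsRel.of_moonRel (hm : MoonRel m) (h : MaxRel R m) (hq : q = 0 ∨ q = 1)
    (hp : p = 0 ∨ p = 1) (hn : MoonRel (shiftedRel q p R m)) : AdmitsRel q p R m := by
  suffices ∀ {m : ℤ → ℤ → Prop} {R : Rectangle} {q p : ℤ}, MoonRel m → MaxRel R m →
      (q = 0 ∨ q = 1) → (p = 0 ∨ p = 1) → MoonRel (shiftedRel q p R m) → ∀ i j, m i j →
      ¬(R.i₀ ≤ i ∧ i ≤ R.i₁) → R.j₀ + p ≤ j ∧ j ≤ R.j₁ by
    refine ⟨this hm h hq hp hn, fun i j hij => ?_⟩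
    exact this hm.flip h.flip hp hq (by rw [shiftedRel_flip]; exact hn.flip) j i hij
  clear h hm hq hp hn
  intro m R q p hm h hq hp hn i j hij hi
  have h0 := (h.outside hm hij).resolve_left hi
  have e1 := R.hi
  have e2 := R.hj
  refine ⟨?_, h0.2⟩
  by_contra hcon
  obtain ⟨rfl, rfl⟩ : p = 1 ∧ j = R.j₀ := by omega
  have hn1 : shiftedRel q 1 R m i (R.j₀ - 1) := Or.inr (Or.inl ⟨hi, by rwa [sub_add_cancel]⟩)
  obtain ⟨j₁, hj1, hj2, hj3⟩ := h.col
  obtain ⟨i₁, hi1, hi2, hi3⟩ := h.row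
  -- The moved box is compared with an up-diagonal that does not leave `R` after the shift. For `q =
  -- 1` this is the last one of `R`, since boxes entering it come from the up-diagonal beyond `R`;
  -- for `q = 0` it is the one given by `h.row`.
  by_cases hq1 : q = 1
  · subst hq1
    rcases hn.nested i R.i₁ (R.j₀ - 1) R.j₁ hn1 (Or.inl (by omega)) with h1 | h1
    · rcases h1 with h1 | h1 | h1
      · exact hi h1.1
      · have := (h.outside hm h1.2).resolve_left hi
        omega
      · omega
    · rcases h1 with h1 | h1 | h1
      · omega
      · omega
      · have := (h.outside hm h1.2).resolve_right h1.1
        omega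
  · obtain rfl : q = 0 := by omega
    rcases hn.nested i i₁ (R.j₀ - 1) R.j₁ hn1 (Or.inl (by omega)) with h1 | h1
    · rcases h1 with h1 | h1 | h1
      · exact hi h1.1
      · have := (h.outside hm h1.2).resolve_left hi
        omega
      · omega
    · rcases h1 with h1 | h1 | h1
      · omega
      · omega
      · have := hi3 _ (by simpa using h1.2)
        omega

/-- Admissible shifts lead to moon polyominoes. -/
theorem MoonRel.shiftedRel (hm : MoonRel m) (h : MaxRel R m) (hq : q = 0 ∨ q = 1)
    (hp : p = 0 ∨ p = 1) (ha : AdmitsRel q p R m) : MoonRel (shiftedRel q p R m) := by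
  have half : ∀ {m : ℤ → ℤ → Prop} {R : Rectangle} {q p : ℤ}, MoonRel m → MaxRel R m →
      (q = 0 ∨ q = 1) → (p = 0 ∨ p = 1) → AdmitsRel q p R m →
      ∀ i j k l, _root_.shiftedRel q p R m i j → _root_.shiftedRel q p R m i l → j ≤ k → k ≤ l →
        _root_.shiftedRel q p R m i k := by
    intro m R q p hm h hq hp ha i j k l h1 h2 hjk hkl
    by_cases hi : R.i₀ ≤ i ∧ i ≤ R.i₁
    · by_cases hk : R.j₀ ≤ k ∧ k ≤ R.j₁
      · exact Or.inl ⟨hi, hk⟩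
      · refine Or.inr (Or.inr ⟨hk, ?_⟩)
        rcases lt_or_ge k R.j₀ with hk' | hk'
        · have h3 : m (i + q) j := by
            rcases h1 with h1 | h1 | h1
            · omega
            · exact absurd hi h1.1
            · exact h1.2
          have h4 := ha.cols _ _ h3 (by omega)
          exact hm.rows _ _ _ _ h3 (h.sub (i + q) R.j₀ (by omega) (by omega) le_rfl R.hj) hjk
            (by omega)
        · have h3 : m (i + q) l := by
            rcases h2 with h1 | h1 | h1
            · omega
            · exact absurd hi h1.1
            · exact h1.2
          have h4 := ha.cols _ _ h3 (by omega)
          exact hm.rows _ _ _ _ (h.sub (i + q) R.j₁ (by omega) (by omega) R.hj le_rfl) h3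
            (by omega) hkl
    · have key : ∀ {j}, _root_.shiftedRel q p R m i j → m i (j + p) := by
        intro j hj
        rcases hj with h1 | h1 | h1
        · exact absurd h1.1 hi
        · exact h1.2
        · have := ha.cols _ _ h1.2 h1.1
          omega
      exact Or.inr (Or.inl ⟨hi, hm.rows _ _ _ _ (key h1) (key h2) (by omega) (by omega)⟩)
  refine ⟨half hm h hq hp ha, fun j i k l h1 h2 => ?_, fun i i' j j' h1 h2 => ?_⟩
  · have := half hm.flip h.flip hp hq ha.flip j i k l
    rw [shiftedRel_flip] at this
    exact this h1 h2
  · have key : ∀ {i j}, _root_.shiftedRel q p R m i j → ¬(R.i₀ ≤ i ∧ i ≤ R.i₁) → m i (j + p) := by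
      intro i j hj hi
      rcases hj with h1 | h1 | h1
      · exact absurd h1.1 hi
      · exact h1.2
      · have := ha.cols _ _ h1.2 h1.1
        omega
    have key' : ∀ {i j}, _root_.shiftedRel q p R m i j → ¬(R.i₀ ≤ i ∧ i ≤ R.i₁) →
        R.j₀ ≤ j ∧ j ≤ R.j₁ := by
      intro i j hj hi
      have := ha.rows _ _ (key hj hi) hi
      omega
    by_cases hi : R.i₀ ≤ i ∧ i ≤ R.i₁
    · by_cases hi' : R.i₀ ≤ i' ∧ i' ≤ R.i₁
      · by_cases hj : R.j₀ ≤ j ∧ j ≤ R.j₁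
        · exact Or.inr (Or.inl ⟨hi', hj⟩)
        by_cases hj' : R.j₀ ≤ j' ∧ j' ≤ R.j₁
        · exact Or.inl (Or.inl ⟨hi, hj'⟩)
        have f1 : m (i + q) j := by
          rcases h1 with h1 | h1 | h1
          · exact absurd h1.2 hj
          · exact absurd hi h1.1
          · exact h1.2
        have f2 : m (i' + q) j' := by
          rcases h2 with h1 | h1 | h1
          · exact absurd h1.2 hj'
          · exact absurd hi' h1.1
          · exact h1.2
        rcases hm.nested _ _ _ _ f1 f2 with h3 | h3
        · exact Or.inl (Or.inr (Or.inr ⟨hj', h3⟩))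
        · exact Or.inr (Or.inr (Or.inr ⟨hj, h3⟩))
      · exact Or.inl (Or.inl ⟨hi, key' h2 hi'⟩)
    · by_cases hi' : R.i₀ ≤ i' ∧ i' ≤ R.i₁
      · exact Or.inr (Or.inl ⟨hi', key' h1 hi⟩)
      · rcases hm.nested _ _ _ _ (key h1 hi) (key h2 hi') with h3 | h3
        · exact Or.inl (Or.inr (Or.inl ⟨hi, h3⟩))
        · exact Or.inr (Or.inr (Or.inl ⟨hi', h3⟩))

/-- The rectangle `R₁` has more up-diagonals and fewer down-diagonals than `R₂`. -/
structure Crosses (R₁ R₂ : Rectangle) : Prop where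
  i₀_le : R₁.i₀ ≤ R₂.i₀
  le_i₁ : R₂.i₁ ≤ R₁.i₁
  j₀_le : R₂.j₀ ≤ R₁.j₀
  le_j₁ : R₁.j₁ ≤ R₂.j₁
  rows_ne : ¬(R₂.i₀ ≤ R₁.i₀ ∧ R₁.i₁ ≤ R₂.i₁)
  cols_ne : ¬(R₁.j₀ ≤ R₂.j₀ ∧ R₂.j₁ ≤ R₁.j₁)

theorem Crosses.swap (h : Crosses R₁ R₂) : Crosses R₂.swap R₁.swap :=
  ⟨h.j₀_le, h.le_j₁, h.i₀_le, h.le_i₁, h.cols_ne, h.rows_ne⟩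

/-- Some down-diagonal of the wide rectangle misses the tall one; its boxes move by `q` and have to
stay within the rows of the tall rectangle. -/
theorem Crosses.add_le (h : Crosses R₁ R₂) (h₂ : MaxRel R₂ m) (ha : AdmitsRel q p R₁ m) :
    R₁.i₀ + q ≤ R₂.i₀ := by
  have e1 := R₁.hj
  have e2 := R₂.hj
  have h1 := h.cols_ne
  obtain ⟨l, hl⟩ : ∃ l, (R₂.j₀ ≤ l ∧ l ≤ R₂.j₁) ∧ ¬(R₁.j₀ ≤ l ∧ l ≤ R₁.j₁) := by
    by_cases h : R₁.j₀ ≤ R₂.j₀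
    · exact ⟨R₂.j₁, by omega⟩
    · exact ⟨R₂.j₀, by omega⟩
  exact (ha.cols R₂.i₀ l (h₂.sub _ _ le_rfl R₂.hi hl.1.1 hl.1.2) hl.2).1

/-- The translate of the wider rectangle is maximal after a shift with respect to the taller one. -/
theorem Crosses.maxRel (h : Crosses R₁ R₂) (h₁ : MaxRel R₁ m) (h₂ : MaxRel R₂ m)
    (hq : q₁ = 0 ∨ q₁ = 1) (hp : p₁ = 0 ∨ p₁ = 1) (ha : AdmitsRel q₁ p₁ R₁ m) :
    MaxRel (R₂.lower q₁ 0) (shiftedRel q₁ p₁ R₁ m) := by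
  have e := h.add_le h₂ ha
  have e1 := h.le_i₁
  have e2 := h.j₀_le
  have e3 := h.le_j₁
  have e4 := h.rows_ne
  have e5 := R₂.hi
  have e6 := R₁.hi
  refine ⟨fun i j h1 h2 h3 h4 => ?_, ?_, ?_⟩
  · simp only [Rectangle.lower] at h1 h2 h3 h4
    by_cases hj : R₁.j₀ ≤ j ∧ j ≤ R₁.j₁
    · exact Or.inl ⟨by omega, hj⟩
    · exact Or.inr (Or.inr ⟨hj, h₂.sub _ _ (by omega) (by omega) (by omega) (by omega)⟩)
  · obtain ⟨i, h1, h2, h3⟩ := h₂.row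
    refine ⟨i - q₁, by simp only [Rectangle.lower]; omega, by simp only [Rectangle.lower]; omega,
      fun j hj => ?_⟩
    simp only [Rectangle.lower]
    rcases hj with hj | hj | hj
    · omega
    · omega
    · have := h3 j (by simpa using hj.2)
      omega
  · obtain ⟨j, h1, h2, h3⟩ := h₂.col
    refine ⟨j, by simp only [Rectangle.lower]; omega, by simp only [Rectangle.lower]; omega,
      fun i hi => ?_⟩
    have hj : ¬(R₁.j₀ ≤ j ∧ j ≤ R₁.j₁) := fun hj => by
      have f1 := h3 _ (h₁.sub R₁.i₀ j le_rfl R₁.hi hj.1 hj.2)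
      have f2 := h3 _ (h₁.sub R₁.i₁ j R₁.hi le_rfl hj.1 hj.2)
      omega
    simp only [Rectangle.lower]
    rcases hi with hi | hi | hi
    · omega
    · have := ha.rows _ _ hi.2 hi.1
      omega
    · have := h3 _ hi.2
      omega

/-- Admissibility stands in for the condition that the target is a moon polyomino; unlike that
condition it can be carried over to the shifted polyomino box by box. -/
theorem Crosses.admitsRel (h : Crosses R₁ R₂) (h₁ : MaxRel R₁ m) (h₂ : MaxRel R₂ m)
    (hp : p₁ = 0 ∨ p₁ = 1) (ha : AdmitsRel q₁ p₁ R₁ m)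
    (ha₂ : AdmitsRel q₂ p₂ R₂ m) : AdmitsRel q₂ p₂ (R₂.lower q₁ 0) (shiftedRel q₁ p₁ R₁ m) := by
  have e := h.add_le h₂ ha
  have e' : R₂.j₀ + p₂ ≤ R₁.j₀ := h.swap.add_le h₁.flip ha₂.flip
  have e1 := h.le_i₁
  have e2 := h.j₀_le
  have e3 := h.le_j₁
  have e4 := R₁.hj
  refine ⟨fun i j hij hi => ?_, fun i j hij hj => ?_⟩
  · simp only [Rectangle.lower] at hi ⊢
    rcases hij with h1 | h1 | h1
    · omega
    · have := ha.rows _ _ h1.2 h1.1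
      omega
    · have := ha₂.rows _ _ h1.2 (by omega)
      omega
  · simp only [Rectangle.lower] at hj ⊢
    rcases hij with h1 | h1 | h1
    · omega
    · have := ha.rows _ _ h1.2 h1.1
      omega
    · have := ha₂.cols _ _ h1.2 (by omega)
      omega

/-- The polyomino after the shifts with respect to two crossing rectangles. -/
def doubleRel (q₁ p₁ q₂ p₂ : ℤ) (R₁ R₂ : Rectangle) (m : ℤ → ℤ → Prop) (i j : ℤ) : Prop :=
  ((R₂.i₀ ≤ i + q₁ ∧ i + q₁ ≤ R₂.i₁) ∧ R₂.j₀ ≤ j ∧ j ≤ R₂.j₁) ∨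
  ((R₁.j₀ ≤ j + p₂ ∧ j + p₂ ≤ R₁.j₁) ∧ R₁.i₀ ≤ i ∧ i ≤ R₁.i₁) ∨
  (¬(R₁.i₀ ≤ i ∧ i ≤ R₁.i₁) ∧ m i (j + (p₁ + p₂))) ∨
  (¬(R₂.j₀ ≤ j ∧ j ≤ R₂.j₁) ∧ m (i + (q₁ + q₂)) j) ∨
  (¬(R₂.i₀ ≤ i + q₁ ∧ i + q₁ ≤ R₂.i₁) ∧ ¬(R₁.j₀ ≤ j + p₂ ∧ j + p₂ ≤ R₁.j₁) ∧ m (i + q₁) (j + p₂))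

theorem doubleRel_flip : doubleRel p₂ q₂ p₁ q₁ R₂.swap R₁.swap (flip m) =
    flip (doubleRel q₁ p₁ q₂ p₂ R₁ R₂ m) := by
  funext i j
  rw [eq_iff_iff]
  constructor
  · rintro (⟨h1, h2⟩ | ⟨h1, h2⟩ | ⟨h1, h2⟩ | ⟨h1, h2⟩ | ⟨h1, h2, h3⟩)
    · exact Or.inr (Or.inl ⟨h1, h2⟩)
    · exact Or.inl ⟨h1, h2⟩
    · rw [add_comm q₂] at h2
      exact Or.inr (Or.inr (Or.inr (Or.inl ⟨h1, h2⟩)))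
    · rw [add_comm p₂] at h2
      exact Or.inr (Or.inr (Or.inl ⟨h1, h2⟩))
    · exact Or.inr (Or.inr (Or.inr (Or.inr ⟨h2, h1, h3⟩)))
  · rintro (⟨h1, h2⟩ | ⟨h1, h2⟩ | ⟨h1, h2⟩ | ⟨h1, h2⟩ | ⟨h1, h2, h3⟩)
    · exact Or.inr (Or.inl ⟨h1, h2⟩)
    · exact Or.inl ⟨h1, h2⟩
    · rw [add_comm p₁] at h2
      exact Or.inr (Or.inr (Or.inr (Or.inl ⟨h1, h2⟩)))
    · rw [add_comm q₁] at h2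
      exact Or.inr (Or.inr (Or.inl ⟨h1, h2⟩))
    · exact Or.inr (Or.inr (Or.inr (Or.inr ⟨h2, h1, h3⟩)))

/-- The closed form `doubleRel` is invariant under transposition combined with exchange of the
rectangles, so the other order of shifting leads to it as well. -/
theorem Crosses.shiftedRel (h : Crosses R₁ R₂) (h₁ : MaxRel R₁ m) (h₂ : MaxRel R₂ m)
    (hq : q₁ = 0 ∨ q₁ = 1) (hp : p₁ = 0 ∨ p₁ = 1) (hp' : p₂ = 0 ∨ p₂ = 1)
    (ha : AdmitsRel q₁ p₁ R₁ m)
    (ha₂ : AdmitsRel q₂ p₂ R₂ m) :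
    shiftedRel q₂ p₂ (R₂.lower q₁ 0) (shiftedRel q₁ p₁ R₁ m) =
      doubleRel q₁ p₁ q₂ p₂ R₁ R₂ m := by
  have e := h.add_le h₂ ha
  have e' : R₂.j₀ + p₂ ≤ R₁.j₀ := h.swap.add_le h₁.flip ha₂.flip
  have e1 := h.le_i₁
  have e2 := h.j₀_le
  have e3 := h.le_j₁
  funext i j
  rw [eq_iff_iff]
  constructor
  · rintro (h1 | ⟨h1, h2 | h2 | h2⟩ | ⟨h1, h2 | h2 | h2⟩)
    · simp only [Rectangle.lower] at h1
      exact Or.inl (by omega)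
    · exact Or.inr (Or.inl ⟨h2.2, h2.1⟩)
    · exact Or.inr (Or.inr (Or.inl ⟨h2.1, by rw [add_comm p₁, ← add_assoc]; exact h2.2⟩))
    · simp only [Rectangle.lower] at h1
      exact Or.inr (Or.inr (Or.inr (Or.inr ⟨by omega, h2⟩)))
    · simp only [Rectangle.lower] at h1
      omega
    · simp only [Rectangle.lower] at h1
      have := ha.rows _ _ h2.2 h2.1
      omega
    · simp only [Rectangle.lower, sub_zero] at h1
      exact Or.inr (Or.inr (Or.inr (Or.inl ⟨h1, by
        rw [add_comm q₁, ← add_assoc]; exact h2.2⟩)))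
  · rintro (h1 | h1 | h1 | h1 | h1)
    · exact Or.inl (by simp only [Rectangle.lower]; omega)
    · by_cases hi : (R₂.lower q₁ 0).i₀ ≤ i ∧ i ≤ (R₂.lower q₁ 0).i₁
      · exact Or.inl ⟨hi, by simp only [Rectangle.lower]; omega⟩
      · exact Or.inr (Or.inl ⟨hi, Or.inl ⟨h1.2, h1.1⟩⟩)
    · refine Or.inr (Or.inl ⟨by simp only [Rectangle.lower]; omega, Or.inr (Or.inl ⟨h1.1, ?_⟩)⟩)
      rw [add_assoc, add_comm p₂]
      exact h1.2
    · refine Or.inr (Or.inr ⟨by simp only [Rectangle.lower, sub_zero]; exact h1.1,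
        Or.inr (Or.inr ⟨by omega, ?_⟩)⟩)
      rw [add_assoc, add_comm q₂]
      exact h1.2
    · exact Or.inr (Or.inl ⟨by simp only [Rectangle.lower]; omega, Or.inr (Or.inr h1.2)⟩)

theorem Rectangle.lower_swap (R : Rectangle) (a b : ℤ) : (R.lower a b).swap = R.swap.lower b a := rfl

theorem Rectangle.swap_swap (R : Rectangle) : R.swap.swap = R := rfl

theorem Crosses.maxRel' (h : Crosses R₁ R₂) (h₁ : MaxRel R₁ m) (h₂ : MaxRel R₂ m)
    (hq : q₂ = 0 ∨ q₂ = 1) (hp : p₂ = 0 ∨ p₂ = 1) (ha : AdmitsRel q₂ p₂ R₂ m) :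
    MaxRel (R₁.lower 0 p₂) (_root_.shiftedRel q₂ p₂ R₂ m) := by
  have := (h.swap.maxRel h₂.flip h₁.flip hp hq ha.flip).flip
  rwa [shiftedRel_flip] at this

theorem Crosses.admitsRel' (h : Crosses R₁ R₂) (h₁ : MaxRel R₁ m) (h₂ : MaxRel R₂ m)
    (hq : q₂ = 0 ∨ q₂ = 1) (ha : AdmitsRel q₁ p₁ R₁ m)
    (ha₂ : AdmitsRel q₂ p₂ R₂ m) :
    AdmitsRel q₁ p₁ (R₁.lower 0 p₂) (_root_.shiftedRel q₂ p₂ R₂ m) := by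
  have := (h.swap.admitsRel h₂.flip h₁.flip hq ha₂.flip ha.flip).flip
  rwa [shiftedRel_flip] at this

theorem Crosses.shiftedRel' (h : Crosses R₁ R₂) (h₁ : MaxRel R₁ m) (h₂ : MaxRel R₂ m)
    (hq : q₂ = 0 ∨ q₂ = 1) (hp : p₂ = 0 ∨ p₂ = 1) (hp' : q₁ = 0 ∨ q₁ = 1)
    (ha : AdmitsRel q₁ p₁ R₁ m) (ha₂ : AdmitsRel q₂ p₂ R₂ m) :
    _root_.shiftedRel q₁ p₁ (R₁.lower 0 p₂) (_root_.shiftedRel q₂ p₂ R₂ m) =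
      doubleRel q₁ p₁ q₂ p₂ R₁ R₂ m := by
  have := h.swap.shiftedRel h₂.flip h₁.flip hp hq hp' ha₂.flip ha.flip
  rw [shiftedRel_flip, doubleRel_flip, ← Rectangle.lower_swap, shiftedRel_flip] at this
  exact congrArg flip this

/-! ### Translation between finite sets of boxes and relations -/

/-- The relation of a set of boxes. -/
def boxRel (M : Finset (ℤ × ℤ)) (i j : ℤ) : Prop := (i, j) ∈ M

theorem isMoon_iff {M : Finset (ℤ × ℤ)} : IsMoon M ↔ MoonRel (boxRel M) := by
  constructor
  · intro h
    refine ⟨fun i j k l h1 h2 h3 h4 => (h.up_convex i).out h1 h2 ⟨h3, h4⟩,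
      fun j i k l h1 h2 h3 h4 => (h.down_convex j).out h1 h2 ⟨h3, h4⟩, fun i i' j j' h1 h2 => ?_⟩
    rcases h.nested i i' with h | h
    · exact Or.inr (h h1)
    · exact Or.inl (h h2)
  · intro h
    refine ⟨fun i => ⟨fun j h1 l h2 k hk => h.rows i j k l h1 h2 hk.1 hk.2⟩,
      fun j => ⟨fun i h1 l h2 k hk => h.cols j i k l h1 h2 hk.1 hk.2⟩, fun i i' => ?_⟩
    by_contra hcon
    rw [not_or, Set.not_subset, Set.not_subset] at hcon
    obtain ⟨⟨j, h1, h2⟩, j', h3, h4⟩ := hcon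
    rcases h.nested i i' j j' h1 h3 with h | h
    · exact h4 h
    · exact h2 h

/-- Some up-diagonal of a maximal rectangle does not leave it. -/
theorem exists_row_of_maximal (hm : MoonRel m) (hfin : {p : ℤ × ℤ | m p.1 p.2}.Finite)
    (hsub : ∀ i j, R.i₀ ≤ i → i ≤ R.i₁ → R.j₀ ≤ j → j ≤ R.j₁ → m i j)
    (hmax : ∀ S : Rectangle, S.i₀ = R.i₀ → S.i₁ = R.i₁ → S.j₀ ≤ R.j₀ → R.j₁ ≤ S.j₁ →
      (∀ i j, S.i₀ ≤ i → i ≤ S.i₁ → S.j₀ ≤ j → j ≤ S.j₁ → m i j) → S = R) :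
    ∃ i, R.i₀ ≤ i ∧ i ≤ R.i₁ ∧ ∀ j, m i j → R.j₀ ≤ j ∧ j ≤ R.j₁ := by
  classical
  have e1 := R.hi
  have e2 := R.hj
  have frow : ∀ i, {j | m i j}.Finite := fun i =>
    Set.Finite.subset (hfin.image Prod.snd) fun j hj => ⟨(i, j), hj, rfl⟩
  -- By nestedness, an up-diagonal with the fewest boxes is contained in all others that meet `R`.
  -- If it left `R`, then `R` could be widened inside the polyomino.
  obtain ⟨i, hi, hmin⟩ := Finset.exists_min_image (Finset.Icc R.i₀ R.i₁)
    (fun i => {j | m i j}.ncard) ⟨R.i₀, Finset.mem_Icc.2 ⟨le_rfl, R.hi⟩⟩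
  rw [Finset.mem_Icc] at hi
  have hall : ∀ i', R.i₀ ≤ i' → i' ≤ R.i₁ → ∀ j, m i j → m i' j := by
    intro i' h1 h2 j hj
    by_contra hcon
    have hss : {j | m i' j} ⊂ {j | m i j} := by
      refine ⟨fun j' hj' => ?_, fun h => hcon (h hj)⟩
      exact (hm.nested i i' j j' hj hj').resolve_right hcon
    exact absurd (hmin i' (Finset.mem_Icc.2 ⟨h1, h2⟩))
      (not_le.2 (Set.ncard_lt_ncard hss (frow i)))
  refine ⟨i, hi.1, hi.2, fun j hj => ?_⟩
  by_contra hcon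
  have hj' : ∀ i', R.i₀ ≤ i' → i' ≤ R.i₁ → m i' j := fun i' h1 h2 => hall i' h1 h2 j hj
  have := hmax ⟨R.i₀, R.i₁, min R.j₀ j, max R.j₁ j, R.hi, by omega⟩ rfl rfl (by dsimp only; omega)
    (by dsimp only; omega) (by
      intro i' k h1 h2 h3 h4
      dsimp only at h1 h2 h3 h4
      rcases lt_or_ge k R.j₀ with hk | hk
      · exact hm.rows _ _ _ _ (hj' i' h1 h2) (hsub i' R.j₀ h1 h2 le_rfl R.hj) (by omega) hk.le
      rcases lt_or_ge R.j₁ k with hk' | hk'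
      · exact hm.rows _ _ _ _ (hsub i' R.j₁ h1 h2 R.hj le_rfl) (hj' i' h1 h2) hk'.le (by omega)
      · exact hsub i' k h1 h2 hk hk')
  have f1 := congrArg Rectangle.j₀ this
  have f2 := congrArg Rectangle.j₁ this
  dsimp only at f1 f2
  omega

theorem boxes_subset_iff {M : Finset (ℤ × ℤ)} : R.boxes ⊆ M ↔
    ∀ i j, R.i₀ ≤ i → i ≤ R.i₁ → R.j₀ ≤ j → j ≤ R.j₁ → boxRel M i j :=
  ⟨fun h i j h1 h2 h3 h4 => h (Rectangle.mem_boxes.2 ⟨⟨h1, h2⟩, h3, h4⟩), fun h p hp => by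
    have := Rectangle.mem_boxes.1 hp
    exact h p.1 p.2 this.1.1 this.1.2 this.2.1 this.2.2⟩

/-- Conversely, a larger rectangle in the polyomino contains boxes of the up-diagonal and the
down-diagonal that do not leave `R`, and these bound it on all four sides. -/
theorem isMaxRectangle_iff {M : Finset (ℤ × ℤ)} (hM : IsMoon M) :
    IsMaxRectangle R M ↔ MaxRel R (boxRel M) := by
  constructor
  · rintro ⟨hsub, hmax⟩
    have hmax' : ∀ S : Rectangle, S.i₀ ≤ R.i₀ → R.i₁ ≤ S.i₁ → S.j₀ ≤ R.j₀ → R.j₁ ≤ S.j₁ →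
        (∀ i j, S.i₀ ≤ i → i ≤ S.i₁ → S.j₀ ≤ j → j ≤ S.j₁ → boxRel M i j) → S = R := by
      intro S h1 h2 h3 h4 h5
      refine hmax S (fun p hp => ?_) (boxes_subset_iff.2 h5)
      rw [Rectangle.mem_boxes] at hp ⊢
      omega
    rw [boxes_subset_iff] at hsub
    refine ⟨hsub, ?_, ?_⟩
    · exact exists_row_of_maximal (isMoon_iff.1 hM) M.finite_toSet hsub
        fun S h1 h2 h3 h4 => hmax' S h1.le h2.ge h3 h4
    · refine exists_row_of_maximal (R := R.swap) (isMoon_iff.1 hM).flip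
        ((M.finite_toSet.image Prod.swap).subset fun p hp => ⟨(p.2, p.1), hp, rfl⟩)
        (fun i j h1 h2 h3 h4 => hsub j i h3 h4 h1 h2) fun S h1 h2 h3 h4 h5 => ?_
      have := hmax' S.swap h3 h4 h1.le h2.ge fun i j h1 h2 h3 h4 => h5 j i h3 h4 h1 h2
      rw [← this, Rectangle.swap_swap]
  · rintro ⟨hsub, ⟨i, h1, h2, h3⟩, ⟨j, g1, g2, g3⟩⟩
    refine ⟨boxes_subset_iff.2 hsub, fun S hRS hS => ?_⟩
    rw [boxes_subset_iff] at hRS hS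
    have hRS : ∀ i j, R.i₀ ≤ i → i ≤ R.i₁ → R.j₀ ≤ j → j ≤ R.j₁ →
      (S.i₀ ≤ i ∧ i ≤ S.i₁) ∧ S.j₀ ≤ j ∧ j ≤ S.j₁ := fun i j h1 h2 h3 h4 =>
        Rectangle.mem_boxes.1 (hRS i j h1 h2 h3 h4)
    have a1 := hRS _ _ le_rfl R.hi le_rfl R.hj
    have a2 := hRS _ _ R.hi le_rfl R.hj le_rfl
    have a3 := h3 _ (hS i S.j₀ (by omega) (by omega) le_rfl S.hj)
    have a4 := h3 _ (hS i S.j₁ (by omega) (by omega) S.hj le_rfl)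
    have a5 := g3 _ (hS S.i₀ j le_rfl S.hi (by omega) (by omega))
    have a6 := g3 _ (hS S.i₁ j S.hi le_rfl (by omega) (by omega))
    ext <;> omega

theorem boxShift_eq (k : ShiftKind) {i j : ℤ}
    (h : (R.i₀ ≤ i ∧ i ≤ R.i₁) ∨ (R.j₀ ≤ j ∧ j ≤ R.j₁)) : boxShift k R (i, j) =
      if R.i₀ ≤ i ∧ i ≤ R.i₁ then if R.j₀ ≤ j ∧ j ≤ R.j₁ then (i, j) else (i - k.rowStep, j)
      else (i, j - k.colStep) := by
  by_cases hi : R.i₀ ≤ i ∧ i ≤ R.i₁ <;> by_cases hj : R.j₀ ≤ j ∧ j ≤ R.j₁ <;> cases k <;>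
    simp_all [boxShift, Rectangle.Beside, Rectangle.Along, Rectangle.mem_boxes,
      ShiftKind.rowStep, ShiftKind.colStep]
  rw [if_neg (by omega), if_neg (by omega)]

theorem boxUnshift_eq (k : ShiftKind) {i j : ℤ}
    (h : (R.i₀ ≤ i ∧ i ≤ R.i₁) ∨ (R.j₀ ≤ j ∧ j ≤ R.j₁)) : boxUnshift k R (i, j) =
      if R.i₀ ≤ i ∧ i ≤ R.i₁ then if R.j₀ ≤ j ∧ j ≤ R.j₁ then (i, j) else (i + k.rowStep, j)
      else (i, j + k.colStep) := by
  by_cases hi : R.i₀ ≤ i ∧ i ≤ R.i₁ <;> by_cases hj : R.j₀ ≤ j ∧ j ≤ R.j₁ <;> cases k <;>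
    simp_all [boxUnshift, Rectangle.Beside, Rectangle.Along, Rectangle.mem_boxes,
      ShiftKind.rowStep, ShiftKind.colStep]
  rw [if_neg (by omega), if_neg (by omega)]

theorem ShiftKind.rowStep_cast (k : ShiftKind) : (k.rowStep : ℤ) = 0 ∨ (k.rowStep : ℤ) = 1 := by
  cases k <;> simp [ShiftKind.rowStep]

theorem ShiftKind.colStep_cast (k : ShiftKind) : (k.colStep : ℤ) = 0 ∨ (k.colStep : ℤ) = 1 := by
  cases k <;> simp [ShiftKind.colStep]

open scoped Classical in
theorem boxRel_image {M : Finset (ℤ × ℤ)} (k : ShiftKind) (hM : MoonRel (boxRel M))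
    (hR : MaxRel R (boxRel M)) : boxRel (M.image (boxShift k R)) =
      shiftedRel k.rowStep k.colStep R (boxRel M) := by
  funext i j
  rw [eq_iff_iff, boxRel, Finset.mem_image]
  constructor
  · rintro ⟨⟨a, b⟩, hab, e⟩
    have h0 := hR.outside hM hab
    rw [boxShift_eq k h0] at e
    split_ifs at e with h1 h2
    · cases e
      exact Or.inl ⟨h1, h2⟩
    · cases e
      exact Or.inr (Or.inr ⟨h2, by rw [sub_add_cancel]; exact hab⟩)
    · cases e
      exact Or.inr (Or.inl ⟨h1, by rw [sub_add_cancel]; exact hab⟩)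
  · rintro (h | h | h)
    · refine ⟨(i, j), hR.sub i j h.1.1 h.1.2 h.2.1 h.2.2, ?_⟩
      rw [boxShift_eq k (Or.inl h.1), if_pos h.1, if_pos h.2]
    · refine ⟨(i, j + k.colStep), h.2, ?_⟩
      rw [boxShift_eq k (hR.outside hM h.2), if_neg h.1, add_sub_cancel_right]
    · have h1 := (hR.outside hM h.2).resolve_right h.1
      refine ⟨(i + k.rowStep, j), h.2, ?_⟩
      rw [boxShift_eq k (Or.inl h1), if_pos h1, if_neg h.1, add_sub_cancel_right]

theorem eq_of_boxRel_eq {M N : Finset (ℤ × ℤ)} (h : boxRel M = boxRel N) : M = N := by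
  ext ⟨i, j⟩
  exact iff_of_eq (congrFun (congrFun h i) j)

/-- The description of shifts by relations. -/
theorem isShift_iff {k : ShiftKind} {M N : Finset (ℤ × ℤ)} : IsShift k R M N ↔
    MoonRel (boxRel M) ∧ MaxRel R (boxRel M) ∧ AdmitsRel k.rowStep k.colStep R (boxRel M) ∧
      boxRel N = shiftedRel k.rowStep k.colStep R (boxRel M) := by
  constructor
  · rintro ⟨h1, h2, h3, h4⟩
    rw [isMaxRectangle_iff h1] at h2
    rw [isMoon_iff] at h1 h4
    have e : boxRel N = shiftedRel k.rowStep k.colStep R (boxRel M) := by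
      rw [h3, boxRel_image k h1 h2]
    rw [e] at h4
    exact ⟨h1, h2, AdmitsRel.of_moonRel h1 h2 k.rowStep_cast k.colStep_cast h4, e⟩
  · rintro ⟨h1, h2, h3, h4⟩
    refine ⟨isMoon_iff.2 h1, (isMaxRectangle_iff (isMoon_iff.2 h1)).2 h2,
      eq_of_boxRel_eq ?_, isMoon_iff.2 ?_⟩
    · rw [h4, boxRel_image k h1 h2]
    · rw [h4]
      exact h1.shiftedRel h2 k.rowStep_cast k.colStep_cast h3

theorem Crosses.follow (h : Crosses R₁ R₂) (k : ShiftKind) :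
    follow k R₁ R₂ = R₂.lower k.rowStep 0 := by
  have h1 := h.cols_ne
  have h2 := h.i₀_le
  have h3 := h.le_i₁
  cases k <;> simp [_root_.follow, h1, h2, h3, ShiftKind.rowStep]

theorem Crosses.follow' (h : Crosses R₁ R₂) (k : ShiftKind) :
    _root_.follow k R₂ R₁ = R₁.lower 0 k.colStep := by
  have h1 := h.rows_ne
  have h2 := h.j₀_le
  have h3 := h.le_j₁
  cases k <;> simp [_root_.follow, h1, h2, h3, ShiftKind.colStep]

theorem exists_finset_of_shift {k : ShiftKind} {M : Finset (ℤ × ℤ)} (h1 : MoonRel (boxRel M))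
    (h2 : MaxRel R (boxRel M)) (h3 : AdmitsRel k.rowStep k.colStep R (boxRel M)) :
    ∃ N, IsShift k R M N := by
  classical
  exact ⟨M.image (boxShift k R), isShift_iff.2 ⟨h1, h2, h3, boxRel_image k h1 h2⟩⟩

end Polyomino

/-! ### Commutation of shifts on labelings of polyominoes -/

section Labels

variable {k k₁ k₂ : ShiftKind} {R R₁ R₂ : Rectangle} {M N N₁ N₂ K : Finset (ℤ × ℤ)}

open scoped Classical in
/-- The map of labelings that applies `f` to the labels in `R` and moves the other labels. -/
noncomputable def moveMap (f : (R.boxes → ℝ) → R.boxes → ℝ) (k : ShiftKind) (M N : Finset (ℤ × ℤ))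
    (x : M → ℝ) : N → ℝ :=
  fun q =>
    if h : q.1 ∈ R.boxes then f (fun p => labelAt x p.1) ⟨q.1, h⟩
    else labelAt x (boxUnshift k R q.1)

theorem shiftMap_eq_moveMap (k : ShiftKind) (R : Rectangle) (M N : Finset (ℤ × ℤ)) :
    shiftMap k R M N = moveMap (rectMap k R) k M N := rfl

theorem labelAt_of_notMem (x : M → ℝ) {p : ℤ × ℤ} (h : p ∉ M) : labelAt x p = 0 := by
  simp [labelAt, h]

theorem ext_labelAt {x y : M → ℝ} (h : ∀ i j, boxRel M i j → labelAt x (i, j) = labelAt y (i, j)) :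
    x = y := by
  funext ⟨⟨i, j⟩, hp⟩
  have := h i j hp
  rwa [labelAt_of_mem _ hp, labelAt_of_mem _ hp] at this

theorem IsShift.subset_source (h : IsShift k R M N) : R.boxes ⊆ M := h.maximal.1

theorem IsShift.subset_target (h : IsShift k R M N) : R.boxes ⊆ N := by
  obtain ⟨h1, h2, h3, h4⟩ := isShift_iff.1 h
  rw [boxes_subset_iff, h4]
  exact fun i j h1 h2 h3 h4 => Or.inl ⟨⟨h1, h2⟩, h3, h4⟩

theorem labelAt_moveMap_of_mem (h : IsShift k R M N) (f : (R.boxes → ℝ) → R.boxes → ℝ)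
    (x : M → ℝ) {p : ℤ × ℤ} (hp : p ∈ R.boxes) :
    labelAt (moveMap f k M N x) p = f (fun p => labelAt x p.1) ⟨p, hp⟩ := by
  rw [labelAt_of_mem _ (h.subset_target hp), moveMap, dif_pos hp]

/-- No membership is required: outside the polyominoes both labels have the default value `0`. -/
theorem labelAt_moveMap_along (h : IsShift k R M N) (f : (R.boxes → ℝ) → R.boxes → ℝ)
    (x : M → ℝ) {i j : ℤ} (hi : R.i₀ ≤ i ∧ i ≤ R.i₁) (hj : ¬(R.j₀ ≤ j ∧ j ≤ R.j₁)) :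
    labelAt (moveMap f k M N x) (i, j) = labelAt x (i + k.rowStep, j) := by
  obtain ⟨h1, h2, h3, h4⟩ := isShift_iff.1 h
  by_cases hN : (i, j) ∈ N
  · rw [labelAt_of_mem _ hN, moveMap, dif_neg fun hp => hj (Rectangle.mem_boxes.1 hp).2,
      boxUnshift_eq k (Or.inl hi), if_pos hi, if_neg hj]
  · rw [labelAt_of_notMem _ hN, labelAt_of_notMem]
    intro hM
    change ¬boxRel N i j at hN
    rw [h4] at hN
    exact hN (Or.inr (Or.inr ⟨hj, hM⟩))

theorem labelAt_moveMap_beside (h : IsShift k R M N) (f : (R.boxes → ℝ) → R.boxes → ℝ)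
    (x : M → ℝ) {i j : ℤ} (hi : ¬(R.i₀ ≤ i ∧ i ≤ R.i₁)) (hj : R.j₀ ≤ j ∧ j ≤ R.j₁) :
    labelAt (moveMap f k M N x) (i, j) = labelAt x (i, j + k.colStep) := by
  obtain ⟨h1, h2, h3, h4⟩ := isShift_iff.1 h
  by_cases hN : (i, j) ∈ N
  · rw [labelAt_of_mem _ hN, moveMap, dif_neg fun hp => hi (Rectangle.mem_boxes.1 hp).1,
      boxUnshift_eq k (Or.inr hj), if_neg hi]
  · rw [labelAt_of_notMem _ hN, labelAt_of_notMem]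
    intro hM
    change ¬boxRel N i j at hN
    rw [h4] at hN
    exact hN (Or.inr (Or.inl ⟨hi, hM⟩))

/-- The deformation of `shiftMap`. -/
noncomputable def softShiftMap (t : ℝ) (k : ShiftKind) (R : Rectangle) (M N : Finset (ℤ × ℤ)) :
    (M → ℝ) → N → ℝ :=
  moveMap (softRectMap t k R) k M N

theorem contConv_softShiftMap (k : ShiftKind) (R : Rectangle) (M N : Finset (ℤ × ℤ)) :
    ContConv (fun n => softShiftMap n k R M N) (shiftMap k R M N) := by
  classical
  intro X x hX q
  have hl : ∀ p, Tendsto (fun n => labelAt (X n) p) atTop (𝓝 (labelAt x p)) := by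
    intro p
    by_cases hp : p ∈ M
    · simp only [labelAt_of_mem _ hp]
      exact hX _
    · simp only [labelAt_of_notMem _ hp]
      exact tendsto_const_nhds
  rw [shiftMap_eq_moveMap]
  by_cases hq : q.1 ∈ R.boxes
  · simp only [softShiftMap, moveMap, dif_pos hq]
    exact (permConv_softRectMap k R).1 _ _ (fun p => hl p.1) _
  · simp only [softShiftMap, moveMap, dif_neg hq]
    exact hl _

/-- The exponential of a label. -/
noncomputable def labelExp (t : ℝ) (x : M → ℝ) (i j : ℤ) : ℝ := Real.exp (t * labelAt x (i, j))

theorem chainShift_softShiftMap {t : ℝ} (ht : t ≠ 0) (h : IsShift k R M N) (x : M → ℝ) :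
    ChainShift k R.numRows R.numCols (Real.exp t) (corner (labelExp t x) R.i₀ R.j₀)
      (corner (labelExp t (softShiftMap t k R M N x)) R.i₀ R.j₀) := by
  refine (chainShift_softRectMap ht k R fun p => labelAt x p.1).congr R.numRows_pos R.numCols_pos
    (fun a b ha hb => ?_) fun a b ha hb => ?_
  · rw [expArray_box _ _ ha hb]
    rfl
  · rw [expArray_box _ _ ha hb, corner, labelExp, softShiftMap,
      labelAt_moveMap_of_mem h _ _ (p := (R.i₀ + a, R.j₀ + b)) (R.box a b ha hb).2]
    rfl

theorem Rectangle.numRows_lower (R : Rectangle) (a b : ℤ) :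
    (R.lower a b).numRows = R.numRows := by
  simp [Rectangle.numRows, Rectangle.lower]

theorem Rectangle.numCols_lower (R : Rectangle) (a b : ℤ) :
    (R.lower a b).numCols = R.numCols := by
  simp [Rectangle.numCols, Rectangle.lower]

/-- On the union of the two translated rectangles this is `commute_labels` for the exponentials of
the labels. The other boxes are only carried along, by vectors whose sum does not depend on the
order. -/
theorem softShiftMap_comm {t : ℝ} (ht : t ≠ 0) (hc : Crosses R₁ R₂) (h₁ : IsShift k₁ R₁ M N₁)
    (h₂ : IsShift k₂ R₂ M N₂) (h₃ : IsShift k₂ (R₂.lower k₁.rowStep 0) N₁ K)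
    (h₄ : IsShift k₁ (R₁.lower 0 k₂.colStep) N₂ K) :
    softShiftMap t k₂ (R₂.lower k₁.rowStep 0) N₁ K ∘ softShiftMap t k₁ R₁ M N₁ =
      softShiftMap t k₁ (R₁.lower 0 k₂.colStep) N₂ K ∘ softShiftMap t k₂ R₂ M N₂ := by
  funext x
  refine ext_labelAt fun i j hij => ?_
  obtain ⟨hm, m₁, ad₁, e₁⟩ := isShift_iff.1 h₁
  obtain ⟨-, m₂, ad₂, e₂⟩ := isShift_iff.1 h₂
  obtain ⟨-, m₃, ad₃, e₃⟩ := isShift_iff.1 h₃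
  have a1 := hc.add_le m₂ ad₁
  have a2 : R₂.j₀ + k₂.colStep ≤ R₁.j₀ := hc.swap.add_le m₁.flip ad₂.flip
  rw [e₃, e₁, hc.shiftedRel m₁ m₂ k₁.rowStep_cast k₁.colStep_cast k₂.colStep_cast ad₁ ad₂] at hij
  have c1 := hc.le_i₁
  have c2 := hc.i₀_le
  have c3 := hc.j₀_le
  have c4 := hc.le_j₁
  have c5 := hc.rows_ne
  have c6 := hc.cols_ne
  have n1 := R₁.numRows_eq
  have n2 := R₁.numCols_eq
  have n3 := R₂.numRows_eq
  have n4 := R₂.numCols_eq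
  have n5 := R₁.hi
  have n6 := R₂.hi
  have n7 := R₁.hj
  have n8 := R₂.hj
  have s1 := k₁.rowStep_cast
  have s2 := k₁.colStep_cast
  have s3 := k₂.rowStep_cast
  have s4 := k₂.colStep_cast
  simp only [Function.comp_apply]
  by_cases hin : ((R₂.i₀ ≤ i + k₁.rowStep ∧ i + k₁.rowStep ≤ R₂.i₁) ∧ R₂.j₀ ≤ j ∧ j ≤ R₂.j₁) ∨
      ((R₁.j₀ ≤ j + k₂.colStep ∧ j + k₂.colStep ≤ R₁.j₁) ∧ R₁.i₀ ≤ i ∧ i ≤ R₁.i₁)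
  · set x₁ := softShiftMap t k₁ R₁ M N₁ x with hx₁
    set x₂ := softShiftMap t k₂ R₂ M N₂ x with hx₂
    have pos : ∀ {M : Finset (ℤ × ℤ)} (x : M → ℝ) (i j : ℤ), 0 < labelExp t x i j :=
      fun _ _ _ => Real.exp_pos _
    have key := commute_labels (k₁ := k₁) (k₂ := k₂) (a₁ := R₁.i₀) (b₁ := R₁.j₀) (a₂ := R₂.i₀)
      (b₂ := R₂.j₀) (a' := R₂.i₀ - k₁.rowStep) (b' := R₁.j₀ - k₂.colStep)
      (r₁ := R₁.numRows) (s₁ := R₁.numCols) (r₂ := R₂.numRows) (s₂ := R₂.numCols)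
      (w := Real.exp t) (X := labelExp t x) (X' := labelExp t x₁)
      (Y := labelExp t (softShiftMap t k₂ (R₂.lower k₁.rowStep 0) N₁ K x₁))
      (Z := labelExp t x₂)
      (W := labelExp t (softShiftMap t k₁ (R₁.lower 0 k₂.colStep) N₂ K x₂))
      (by omega) (by omega) (Real.exp_pos t) R₂.numRows_pos R₁.numCols_pos (by omega) (by omega)
      (pos _) (pos _) (pos _) (pos _) (pos _) (by omega) (by omega) (by omega) (by omega)
      (chainShift_softShiftMap ht h₁ x)
      (fun i j g1 g2 g3 g4 g5 => by
        rw [labelExp, hx₁, softShiftMap, labelAt_moveMap_along h₁ _ _ (by omega) (by omega)]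
        rfl)
      (chainShift_softShiftMap ht h₂ x)
      (fun i j g1 g2 g3 g4 g5 => by
        rw [labelExp, hx₂, softShiftMap, labelAt_moveMap_beside h₂ _ _ (by omega) (by omega)]
        rfl)
      (by
        have := chainShift_softShiftMap ht h₃ x₁
        rw [Rectangle.numRows_lower, Rectangle.numCols_lower] at this
        simpa only [Rectangle.lower, sub_zero] using this)
      (fun i j g1 g2 g3 g4 g5 => by
        rw [labelExp, softShiftMap, labelAt_moveMap_beside h₃ _ _
          (by simp only [Rectangle.lower]; omega) (by simp only [Rectangle.lower]; omega)]
        rfl)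
      (by
        have := chainShift_softShiftMap ht h₄ x₂
        rw [Rectangle.numRows_lower, Rectangle.numCols_lower] at this
        simpa only [Rectangle.lower, sub_zero] using this)
      (fun i j g1 g2 g3 g4 g5 => by
        rw [labelExp, softShiftMap, labelAt_moveMap_along h₄ _ _
          (by simp only [Rectangle.lower]; omega) (by simp only [Rectangle.lower]; omega)]
        rfl)
      (i := i) (j := j) (by omega)
    exact mul_left_cancel₀ ht (Real.exp_injective key)
  · rw [not_or] at hin
    rcases hij with h | h | h | h | h
    · exact absurd h hin.1
    · exact absurd h hin.2
    · have := ad₁.rows _ _ h.2 h.1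
      rw [softShiftMap, labelAt_moveMap_beside h₃ _ _ (by simp only [Rectangle.lower]; omega)
          (by simp only [Rectangle.lower]; omega), softShiftMap,
        labelAt_moveMap_beside h₁ _ _ h.1 (by omega), softShiftMap,
        labelAt_moveMap_beside h₄ _ _ (by simp only [Rectangle.lower]; omega)
          (by simp only [Rectangle.lower]; omega), softShiftMap,
        labelAt_moveMap_beside h₂ _ _ (by omega) (by omega), add_right_comm]
    · have := ad₂.cols _ _ h.2 h.1
      rw [softShiftMap, labelAt_moveMap_along h₃ _ _ (by simp only [Rectangle.lower]; omega)
          (by simp only [Rectangle.lower]; omega), softShiftMap,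
        labelAt_moveMap_along h₁ _ _ (by omega) (by omega), softShiftMap,
        labelAt_moveMap_along h₄ _ _ (by simp only [Rectangle.lower]; omega)
          (by simp only [Rectangle.lower]; omega), softShiftMap,
        labelAt_moveMap_along h₂ _ _ (by omega) (by omega), add_right_comm]
    · obtain ⟨g1, g2, g3⟩ := h
      have f1 := ad₁.cols _ _ g3 g2
      have f2 := ad₂.rows _ _ g3 g1
      rw [softShiftMap, labelAt_moveMap_beside h₃ _ _ (by simp only [Rectangle.lower]; omega)
          (by simp only [Rectangle.lower]; omega), softShiftMap,
        labelAt_moveMap_along h₁ _ _ (by omega) (by omega), softShiftMap,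
        labelAt_moveMap_along h₄ _ _ (by simp only [Rectangle.lower]; omega)
          (by simp only [Rectangle.lower]; omega), softShiftMap,
        labelAt_moveMap_beside h₂ _ _ (by omega) (by omega)]

theorem shiftMap_comm_of_crosses (hc : Crosses R₁ R₂) (h₁ : IsShift k₁ R₁ M N₁)
    (h₂ : IsShift k₂ R₂ M N₂) : ∃ K : Finset (ℤ × ℤ),
      IsShift k₂ (follow k₁ R₁ R₂) N₁ K ∧ IsShift k₁ (follow k₂ R₂ R₁) N₂ K ∧
      shiftMap k₂ (follow k₁ R₁ R₂) N₁ K ∘ shiftMap k₁ R₁ M N₁ =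
        shiftMap k₁ (follow k₂ R₂ R₁) N₂ K ∘ shiftMap k₂ R₂ M N₂ := by
  rw [hc.follow, hc.follow']
  obtain ⟨hm, m₁, ad₁, e₁⟩ := isShift_iff.1 h₁
  obtain ⟨-, m₂, ad₂, e₂⟩ := isShift_iff.1 h₂
  have r1 := k₁.rowStep_cast
  have c1 := k₁.colStep_cast
  have r2 := k₂.rowStep_cast
  have c2 := k₂.colStep_cast
  obtain ⟨K, hK⟩ := exists_finset_of_shift (k := k₂) (R := R₂.lower k₁.rowStep 0) (M := N₁)
    (isMoon_iff.1 h₁.moon_target)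
    (by rw [e₁]; exact hc.maxRel m₁ m₂ r1 c1 ad₁)
    (by rw [e₁]; exact hc.admitsRel m₁ m₂ c1 ad₁ ad₂)
  have hK' : IsShift k₁ (R₁.lower 0 k₂.colStep) N₂ K := by
    refine isShift_iff.2 ⟨isMoon_iff.1 h₂.moon_target,
      by rw [e₂]; exact hc.maxRel' m₁ m₂ r2 c2 ad₂,
      by rw [e₂]; exact hc.admitsRel' m₁ m₂ r2 ad₁ ad₂, ?_⟩
    rw [(isShift_iff.1 hK).2.2.2, e₁, e₂, hc.shiftedRel m₁ m₂ r1 c1 c2 ad₁ ad₂,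
      hc.shiftedRel' m₁ m₂ r2 c2 r1 ad₁ ad₂]
  refine ⟨K, hK, hK', ?_⟩
  -- The identity of the deformed maps passes to the limit.
  refine ContConv.eq ((contConv_softShiftMap _ _ _ _).comp (contConv_softShiftMap _ _ _ _))
    ((contConv_softShiftMap _ _ _ _).comp (contConv_softShiftMap _ _ _ _)) fun n hn => ?_
  exact softShiftMap_comm (Nat.cast_ne_zero.2 hn.ne') hc h₁ h₂ hK hK'

/-- The maps of two different maximal rectangles commute. -/
theorem shiftMap_comm (hne : R₁ ≠ R₂) (h₁ : IsShift k₁ R₁ M N₁)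
    (h₂ : IsShift k₂ R₂ M N₂) : ∃ K : Finset (ℤ × ℤ),
      IsShift k₂ (follow k₁ R₁ R₂) N₁ K ∧ IsShift k₁ (follow k₂ R₂ R₁) N₂ K ∧
      shiftMap k₂ (follow k₁ R₁ R₂) N₁ K ∘ shiftMap k₁ R₁ M N₁ =
        shiftMap k₁ (follow k₂ R₂ R₁) N₂ K ∘ shiftMap k₂ R₂ M N₂ := by
  obtain ⟨hm, m₁, -, -⟩ := isShift_iff.1 h₁
  obtain ⟨-, m₂, -, -⟩ := isShift_iff.1 h₂
  rcases m₁.crossing hm m₂ hne with ⟨a, b, c, d, e, f⟩ | ⟨a, b, c, d, e, f⟩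
  · exact shiftMap_comm_of_crosses ⟨a, b, c, d, e, f⟩ h₁ h₂
  · obtain ⟨K, g1, g2, g3⟩ := shiftMap_comm_of_crosses ⟨a, b, c, d, e, f⟩ h₂ h₁
    exact ⟨K, g2, g1, g3.symm⟩

end Labels

/-! ### Confluence and independence of the sequence of shifts -/

section Confluence

section ToggleCommute

variable {P : Type*} [PartialOrder P] [Fintype P]

theorem maxBelow_congr_covBy {x y : P → ℝ} {p : P} (h : ∀ q, q ⋖ p → x q = y q) :
    maxBelow x p = maxBelow y p := by
  unfold maxBelow
  split_ifs with hne
  · exact Finset.sup'_congr hne rfl fun q hq => h q (mem_lowerCovers.1 hq)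
  · rfl

theorem minAbove_congr_covBy {x y : P → ℝ} {p : P} (h : ∀ q, p ⋖ q → x q = y q) :
    minAbove x p = minAbove y p := by
  unfold minAbove
  split_ifs with hne
  · exact Finset.inf'_congr hne rfl fun q hq => h q (mem_upperCovers.1 hq)
  · rfl

theorem toggle_apply_self (p : P) (x : P → ℝ) :
    toggle p x p = minAbove x p + maxBelow x p - x p := by
  simp [toggle, toggleFun]

theorem toggle_apply_ne {p q : P} (h : q ≠ p) (x : P → ℝ) : toggle p x q = x q := by
  simp [toggle, toggleFun, h]

theorem toggle_commute {p q : P} (h : p ≠ q) (h₁ : ¬p ⋖ q) (h₂ : ¬q ⋖ p) :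
    Commute (toggle p) (toggle q) := by
  have key : ∀ {p q : P}, p ≠ q → ¬p ⋖ q → ¬q ⋖ p → ∀ x, toggle p (toggle q x) p = toggle p x p := by
    intro p q h h₁ h₂ x
    rw [toggle_apply_self, toggle_apply_self, toggle_apply_ne h,
      maxBelow_congr_covBy (x := toggle q x) (y := x) fun a ha =>
        toggle_apply_ne (by rintro rfl; exact h₂ ha) x,
      minAbove_congr_covBy (x := toggle q x) (y := x) fun a ha =>
        toggle_apply_ne (by rintro rfl; exact h₁ ha) x]
  refine Equiv.ext fun x => funext fun a => ?_
  rw [Equiv.Perm.mul_apply, Equiv.Perm.mul_apply]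
  by_cases ha : a = p
  · subst ha
    rw [key h h₁ h₂, toggle_apply_ne h]
  · rw [toggle_apply_ne ha]
    by_cases ha' : a = q
    · subst ha'
      rw [key (Ne.symm h) h₂ h₁]
    · rw [toggle_apply_ne ha', toggle_apply_ne ha', toggle_apply_ne ha]

theorem rowmotion_commute {I J : Finset P}
    (h : ∀ p ∈ I, ∀ q ∈ J, p ≠ q ∧ ¬p ⋖ q ∧ ¬q ⋖ p) : Commute (rowmotion I) (rowmotion J) := by
  unfold rowmotion
  refine Commute.list_prod_left _ _ fun f hf => Commute.list_prod_right _ _ fun g hg => ?_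
  obtain ⟨p, hp, rfl⟩ := List.mem_map.1 hf
  obtain ⟨q, hq, rfl⟩ := List.mem_map.1 hg
  obtain ⟨h1, h2, h3⟩ := h p (mem_linearList.1 hp) q (mem_linearList.1 hq)
  exact toggle_commute h1 h2 h3

end ToggleCommute

/-- The indices of a file strictly left and a file strictly right of the top element differ by at
least two, so no toggles of the two maps sit on a cover relation. -/
theorem proP_commute_proQ (R : Rectangle) : Commute (ProP R) (ProQ R) := by
  rw [ProP_eq, ProQ_eq]
  refine Commute.list_prod_left _ _ fun f hf => Commute.list_prod_right _ _ fun g hg => ?_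
  obtain ⟨a, -, rfl⟩ := List.mem_map.1 hf
  obtain ⟨b, -, rfl⟩ := List.mem_map.1 hg
  refine rowmotion_commute fun p hp q hq => ?_
  rw [Rectangle.mem_file] at hp hq
  refine ⟨fun e => ?_, ?_, ?_⟩
  · subst e
    omega
  · rw [Rectangle.covBy_iff]
    omega
  · rw [Rectangle.covBy_iff]
    omega

theorem rectMap_commute (R : Rectangle) : Commute (rectMap .proP R) (rectMap .proQ R) := by
  have h := (proP_commute_proQ R).eq
  change (RSK R)⁻¹ * ProP R * RSK R * ((RSK R)⁻¹ * ProQ R * RSK R) =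
    (RSK R)⁻¹ * ProQ R * RSK R * ((RSK R)⁻¹ * ProP R * RSK R)
  calc _ = (RSK R)⁻¹ * (ProP R * ProQ R) * RSK R := by group
    _ = (RSK R)⁻¹ * (ProQ R * ProP R) * RSK R := by rw [h]
    _ = _ := by group

variable {k k₁ k₂ : ShiftKind} {R R₁ R₂ : Rectangle} {M N N₁ N₂ K : Finset (ℤ × ℤ)}

theorem moveMap_bijective (h : IsShift k R M N) (f : Equiv.Perm (R.boxes → ℝ)) :
    Function.Bijective (moveMap f k M N) := by
  classical
  obtain ⟨hm, hR, ha, e⟩ := isShift_iff.1 h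
  constructor
  · intro x x' hx
    have hl : ∀ p, labelAt (moveMap f k M N x) p = labelAt (moveMap f k M N x') p := by simp [hx]
    refine ext_labelAt fun i j hij => ?_
    by_cases hi : R.i₀ ≤ i ∧ i ≤ R.i₁
    · by_cases hj : R.j₀ ≤ j ∧ j ≤ R.j₁
      · have hf : f (fun p => labelAt x p.1) = f (fun p => labelAt x' p.1) := by
          funext p
          have := hl p.1
          rwa [labelAt_moveMap_of_mem h _ _ p.2, labelAt_moveMap_of_mem h _ _ p.2] at this
        exact congrFun (f.injective hf) ⟨(i, j), Rectangle.mem_boxes.2 ⟨hi, hj⟩⟩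
      · have h1 := ha.cols _ _ hij hj
        have := hl (i - k.rowStep, j)
        rwa [labelAt_moveMap_along h _ _ (by omega) hj, labelAt_moveMap_along h _ _ (by omega) hj,
          sub_add_cancel] at this
    · have h1 := ha.rows _ _ hij hi
      have := hl (i, j - k.colStep)
      rwa [labelAt_moveMap_beside h _ _ hi (by omega), labelAt_moveMap_beside h _ _ hi (by omega),
        sub_add_cancel] at this
  · intro y
    let x : M → ℝ := fun p => if hp : p.1 ∈ R.boxes then
      f.symm (fun q => labelAt y q.1) ⟨p.1, hp⟩ else labelAt y (boxShift k R p.1)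
    refine ⟨x, ext_labelAt fun i j hij => ?_⟩
    rw [e] at hij
    rcases hij with hij | hij | hij
    · have hp : (i, j) ∈ R.boxes := Rectangle.mem_boxes.2 hij
      have hx : (fun p : R.boxes => labelAt x p.1) = f.symm (fun q => labelAt y q.1) := by
        funext p
        rw [labelAt_of_mem x (h.subset_source p.2)]
        simp [x]
      rw [labelAt_moveMap_of_mem h _ _ hp, hx, Equiv.apply_symm_apply]
    · have h1 := ha.rows _ _ hij.2 hij.1
      rw [labelAt_moveMap_beside h _ _ hij.1 (by omega), labelAt_of_mem x hij.2]
      simp only [x]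
      rw [dif_neg fun hp => hij.1 (Rectangle.mem_boxes.1 hp).1,
        boxShift_eq k (Or.inr (by omega)), if_neg hij.1, add_sub_cancel_right]
    · have h1 := ha.cols _ _ hij.2 hij.1
      have hq := k.rowStep_cast
      rw [labelAt_moveMap_along h _ _ (by omega) hij.1, labelAt_of_mem x hij.2]
      simp only [x]
      rw [dif_neg fun hp => hij.1 (Rectangle.mem_boxes.1 hp).2,
        boxShift_eq k (Or.inl (by omega)), if_pos (by omega), if_neg hij.1, add_sub_cancel_right]

/-- A shift of the given kind moves some box. -/
def MovesRel (q p : ℤ) (R : Rectangle) (m : ℤ → ℤ → Prop) : Prop :=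
  (p = 1 ∧ ∃ i j, m i j ∧ ¬(R.i₀ ≤ i ∧ i ≤ R.i₁)) ∨ (q = 1 ∧ ∃ i j, m i j ∧ ¬(R.j₀ ≤ j ∧ j ≤ R.j₁))

/-- The total distance of the boxes from a lower bound. -/
def totalHeight (c : ℤ × ℤ) (M : Finset (ℤ × ℤ)) : ℕ :=
  ∑ p ∈ M, ((p.1 - c.1) + (p.2 - c.2)).toNat

/-- A moved box stays within the rows or columns of `R`, and the boxes of `R` are bounded by `c`.
Thus one bound serves for all later shifts. -/
theorem IsShift.mem_lowerBounds (h : IsShift k R M N) {c : ℤ × ℤ}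
    (hc : c ∈ lowerBounds (M : Set (ℤ × ℤ))) : c ∈ lowerBounds (N : Set (ℤ × ℤ)) := by
  obtain ⟨hm, hR, ha, e⟩ := isShift_iff.1 h
  have hc' : ∀ i j, boxRel M i j → c.1 ≤ i ∧ c.2 ≤ j := fun i j hij => Prod.le_def.1 (hc hij)
  have hR' := hc' _ _ (hR.sub R.i₀ R.j₀ le_rfl R.hi le_rfl R.hj)
  rintro ⟨i, j⟩ hij
  have hij' : boxRel N i j := hij
  rw [e] at hij'
  rw [Prod.le_def]
  dsimp only
  rcases hij' with h1 | h1 | h1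
  · omega
  · have h2 := ha.rows _ _ h1.2 h1.1
    have h3 := hc' _ _ h1.2
    omega
  · have h2 := ha.cols _ _ h1.2 h1.1
    have h3 := hc' _ _ h1.2
    omega

/-- Every moved box loses one unit of height. The truncation to natural numbers does no harm because
the box remains above `c`. -/
theorem IsShift.totalHeight_lt (h : IsShift k R M N) {c : ℤ × ℤ}
    (hc : c ∈ lowerBounds (M : Set (ℤ × ℤ)))
    (hmove : MovesRel k.rowStep k.colStep R (boxRel M)) : totalHeight c N < totalHeight c M := by
  classical
  obtain ⟨hm, hR, ha, e⟩ := isShift_iff.1 h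
  have hc' : ∀ i j, boxRel M i j → c.1 ≤ i ∧ c.2 ≤ j := fun i j hij => Prod.le_def.1 (hc hij)
  have hR' := hc' _ _ (hR.sub R.i₀ R.j₀ le_rfl R.hi le_rfl R.hj)
  have hq := k.rowStep_cast
  have hp := k.colStep_cast
  let f : ℤ × ℤ → ℕ := fun p => ((p.1 - c.1) + (p.2 - c.2)).toNat
  have h1 : ∑ p ∈ N, f p ≤ ∑ p ∈ M, f (boxShift k R p) := by
    rw [h.image_eq]
    exact Finset.sum_image_le_of_nonneg fun _ _ => Nat.zero_le _
  refine lt_of_le_of_lt h1 (Finset.sum_lt_sum ?_ ?_)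
  · rintro ⟨i, j⟩ hij
    rw [boxShift_eq k (hR.outside hm hij)]
    simp only [f]
    split_ifs <;> dsimp only <;> omega
  · rcases hmove with ⟨hp1, i, j, hij, hi⟩ | ⟨hq1, i, j, hij, hj⟩
    · refine ⟨(i, j), hij, ?_⟩
      have := ha.rows _ _ hij hi
      have := hc' _ _ hij
      rw [boxShift_eq k (hR.outside hm hij), if_neg hi]
      simp only [f]
      omega
    · refine ⟨(i, j), hij, ?_⟩
      have h2 := ha.cols _ _ hij hj
      have := hc' _ _ hij
      rw [boxShift_eq k (hR.outside hm hij), if_pos (by omega), if_neg hj]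
      simp only [f]
      omega

theorem IsShift.ne_iff (h : IsShift k R M N) :
    M ≠ N ↔ MovesRel k.rowStep k.colStep R (boxRel M) := by
  obtain ⟨hm, hR, ha, e⟩ := isShift_iff.1 h
  constructor
  · intro hne
    by_contra hcon
    refine hne (eq_of_boxRel_eq ?_)
    rw [e]
    rw [MovesRel, not_or] at hcon
    have hq := k.rowStep_cast
    have hp := k.colStep_cast
    have c1 : ∀ i j, boxRel M i j → ¬(R.i₀ ≤ i ∧ i ≤ R.i₁) → (k.colStep : ℤ) = 0 := fun i j h1 h2 =>
      hp.resolve_right fun h3 => hcon.1 ⟨h3, i, j, h1, h2⟩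
    have c2 : ∀ i j, boxRel M i j → ¬(R.j₀ ≤ j ∧ j ≤ R.j₁) → (k.rowStep : ℤ) = 0 := fun i j h1 h2 =>
      hq.resolve_right fun h3 => hcon.2 ⟨h3, i, j, h1, h2⟩
    funext i j
    rw [eq_iff_iff]
    constructor
    · intro hij
      by_cases hi : R.i₀ ≤ i ∧ i ≤ R.i₁
      · by_cases hj : R.j₀ ≤ j ∧ j ≤ R.j₁
        · exact Or.inl ⟨hi, hj⟩
        · exact Or.inr (Or.inr ⟨hj, by rwa [c2 _ _ hij hj, add_zero]⟩)
      · exact Or.inr (Or.inl ⟨hi, by rwa [c1 _ _ hij hi, add_zero]⟩)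
    · rintro (h1 | h1 | h1)
      · exact hR.sub _ _ h1.1.1 h1.1.2 h1.2.1 h1.2.2
      · have := h1.2
        rwa [c1 _ _ this h1.1, add_zero] at this
      · have := h1.2
        rwa [c2 _ _ this h1.1, add_zero] at this
  · rintro hmove rfl
    obtain ⟨c, hc⟩ := M.bddBelow
    exact lt_irrefl _ (h.totalHeight_lt hc hmove)

/-- A shift of the first two types that moves some box, together with its map. -/
def ShiftStep (M N : Finset (ℤ × ℤ)) (f : (M → ℝ) → N → ℝ) : Prop :=
  ∃ (k : ShiftKind) (R : Rectangle), (k = .proP ∨ k = .proQ) ∧ IsShift k R M N ∧ M ≠ N ∧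
    f = shiftMap k R M N

/-- For a shift of down-diagonals the taller rectangle `R₁`, which is fixed, still has rows outside
the translate of `R₂`. For a shift of up-diagonals a box that would have moved is carried along and
can still be moved. -/
theorem MovesRel.lower (hc : Crosses R₁ R₂) (h₁ : IsShift k₁ R₁ M N₁) (h₂ : IsShift k₂ R₂ M N₂)
    (h : MovesRel k₂.rowStep k₂.colStep R₂ (boxRel M)) :
    MovesRel k₂.rowStep k₂.colStep (R₂.lower k₁.rowStep 0) (boxRel N₁) := by
  obtain ⟨hm, m₁, ad₁, e₁⟩ := isShift_iff.1 h₁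
  obtain ⟨-, m₂, ad₂, e₂⟩ := isShift_iff.1 h₂
  have a1 := hc.add_le m₂ ad₁
  have hn := hc.rows_ne
  have h1 := R₁.hi
  have h2 := R₂.hi
  have h3 := hc.le_i₁
  rcases h with ⟨hp, -⟩ | ⟨hq, i, j, hij, hj⟩
  · refine Or.inl ⟨hp, ?_⟩
    have hs := boxes_subset_iff.1 h₁.subset_target
    by_cases hi : R₂.i₀ - k₁.rowStep ≤ R₁.i₀
    · refine ⟨R₁.i₁, R₁.j₀, hs _ _ R₁.hi le_rfl le_rfl R₁.hj, ?_⟩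
      simp only [Rectangle.lower]
      omega
    · refine ⟨R₁.i₀, R₁.j₀, hs _ _ le_rfl R₁.hi le_rfl R₁.hj, ?_⟩
      simp only [Rectangle.lower]
      omega
  · refine Or.inr ⟨hq, i - k₁.rowStep, j, ?_, by simpa only [Rectangle.lower, sub_zero] using hj⟩
    rw [e₁]
    have := hc.j₀_le
    have := hc.le_j₁
    exact Or.inr (Or.inr ⟨by omega, by rwa [sub_add_cancel]⟩)

theorem MovesRel.lower' (hc : Crosses R₁ R₂) (h₁ : IsShift k₁ R₁ M N₁) (h₂ : IsShift k₂ R₂ M N₂)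
    (h : MovesRel k₁.rowStep k₁.colStep R₁ (boxRel M)) :
    MovesRel k₁.rowStep k₁.colStep (R₁.lower 0 k₂.colStep) (boxRel N₂) := by
  obtain ⟨hm, m₁, ad₁, e₁⟩ := isShift_iff.1 h₁
  obtain ⟨-, m₂, ad₂, e₂⟩ := isShift_iff.1 h₂
  have a1 : R₂.j₀ + k₂.colStep ≤ R₁.j₀ := hc.swap.add_le m₁.flip ad₂.flip
  have hn := hc.cols_ne
  have h1 := R₁.hj
  have h2 := R₂.hj
  have h3 := hc.le_j₁
  rcases h with ⟨hp, i, j, hij, hi⟩ | ⟨hq, -⟩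
  · refine Or.inl ⟨hp, i, j - k₂.colStep, ?_, by simpa only [Rectangle.lower, sub_zero] using hi⟩
    rw [e₂]
    have := hc.i₀_le
    have := hc.le_i₁
    exact Or.inr (Or.inl ⟨by omega, by rwa [sub_add_cancel]⟩)
  · refine Or.inr ⟨hq, ?_⟩
    have hs := boxes_subset_iff.1 h₂.subset_target
    by_cases hj : R₁.j₀ - k₂.colStep ≤ R₂.j₀
    · refine ⟨R₂.i₀, R₂.j₁, hs _ _ le_rfl R₂.hi R₂.hj le_rfl, ?_⟩
      simp only [Rectangle.lower]
      omega
    · refine ⟨R₂.i₀, R₂.j₀, hs _ _ le_rfl R₂.hi le_rfl R₂.hj, ?_⟩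
      simp only [Rectangle.lower]
      omega

theorem MaxRel.shiftedRel {q p : ℤ} {m : ℤ → ℤ → Prop} (h : MaxRel R m) (hq : q = 0 ∨ q = 1)
    (hp : p = 0 ∨ p = 1) (ha : AdmitsRel q p R m) : MaxRel R (shiftedRel q p R m) := by
  have half : ∀ {m : ℤ → ℤ → Prop} {R : Rectangle} {q p : ℤ}, MaxRel R m →
      (q = 0 ∨ q = 1) → AdmitsRel q p R m → ∃ i, R.i₀ ≤ i ∧ i ≤ R.i₁ ∧
        ∀ j, _root_.shiftedRel q p R m i j → R.j₀ ≤ j ∧ j ≤ R.j₁ := by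
    intro m R q p h hq ha
    rcases hq with rfl | rfl
    · obtain ⟨i, h1, h2, h3⟩ := h.row
      refine ⟨i, h1, h2, fun j hj => ?_⟩
      rcases hj with hj | hj | hj
      · exact hj.2
      · omega
      · exact h3 j (by simpa using hj.2)
    -- A box entering the last row from outside would come from the row beyond `R`, which
    -- admissibility excludes.
    · refine ⟨R.i₁, R.hi, le_rfl, fun j hj => ?_⟩
      have := R.hi
      rcases hj with hj | hj | hj
      · exact hj.2
      · omega
      · have := ha.cols _ _ hj.2 hj.1
        omega
  refine ⟨fun i j h1 h2 h3 h4 => Or.inl ⟨⟨h1, h2⟩, h3, h4⟩, half h hq ha, ?_⟩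
  have := half h.flip hp ha.flip
  rwa [shiftedRel_flip] at this

/-- The shifts of the first two types with respect to the same rectangle commute. -/
theorem shiftMap_comm_same (h₁ : IsShift .proP R M N₁) (h₂ : IsShift .proQ R M N₂) :
    ∃ K, IsShift .proQ R N₁ K ∧ IsShift .proP R N₂ K ∧
      shiftMap .proQ R N₁ K ∘ shiftMap .proP R M N₁ =
        shiftMap .proP R N₂ K ∘ shiftMap .proQ R M N₂ := by
  obtain ⟨hm, hR, ad₁, e₁⟩ := isShift_iff.1 h₁
  obtain ⟨-, -, ad₂, e₂⟩ := isShift_iff.1 h₂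
  have hi := R.hi
  have hj := R.hj
  change AdmitsRel 0 1 R _ at ad₁
  change AdmitsRel 1 0 R _ at ad₂
  change boxRel N₁ = shiftedRel 0 1 R _ at e₁
  change boxRel N₂ = shiftedRel 1 0 R _ at e₂
  obtain ⟨K, hK⟩ := exists_finset_of_shift (k := .proQ) (R := R) (M := N₁)
    (isMoon_iff.1 h₁.moon_target)
    (by rw [e₁]; exact hR.shiftedRel (Or.inl rfl) (Or.inr rfl) ad₁)
    (by
      rw [e₁]
      change AdmitsRel 1 0 R _
      refine ⟨fun i j hij h => ?_, fun i j hij h => ?_⟩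
      · rcases hij with h1 | h1 | h1
        · omega
        · have := ad₁.rows _ _ h1.2 h1.1
          omega
        · have := ad₁.cols _ _ h1.2 h1.1
          omega
      · rcases hij with h1 | h1 | h1
        · omega
        · have := ad₁.rows _ _ h1.2 h1.1
          omega
        · have := ad₂.cols _ _ h1.2 h1.1
          omega)
  have hK' : IsShift .proP R N₂ K := by
    refine isShift_iff.2 ⟨isMoon_iff.1 h₂.moon_target,
      by rw [e₂]; exact hR.shiftedRel (Or.inr rfl) (Or.inl rfl) ad₂, ?_, ?_⟩
    · rw [e₂]
      change AdmitsRel 0 1 R _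
      refine ⟨fun i j hij h => ?_, fun i j hij h => ?_⟩
      · rcases hij with h1 | h1 | h1
        · omega
        · have := ad₁.rows _ _ h1.2 h1.1
          omega
        · have := ad₂.cols _ _ h1.2 h1.1
          omega
      · rcases hij with h1 | h1 | h1
        · omega
        · have := ad₂.rows _ _ h1.2 h1.1
          omega
        · have := ad₂.cols _ _ h1.2 h1.1
          omega
    · rw [(isShift_iff.1 hK).2.2.2, e₁, e₂]
      change shiftedRel 1 0 R (shiftedRel 0 1 R _) = shiftedRel 0 1 R (shiftedRel 1 0 R _)
      funext i j
      rw [eq_iff_iff]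
      constructor
      · rintro (h1 | ⟨h1, h2 | h2 | h2⟩ | ⟨h1, h2 | h2 | h2⟩)
        · exact Or.inl h1
        · omega
        · rw [add_zero] at h2
          exact Or.inr (Or.inl ⟨h1, Or.inr (Or.inl ⟨h1, by rw [add_zero]; exact h2.2⟩)⟩)
        · rw [add_zero, add_zero] at h2
          have := ad₂.cols _ _ h2.2 h2.1
          omega
        · omega
        · have := ad₁.rows _ _ h2.2 h2.1
          omega
        · rw [add_zero] at h2
          refine Or.inr (Or.inr ⟨h1, Or.inr (Or.inr ⟨h1, ?_⟩)⟩)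
          rw [add_zero]
          exact h2.2
      · rintro (h1 | ⟨h1, h2 | h2 | h2⟩ | ⟨h1, h2 | h2 | h2⟩)
        · exact Or.inl h1
        · omega
        · rw [add_zero] at h2
          refine Or.inr (Or.inl ⟨h1, Or.inr (Or.inl ⟨h1, ?_⟩)⟩)
          rw [add_zero]
          exact h2.2
        · have := ad₂.cols _ _ h2.2 h2.1
          omega
        · omega
        · rw [add_zero, add_zero] at h2
          have := ad₁.rows _ _ h2.2 h2.1
          omega
        · rw [add_zero] at h2
          refine Or.inr (Or.inr ⟨h1, Or.inr (Or.inr ⟨h1, ?_⟩)⟩)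
          rw [add_zero]
          exact h2.2
  refine ⟨K, hK, hK', ?_⟩
  funext x
  simp only [Function.comp_apply, shiftMap_eq_moveMap]
  have hKm := isMoon_iff.1 hK.moon_target
  have hKR : MaxRel R (boxRel K) := by
    have f := isShift_iff.1 hK
    rw [f.2.2.2]
    exact f.2.1.shiftedRel (Or.inr rfl) (Or.inl rfl) f.2.2.1
  refine ext_labelAt fun i j hij => ?_
  rcases hKR.outside hKm hij with h | h
  · by_cases h' : R.j₀ ≤ j ∧ j ≤ R.j₁
    · have hp : (i, j) ∈ R.boxes := Rectangle.mem_boxes.2 ⟨h, h'⟩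
      have f1 : (fun p : R.boxes => labelAt (moveMap (rectMap .proP R) .proP M N₁ x) p.1) =
          rectMap .proP R fun p => labelAt x p.1 :=
        funext fun p => labelAt_moveMap_of_mem h₁ _ _ p.2
      have f2 : (fun p : R.boxes => labelAt (moveMap (rectMap .proQ R) .proQ M N₂ x) p.1) =
          rectMap .proQ R fun p => labelAt x p.1 :=
        funext fun p => labelAt_moveMap_of_mem h₂ _ _ p.2
      rw [labelAt_moveMap_of_mem hK _ _ hp, labelAt_moveMap_of_mem hK' _ _ hp, f1, f2,
        ← Equiv.Perm.mul_apply, ← Equiv.Perm.mul_apply, (rectMap_commute R).eq]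
    · have f : boxRel N₁ (i + ShiftKind.proQ.rowStep) j := by
        rw [(isShift_iff.1 hK).2.2.2] at hij
        rcases hij with h1 | h1 | h1
        · exact absurd h1.2 h'
        · exact absurd h h1.1
        · exact h1.2
      have f' := ((isShift_iff.1 hK).2.1.outside (isMoon_iff.1 hK.moon_source) f).resolve_right h'
      have z : (ShiftKind.proP.rowStep : ℤ) = 0 := rfl
      rw [labelAt_moveMap_along hK _ _ h h', labelAt_moveMap_along hK' _ _ h h',
        labelAt_moveMap_along h₁ _ _ f' h', labelAt_moveMap_along h₂ _ _ (by omega) h',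
        add_right_comm]
  · by_cases h' : R.i₀ ≤ i ∧ i ≤ R.i₁
    · have hp : (i, j) ∈ R.boxes := Rectangle.mem_boxes.2 ⟨h', h⟩
      have f1 : (fun p : R.boxes => labelAt (moveMap (rectMap .proP R) .proP M N₁ x) p.1) =
          rectMap .proP R fun p => labelAt x p.1 :=
        funext fun p => labelAt_moveMap_of_mem h₁ _ _ p.2
      have f2 : (fun p : R.boxes => labelAt (moveMap (rectMap .proQ R) .proQ M N₂ x) p.1) =
          rectMap .proQ R fun p => labelAt x p.1 :=
        funext fun p => labelAt_moveMap_of_mem h₂ _ _ p.2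
      rw [labelAt_moveMap_of_mem hK _ _ hp, labelAt_moveMap_of_mem hK' _ _ hp, f1, f2,
        ← Equiv.Perm.mul_apply, ← Equiv.Perm.mul_apply, (rectMap_commute R).eq]
    · have f : boxRel N₂ i (j + ShiftKind.proP.colStep) := by
        rw [(isShift_iff.1 hK').2.2.2] at hij
        rcases hij with h1 | h1 | h1
        · exact absurd h1.1 h'
        · exact h1.2
        · exact absurd h h1.1
      have f' := ((isShift_iff.1 hK').2.1.outside (isMoon_iff.1 hK'.moon_source) f).resolve_left h'
      have z : (ShiftKind.proQ.colStep : ℤ) = 0 := rfl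
      rw [labelAt_moveMap_beside hK _ _ h' h, labelAt_moveMap_beside hK' _ _ h' h,
        labelAt_moveMap_beside h₁ _ _ h' (by omega), labelAt_moveMap_beside h₂ _ _ h' f',
        add_right_comm]

theorem ShiftStep.of_isShift (hk : k = .proP ∨ k = .proQ) (h : IsShift k R M N)
    (hmove : MovesRel k.rowStep k.colStep R (boxRel M)) : ShiftStep M N (shiftMap k R M N) :=
  ⟨k, R, hk, h, h.ne_iff.2 hmove, rfl⟩

/-- Local confluence of shifts. -/
theorem ShiftStep.diamond {f₁ : (M → ℝ) → N₁ → ℝ} {f₂ : (M → ℝ) → N₂ → ℝ}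
    (h₁ : ShiftStep M N₁ f₁) (h₂ : ShiftStep M N₂ f₂) :
    (⟨N₁, f₁⟩ : Σ N : Finset (ℤ × ℤ), (M → ℝ) → N → ℝ) = ⟨N₂, f₂⟩ ∨
    ∃ (K : Finset (ℤ × ℤ)) (g₁ : (N₁ → ℝ) → K → ℝ) (g₂ : (N₂ → ℝ) → K → ℝ),
      ShiftStep N₁ K g₁ ∧ ShiftStep N₂ K g₂ ∧ g₁ ∘ f₁ = g₂ ∘ f₂ := by
  obtain ⟨k₁, R₁, hk₁, s₁, hne₁, rfl⟩ := h₁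
  obtain ⟨k₂, R₂, hk₂, s₂, hne₂, rfl⟩ := h₂
  rw [s₁.ne_iff] at hne₁
  rw [s₂.ne_iff] at hne₂
  by_cases hR : R₁ = R₂
  · subst hR
    by_cases hk : k₁ = k₂
    · subst hk
      obtain rfl : N₁ = N₂ := by rw [s₁.image_eq, s₂.image_eq]
      exact Or.inl rfl
    · right
      have key : ∀ {N₁ N₂ : Finset (ℤ × ℤ)} (_ : IsShift .proP R₁ M N₁) (_ : IsShift .proQ R₁ M N₂)
          (_ : MovesRel 0 1 R₁ (boxRel M)) (_ : MovesRel 1 0 R₁ (boxRel M)),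
          ∃ (K : Finset (ℤ × ℤ)) (g₁ : (N₁ → ℝ) → K → ℝ) (g₂ : (N₂ → ℝ) → K → ℝ),
            ShiftStep N₁ K g₁ ∧ ShiftStep N₂ K g₂ ∧
            g₁ ∘ shiftMap .proP R₁ M N₁ = g₂ ∘ shiftMap .proQ R₁ M N₂ := by
        intro N₁ N₂ h₁ h₂ m₁ m₂
        obtain ⟨K, hK, hK', e⟩ := shiftMap_comm_same h₁ h₂
        have e₁ : boxRel N₁ = shiftedRel 0 1 R₁ _ := (isShift_iff.1 h₁).2.2.2
        have e₂ : boxRel N₂ = shiftedRel 1 0 R₁ _ := (isShift_iff.1 h₂).2.2.2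
        refine ⟨K, _, _, .of_isShift (Or.inr rfl) hK (Or.inr ⟨rfl, ?_⟩),
          .of_isShift (Or.inl rfl) hK' (Or.inl ⟨rfl, ?_⟩), e⟩
        · obtain ⟨i, j, hij, hj⟩ := (m₂.resolve_left fun h => zero_ne_one h.1).2
          exact ⟨i, j, by rw [e₁]; exact Or.inr (Or.inr ⟨hj, by rwa [add_zero]⟩), hj⟩
        · obtain ⟨i, j, hij, hi⟩ := (m₁.resolve_right fun h => zero_ne_one h.1).2
          exact ⟨i, j, by rw [e₂]; exact Or.inr (Or.inl ⟨hi, by rwa [add_zero]⟩), hi⟩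
      rcases hk₁ with rfl | rfl <;> rcases hk₂ with rfl | rfl
      · exact absurd rfl hk
      · exact key s₁ s₂ hne₁ hne₂
      · obtain ⟨K, g₁, g₂, a, b, c⟩ := key s₂ s₁ hne₂ hne₁
        exact ⟨K, g₂, g₁, b, a, c.symm⟩
      · exact absurd rfl hk
  · right
    obtain ⟨K, a, b, c⟩ := shiftMap_comm hR s₁ s₂
    obtain ⟨hm, m₁, -, -⟩ := isShift_iff.1 s₁
    obtain ⟨-, m₂, -, -⟩ := isShift_iff.1 s₂
    refine ⟨K, _, _, .of_isShift hk₂ a ?_, .of_isShift hk₁ b ?_, c⟩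
    · rcases m₁.crossing hm m₂ hR with ⟨d1, d2, d3, d4, d5, d6⟩ | ⟨d1, d2, d3, d4, d5, d6⟩
      · have hc : Crosses R₁ R₂ := ⟨d1, d2, d3, d4, d5, d6⟩
        rw [hc.follow]
        exact hne₂.lower hc s₁ s₂
      · have hc : Crosses R₂ R₁ := ⟨d1, d2, d3, d4, d5, d6⟩
        rw [hc.follow']
        exact hne₂.lower' hc s₂ s₁
    · rcases m₁.crossing hm m₂ hR with ⟨d1, d2, d3, d4, d5, d6⟩ | ⟨d1, d2, d3, d4, d5, d6⟩
      · have hc : Crosses R₁ R₂ := ⟨d1, d2, d3, d4, d5, d6⟩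
        rw [hc.follow']
        exact hne₁.lower' hc s₁ s₂
      · have hc : Crosses R₂ R₁ := ⟨d1, d2, d3, d4, d5, d6⟩
        rw [hc.follow]
        exact hne₁.lower hc s₂ s₁

theorem ShiftStep.bijective {f : (M → ℝ) → N → ℝ} (h : ShiftStep M N f) : Function.Bijective f := by
  obtain ⟨k, R, -, s, -, rfl⟩ := h
  exact moveMap_bijective s (rectMap k R)

theorem ShiftStep.mem_lowerBounds {f : (M → ℝ) → N → ℝ} (h : ShiftStep M N f) {c : ℤ × ℤ}
    (hc : c ∈ lowerBounds (M : Set (ℤ × ℤ))) : c ∈ lowerBounds (N : Set (ℤ × ℤ)) := by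
  obtain ⟨k, R, -, s, -, rfl⟩ := h
  exact s.mem_lowerBounds hc

theorem ShiftStep.totalHeight_lt {f : (M → ℝ) → N → ℝ} (h : ShiftStep M N f) {c : ℤ × ℤ}
    (hc : c ∈ lowerBounds (M : Set (ℤ × ℤ))) : totalHeight c N < totalHeight c M := by
  obtain ⟨k, R, -, s, hne, rfl⟩ := h
  exact s.totalHeight_lt hc (s.ne_iff.1 hne)

/-- `NormalForm M T C`: a sequence of shifts leads from `M` to `T`, where no further shift is possible,
and the composite of their maps is `C`. -/
inductive NormalForm : (M T : Finset (ℤ × ℤ)) → ((M → ℝ) → T → ℝ) → Prop where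
  | base {M : Finset (ℤ × ℤ)} (h : ∀ N f, ¬ShiftStep M N f) : NormalForm M M id
  | step {M N T : Finset (ℤ × ℤ)} {f : (M → ℝ) → N → ℝ} {C : (N → ℝ) → T → ℝ}
      (h : ShiftStep M N f) (hC : NormalForm N T C) : NormalForm M T (C ∘ f)

theorem NormalForm.bijective {T : Finset (ℤ × ℤ)} {C : (M → ℝ) → T → ℝ} (h : NormalForm M T C) :
    Function.Bijective C := by
  induction h with
  | base => exact Function.bijective_id
  | step h _ ih => exact ih.comp h.bijective

theorem NormalForm.exists (M : Finset (ℤ × ℤ)) : ∃ T C, NormalForm M T C := by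
  obtain ⟨c, hc⟩ := M.bddBelow
  induction hn : totalHeight c M using Nat.strong_induction_on generalizing M with
  | _ n ih =>
    by_cases h : ∃ N f, ShiftStep M N f
    · obtain ⟨N, f, h⟩ := h
      obtain ⟨T, C, hC⟩ := ih _ (hn ▸ h.totalHeight_lt hc) N (h.mem_lowerBounds hc) rfl
      exact ⟨T, _, hC.step h⟩
    · push Not at h
      exact ⟨M, id, .base h⟩

/-- Newman's argument by induction on the total height above a fixed bound, comparing terminal
polyominoes and maps at once. -/
theorem NormalForm.unique {T T' : Finset (ℤ × ℤ)} {C : (M → ℝ) → T → ℝ} {C' : (M → ℝ) → T' → ℝ}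
    (h : NormalForm M T C) (h' : NormalForm M T' C') :
    (⟨T, C⟩ : Σ T : Finset (ℤ × ℤ), (M → ℝ) → T → ℝ) = ⟨T', C'⟩ := by
  obtain ⟨c, hc⟩ := M.bddBelow
  induction hn : totalHeight c M using Nat.strong_induction_on generalizing M T T' with
  | _ n ih =>
    cases h with
    | base h =>
      cases h' with
      | base => rfl
      | step g _ => exact absurd g (h _ _)
    | step g₁ hC₁ =>
      cases h' with
      | base h => exact absurd g₁ (h _ _)
      | step g₂ hC₂ =>
        have lt₁ := hn ▸ g₁.totalHeight_lt hc
        have lt₂ := hn ▸ g₂.totalHeight_lt hc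
        rcases g₁.diamond g₂ with e | ⟨K, d₁, d₂, a, b, e⟩
        · cases e
          cases ih _ lt₁ hC₁ hC₂ (g₁.mem_lowerBounds hc) rfl
          rfl
        -- Any normal form of the common successor `K` extends to normal forms of both intermediate
        -- polyominoes; by induction these are the given ones.
        · obtain ⟨S, D, hD⟩ := NormalForm.exists K
          cases ih _ lt₁ hC₁ (hD.step a) (g₁.mem_lowerBounds hc) rfl
          cases ih _ lt₂ hC₂ (hD.step b) (g₂.mem_lowerBounds hc) rfl
          rw [Function.comp_assoc, e, Function.comp_assoc]

/-- The composite along a sequence of shifts is determined by the normal forms. -/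
theorem ShiftSeq.sends_iff {L : Finset (ℤ × ℤ)} (s : ShiftSeq L N) :
    ∃ (T : Finset (ℤ × ℤ)) (C : (L → ℝ) → T → ℝ) (C' : (N → ℝ) → T → ℝ), NormalForm L T C ∧
      NormalForm N T C' ∧ ∀ x y, s.Sends x y ↔ C x = C' y := by
  induction s with
  | nil =>
    obtain ⟨T, C, h⟩ := NormalForm.exists L
    exact ⟨T, C, C, h, h, fun x y => h.bijective.1.eq_iff.symm⟩
  | @shift M N _ k R hk h hne ih =>
    obtain ⟨T, C, C', h1, h2, h3⟩ := ih
    have st : ShiftStep M N (shiftMap k R M N) := ⟨k, R, hk, h, hne, rfl⟩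
    obtain ⟨S, D, hD⟩ := NormalForm.exists N
    -- The normal form of `M` may be taken through `N`, so its map factors through the shift.
    cases h2.unique (hD.step st)
    refine ⟨T, C, D, h1, hD, fun x y => ?_⟩
    simp only [ShiftSeq.Sends, h3]
    constructor
    · rintro ⟨z, hz, rfl⟩
      exact hz
    · intro hx
      -- Surjectivity of the shift supplies the intermediate labeling.
      obtain ⟨z, rfl⟩ := st.bijective.2 y
      exact ⟨z, hx, rfl⟩
  | @unshift M N _ k R hk h hne ih =>
    obtain ⟨T, C, C', h1, h2, h3⟩ := ih
    have st : ShiftStep N M (shiftMap k R N M) := ⟨k, R, hk, h, hne.symm, rfl⟩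
    refine ⟨T, C, _, h1, h2.step st, fun x y => ?_⟩
    simp only [ShiftSeq.Sends, h3]
    constructor
    · rintro ⟨z, hz, rfl⟩
      exact hz
    · exact fun hx => ⟨_, hx, rfl⟩

/-- The composite along a sequence of shifts depends only on its ends. -/
theorem ShiftSeq.exists_equiv {M N : Finset (ℤ × ℤ)} (s : ShiftSeq M N) :
    ∃ Ω : (M → ℝ) ≃ (N → ℝ), ∀ (t : ShiftSeq M N) (x : M → ℝ) (y : N → ℝ),
      t.Sends x y ↔ Ω x = y := by
  obtain ⟨T, C, C', h1, h2, -⟩ := s.sends_iff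
  refine ⟨(Equiv.ofBijective C h1.bijective).trans (Equiv.ofBijective C' h2.bijective).symm,
    fun t x y => ?_⟩
  obtain ⟨S, D, D', g1, g2, g3⟩ := t.sends_iff
  cases h1.unique g1
  cases h2.unique g2
  rw [g3, Equiv.trans_apply, Equiv.symm_apply_eq]
  rfl

end Confluence

theorem mainTheorem2 :
    (∀ (k₁ k₂ : ShiftKind) (R₁ R₂ : Rectangle) (M N₁ N₂ : Finset (ℤ × ℤ)),
      R₁ ≠ R₂ → IsShift k₁ R₁ M N₁ → IsShift k₂ R₂ M N₂ →
      ∃ K : Finset (ℤ × ℤ),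
        IsShift k₂ (follow k₁ R₁ R₂) N₁ K ∧ IsShift k₁ (follow k₂ R₂ R₁) N₂ K ∧
        shiftMap k₂ (follow k₁ R₁ R₂) N₁ K ∘ shiftMap k₁ R₁ M N₁ =
          shiftMap k₁ (follow k₂ R₂ R₁) N₂ K ∘ shiftMap k₂ R₂ M N₂) ∧
    (∀ (M N : Finset (ℤ × ℤ)) (s : ShiftSeq M N),
      ∃ Ω : (M → ℝ) ≃ (N → ℝ), ∀ (t : ShiftSeq M N) (x : M → ℝ) (y : N → ℝ),
        t.Sends x y ↔ Ω x = y) := by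
  exact ⟨fun _ _ _ _ _ _ _ hne h₁ h₂ => shiftMap_comm hne h₁ h₂, fun _ _ s => s.exists_equiv⟩
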